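/- Let $\Omega\subset\mathbb R^3$ be a bounded domain (nonempty, open, connected) with $C^\infty$ boundary $\Gamma=\partial\Omega$ and outward unit normal $\mathbf n$, and let $X=L^2(\Omega)\otimes\mathbb R^3$ be the real Hilbert space of square integrable vector fields on $\Omega$. Let $D_0$ be the set of vector fields $\mathbf A\in C^\infty(\overline\Omega)\otimes\mathbb R^3$ such that on $\Gamma$ $$\mathbf A_\parallel:=\mathbf A-(\mathbf n\cdot\mathbf A)\,\mathbf n=0,\qquad \mathbf n\cdot\nabla_{\mathbf n}\mathbf A=0 ,$$ and let $\mathcal A$ be the set of $\mathbf A\in H^1(\Omega)\otimes\mathbb R^3$ with $\mathbf A_\parallel=0$ on $\Gamma$ in the weak sense: $\int_\Omega\big[(\partial_jA_i-\partial_iA_j)\varphi+A_i\partial_j\varphi-A_j\partial_i\varphi\big]dx=0$ for all $i,j$ and all $\varphi\in C^\infty(\mathbb R^3)$. Then the following hold. 1. $D_0$ is dense in $X$, and the operator $\Lambda=-\Delta$ with domain $D_0$ is symmetric and nonnegative: $\langle\Lambda\mathbf A_1,\mathbf A_2\rangle=\langle\mathbf A_1,\Lambda\mathbf A_2\rangle$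 for $\mathbf A_1,\mathbf A_2\in D_0$ and $\langle\mathbf A,\Lambda\mathbf A\rangle\ge0$ for $\mathbf A\in D_0$. Moreover $$\langle\mathbf A,\Lambda\mathbf A\rangle=\sum_{k=1}^3\|\nabla_k\mathbf A\|^2,\qquad \mathbf A\in D_0 .$$ 2. $\Lambda$ admits a self-adjoint extension in $X$, again denoted $\Lambda$, with a domain $D\subset\mathcal A$. Its elements satisfy the condition $\mathbf n\cdot\nabla_{\mathbf n}\mathbf A=0$ on $\Gamma$ in the weak sense, that is, $\langle\Lambda\mathbf A,\mathbf v\rangle=\sum_k\langle\nabla_k\mathbf A,\nabla_k\mathbf v\rangle$ for all $\mathbf A\in D$ and $\mathbf v\in\mathcal A$. For every real $z<0$ the resolvent $(\Lambda-z)^{-1}$ exists and is a compact self-adjoint operator in $X$. The spectrum of $\Lambda$ is discrete: it consists of eigenvalues of finite multiplicity and has no finite accumulation point. There is $\delta>0$ such that $$\langle\mathbf A,\Lambda\mathbf A\rangle\ge\delta\|\mathbf A\|^2,\qquad\mathbf A\in D .$$ 3. There is a constant $C>0$, depending only on $\Omega$, such that $\|\mathbf A\|^2\le C\sum_{k=1}^3\|\nabla_k\mathbf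 A\|^2$ for all $\mathbf A\in\mathcal A$. -/

import Mathlib

open MeasureTheory Set Filter Topology
open scoped ContDiff InnerProductSpace

noncomputable section

namespace VectorLaplacian

/-- Euclidean three-space. -/
abbrev E3 : Type := EuclideanSpace ℝ (Fin 3)

/-! ### Bounded domains with smooth boundary -/

/-- `ρ` is a smooth defining function of `Ω` near `x`: its gradient at `x` is nonzero, and near `x`
the set `Ω` is `{ρ < 0}`. -/
def IsLocalDefiningFunction (Ω : Set E3) (x : E3) (ρ : E3 → ℝ) : Prop :=
  ContDiff ℝ ∞ ρ ∧ gradient ρ x ≠ 0 ∧ ∀ᶠ y in 𝓝 x, (y ∈ Ω ↔ ρ y < 0)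

/-- A bounded domain (nonempty, connected, open set) of `ℝ³` with `C^∞` boundary: near each
boundary point, `Ω` lies on one side of a smooth surface. -/
structure IsSmoothBoundedDomain (Ω : Set E3) : Prop where
  isOpen : IsOpen Ω
  isConnected : IsConnected Ω
  isBounded : Bornology.IsBounded Ω
  smooth_boundary : ∀ x ∈ frontier Ω, ∃ ρ : E3 → ℝ, IsLocalDefiningFunction Ω x ρ

/-- `n` is the outward unit normal to `∂Ω` at `x`. -/
def IsOutwardUnitNormal (Ω : Set E3) (x n : E3) : Prop :=
  ∃ ρ : E3 → ℝ, IsLocalDefiningFunction Ω x ρ ∧ n = ‖gradient ρ x‖⁻¹ • gradient ρ x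

theorem two_le_infty : (2 : WithTop ℕ∞) ≤ ∞ :=
  WithTop.coe_le_coe.2 (le_top : (2 : ℕ∞) ≤ ⊤)

/-! ### Smooth fields with the boundary conditions, and the operator `-Δ` on them -/

/-- The partial derivative `∂_k u` of a vector field. -/
def partialDeriv (k : Fin 3) (u : E3 → E3) (x : E3) : E3 :=
  fderiv ℝ u x (EuclideanSpace.single k 1)

/-- Vector fields which are smooth up to the boundary (restrictions to the closure of `Ω` of smooth
fields on `ℝ³`) and satisfy, at each boundary point with outward unit normal `n`, the two
conditions `u_∥ = u - (n · u) n = 0` and `∂_n u_n = n · (∂_n u) = 0`. -/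
def smoothFields (Ω : Set E3) : Submodule ℝ (E3 → E3) where
  carrier := {u | ContDiff ℝ ∞ u ∧ ∀ x ∈ frontier Ω, ∀ n, IsOutwardUnitNormal Ω x n →
    u x - ⟪n, u x⟫_ℝ • n = 0 ∧ ⟪n, fderiv ℝ u x n⟫_ℝ = 0}
  zero_mem' := by
    refine ⟨contDiff_const, fun x _ n _ => ⟨by simp, ?_⟩⟩
    have h : fderiv ℝ (0 : E3 → E3) x = 0 := fderiv_const_apply (0 : E3)
    rw [h]; simp
  add_mem' := by
    rintro u v ⟨hu, hu'⟩ ⟨hv, hv'⟩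
    refine ⟨hu.add hv, fun x hx n hn => ?_⟩
    obtain ⟨h1, h2⟩ := hu' x hx n hn
    obtain ⟨h3, h4⟩ := hv' x hx n hn
    constructor
    · have e : (u + v) x - ⟪n, (u + v) x⟫_ℝ • n
          = (u x - ⟪n, u x⟫_ℝ • n) + (v x - ⟪n, v x⟫_ℝ • n) := by
        simp only [Pi.add_apply, inner_add_right, add_smul]; abel
      rw [e, h1, h3, add_zero]
    · rw [fderiv_add (hu.differentiable (by simp) x) (hv.differentiable (by simp) x)]
      simp [inner_add_right, h2, h4]
  smul_mem' := by
    rintro c u ⟨hu, hu'⟩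
    refine ⟨contDiff_const.smul hu, fun x hx n hn => ?_⟩
    obtain ⟨h1, h2⟩ := hu' x hx n hn
    constructor
    · have e : (c • u) x - ⟪n, (c • u) x⟫_ℝ • n = c • (u x - ⟪n, u x⟫_ℝ • n) := by
        simp only [Pi.smul_apply, inner_smul_right, smul_sub, mul_smul]
      rw [e, h1, smul_zero]
    · rw [fderiv_const_smul (hu.differentiable (by simp) x)]
      simp [inner_smul_right, h2]

/-- The real Hilbert space `L²(Ω) ⊗ ℝ³`. -/
abbrev L2Field (Ω : Set E3) : Type := Lp E3 2 (volume.restrict Ω)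

/-- The graph, in `L²(Ω) ⊗ ℝ³`, of the operator `u ↦ -Δ u` on the fields of `smoothFields Ω`. -/
def laplacianGraph (Ω : Set E3) : Submodule ℝ (L2Field Ω × L2Field Ω) where
  carrier := {p | ∃ u ∈ smoothFields Ω, p.1 =ᵐ[volume.restrict Ω] u ∧
    p.2 =ᵐ[volume.restrict Ω] fun x => -Laplacian.laplacian u x}
  zero_mem' := by
    refine ⟨0, (smoothFields Ω).zero_mem, Lp.coeFn_zero _ _ _, ?_⟩
    filter_upwards [Lp.coeFn_zero E3 2 (volume.restrict Ω)] with x hx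
    have h : Laplacian.laplacian (0 : E3 → E3) x = 0 := by
      have := InnerProductSpace.laplacian_smul (𝕜 := ℝ) (0 : ℝ) (f := (0 : E3 → E3)) (x := x)
        contDiffAt_const
      simpa using this
    simpa [h] using hx
  add_mem' := by
    rintro p q ⟨u, hu, h1, h2⟩ ⟨v, hv, h3, h4⟩
    refine ⟨u + v, (smoothFields Ω).add_mem hu hv, ?_, ?_⟩
    · filter_upwards [Lp.coeFn_add p.1 q.1, h1, h3] with x hx hx1 hx3
      rw [Prod.fst_add, hx, Pi.add_apply, hx1, hx3, Pi.add_apply]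
    · filter_upwards [Lp.coeFn_add p.2 q.2, h2, h4] with x hx hx2 hx4
      have hl : Laplacian.laplacian (u + v) x
          = Laplacian.laplacian u x + Laplacian.laplacian v x :=
        ContDiffAt.laplacian_add (hu.1.contDiffAt.of_le two_le_infty)
          (hv.1.contDiffAt.of_le two_le_infty)
      rw [Prod.snd_add, hx, Pi.add_apply, hx2, hx4, hl, neg_add]
  smul_mem' := by
    rintro c p ⟨u, hu, h1, h2⟩
    refine ⟨c • u, (smoothFields Ω).smul_mem c hu, ?_, ?_⟩
    · filter_upwards [Lp.coeFn_smul c p.1, h1] with x hx hx1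
      rw [Prod.smul_fst, hx, Pi.smul_apply, hx1, Pi.smul_apply]
    · filter_upwards [Lp.coeFn_smul c p.2, h2] with x hx hx2
      have hl : Laplacian.laplacian (c • u) x = c • Laplacian.laplacian u x :=
        InnerProductSpace.laplacian_smul c (hu.1.contDiffAt.of_le two_le_infty)
      rw [Prod.smul_snd, hx, Pi.smul_apply, hx2, hl, smul_neg]

/-- The vector Laplacian `Λ = -Δ` as an unbounded operator in `L²(Ω) ⊗ ℝ³`, with domain `D₀` the
(classes of) fields of `smoothFields Ω`. -/
def vecLaplacian (Ω : Set E3) : L2Field Ω →ₗ.[ℝ] L2Field Ω :=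
  (laplacianGraph Ω).toLinearPMap

/-- The class of a field determines its Laplacian in `Ω`. -/
theorem laplacianGraph_functional {Ω : Set E3} (hΩ : IsOpen Ω) (p : L2Field Ω × L2Field Ω)
    (hp : p ∈ laplacianGraph Ω) (h0 : p.1 = 0) : p.2 = 0 := by
  obtain ⟨u, hu, h1, h2⟩ := hp
  have hu0 : u =ᵐ[volume.restrict Ω] fun _ => 0 := by
    rw [h0] at h1
    exact h1.symm.trans (Lp.coeFn_zero E3 2 (volume.restrict Ω))
  have heq : EqOn u (fun _ => 0) Ω :=
    Measure.eqOn_open_of_ae_eq hu0 hΩ hu.1.continuous.continuousOn continuousOn_const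
  refine Lp.ext ?_
  filter_upwards [h2, ae_restrict_mem hΩ.measurableSet,
    Lp.coeFn_zero E3 2 (volume.restrict Ω)] with x hx hxΩ hz
  have hev : u =ᶠ[𝓝 x] (0 : E3 → E3) := by
    filter_upwards [hΩ.mem_nhds hxΩ] with y hy using heq hy
  have h : Laplacian.laplacian (0 : E3 → E3) x = 0 := by
    have := InnerProductSpace.laplacian_smul (𝕜 := ℝ) (0 : ℝ) (f := (0 : E3 → E3)) (x := x)
      contDiffAt_const
    simpa using this
  rw [hx, (InnerProductSpace.laplacian_congr_nhds hev).eq_of_nhds, h, hz]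
  simp

theorem graph_vecLaplacian {Ω : Set E3} (hΩ : IsOpen Ω) :
    (vecLaplacian Ω).graph = laplacianGraph Ω :=
  Submodule.toLinearPMap_graph_eq _ (laplacianGraph_functional hΩ)

/-- Continuous fields are square integrable on bounded sets. -/
theorem memLp_of_continuous {Ω : Set E3} (hΩ : Bornology.IsBounded Ω) {u : E3 → E3}
    (hu : Continuous u) : MemLp u 2 (volume.restrict Ω) := by
  have hc : IsCompact (closure Ω) := hΩ.isCompact_closure
  obtain ⟨C, hC⟩ := hc.exists_bound_of_continuousOn hu.continuousOn
  have : IsFiniteMeasure (volume.restrict (closure Ω)) := ⟨by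
    rw [Measure.restrict_apply_univ]; exact hc.measure_lt_top⟩
  have h : MemLp u 2 (volume.restrict (closure Ω)) :=
    MemLp.of_bound hu.aestronglyMeasurable C
      ((ae_restrict_mem hc.measurableSet).mono fun x hx => hC x hx)
  exact h.mono_measure (Measure.restrict_mono subset_closure le_rfl)

/-- Every field of `smoothFields Ω` has an `L²` class in the domain of `vecLaplacian Ω`, on which the
operator is `-Δ`. -/
theorem exists_vecLaplacian_apply {Ω : Set E3} (hΩ : IsSmoothBoundedDomain Ω) {u : E3 → E3}
    (hu : u ∈ smoothFields Ω) :
    ∃ A : (vecLaplacian Ω).domain, (A : L2Field Ω) =ᵐ[volume.restrict Ω] u ∧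
      vecLaplacian Ω A =ᵐ[volume.restrict Ω] fun x => -Laplacian.laplacian u x := by
  have hc : Continuous fun x => -Laplacian.laplacian u x := by
    have h2 : Continuous (iteratedFDeriv ℝ 2 u) := hu.1.continuous_iteratedFDeriv two_le_infty
    rw [InnerProductSpace.laplacian_eq_iteratedFDeriv_orthonormalBasis u
      (EuclideanSpace.basisFun (Fin 3) ℝ)]
    fun_prop
  have hm1 := memLp_of_continuous hΩ.isBounded hu.1.continuous
  have hm2 := memLp_of_continuous hΩ.isBounded hc
  have hg : (hm1.toLp u, hm2.toLp _) ∈ (vecLaplacian Ω).graph := by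
    rw [graph_vecLaplacian hΩ.isOpen]
    exact ⟨u, hu, hm1.coeFn_toLp, hm2.coeFn_toLp⟩
  obtain ⟨A, hA1, hA2⟩ := (LinearPMap.mem_graph_iff _).1 hg
  refine ⟨A, ?_, ?_⟩
  · rw [hA1]; exact hm1.coeFn_toLp
  · rw [hA2]; exact hm2.coeFn_toLp

/-! ### Sobolev fields -/

/-- `G k ∈ L²` is the weak partial derivative `∂_k A` in `Ω`, for `k = 1, 2, 3`; such a `G` exists
exactly when `A ∈ H¹(Ω) ⊗ ℝ³`, and it is then unique. -/
def IsWeakGradient (Ω : Set E3) (A : L2Field Ω) (G : Fin 3 → L2Field Ω) : Prop :=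
  ∀ k : Fin 3, ∀ φ : E3 → ℝ, ContDiff ℝ ∞ φ → HasCompactSupport φ → tsupport φ ⊆ Ω →
    ∫ x in Ω, (fderiv ℝ φ x (EuclideanSpace.single k 1)) • A x = -∫ x in Ω, φ x • G k x

/-- For `A ∈ H¹(Ω) ⊗ ℝ³` with weak gradient `G`: the tangential part of `A` vanishes on `∂Ω`, that
is `n × A = 0`, in the weak sense. By the Stokes formula the integral below equals
`∫_{∂Ω} (n_j A_i - n_i A_j) φ`, so it asks that the components of `n × A` vanish. -/
def HasZeroTangentialPart (Ω : Set E3) (A : L2Field Ω) (G : Fin 3 → L2Field Ω) : Prop :=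
  ∀ i j : Fin 3, ∀ φ : E3 → ℝ, ContDiff ℝ ∞ φ →
    ∫ x in Ω, ((G j x i - G i x j) * φ x
      + (A x i * fderiv ℝ φ x (EuclideanSpace.single j 1)
        - A x j * fderiv ℝ φ x (EuclideanSpace.single i 1))) = 0

/-- `A ∈ H¹(Ω) ⊗ ℝ³` satisfies `-ΔA = F` in `Ω` with the boundary conditions `A_∥ = 0` and
`∂_n A_n = 0` on `∂Ω`, the second one in the weak sense: the boundary term `∫_{∂Ω} ∂_n A · v` of the
Green formula vanishes for all `v ∈ H¹(Ω) ⊗ ℝ³` which are normal to the boundary. -/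
def IsWeakSolution (Ω : Set E3) (A F : L2Field Ω) : Prop :=
  ∃ G : Fin 3 → L2Field Ω, IsWeakGradient Ω A G ∧ HasZeroTangentialPart Ω A G ∧
    ∀ (v : L2Field Ω) (H : Fin 3 → L2Field Ω),
      IsWeakGradient Ω v H → HasZeroTangentialPart Ω v H →
        ⟪F, v⟫_ℝ = ∑ k, ⟪G k, H k⟫_ℝ

/-! ### Spectrum of an unbounded operator -/

section Spectrum

variable {X : Type*} [NormedAddCommGroup X] [InnerProductSpace ℝ X]

/-- `R` is the bounded, everywhere defined inverse `(T - z)⁻¹`. -/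
def IsResolvent (T : X →ₗ.[ℝ] X) (z : ℝ) (R : X →L[ℝ] X) : Prop :=
  (∀ x : X, ∃ h : R x ∈ T.domain, T ⟨R x, h⟩ - z • R x = x) ∧
    ∀ x : T.domain, R (T x - z • (x : X)) = x

/-- The (real) spectrum of `T`. -/
def spectrumSet (T : X →ₗ.[ℝ] X) : Set ℝ :=
  {z | ¬ ∃ R : X →L[ℝ] X, IsResolvent T z R}

/-- The eigenspace `ker (T - z)`. -/
def eigenspaceOf (T : X →ₗ.[ℝ] X) (z : ℝ) : Submodule ℝ T.domain :=
  LinearMap.ker (T.toFun - z • T.domain.subtype)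

/-- The spectrum is discrete: it has no finite accumulation point and consists of eigenvalues of
finite multiplicity. -/
def HasDiscreteSpectrum (T : X →ₗ.[ℝ] X) : Prop :=
  (∀ r : ℝ, (spectrumSet T ∩ Icc (-r) r).Finite) ∧
    ∀ z ∈ spectrumSet T, eigenspaceOf T z ≠ ⊥ ∧ FiniteDimensional ℝ (eigenspaceOf T z)

end Spectrum

end VectorLaplacian

end

noncomputable section

open scoped Manifold

namespace VectorLaplacian

/-! ### Geometry of the boundary -/

/-! Let `V` be the space of `H¹` fields, paired with their weak gradients, that are weakly normal to
`∂Ω`. Its inner product is `⟪A, B⟫ + ∑ₖ ⟪∂ₖA, ∂ₖB⟫`, and `J : V → L²` forgets the gradient. The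
Dirichlet form is `⟪v, w⟫ - ⟪J v, J w⟫`. The theorem follows from four facts: `V` is complete, `J`
is compact, `J` has dense range, and a field of `V` with zero gradient vanishes.

Given these, `K = J J*` is compact, symmetric and injective, and `T = K⁻¹ - 1` is the Friedrichs
operator (`exists_operator_of_form`). Its resolvents come from the Fredholm alternative for `K`, its
spectrum from the eigenvalues of `K`. The Poincaré bound is a compactness argument
(`exists_coercivity_constant`), and it gives the coercivity of `T`. Green's formula
(`green_of_smoothFields`) says that `-Δ` on smooth fields is represented by the Dirichlet form, so
it is symmetric, satisfies the energy identity and is extended by `T`.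

No boundary traces are used. The divergence theorem is needed only as `∫_Ω div (f W) = 0` for a
weakly differentiable `f` and a smooth `W` tangential to `∂Ω` (`integral_divProd_eq_zero`). It is
proved by cutting off near the boundary: the error contains `∇ρ · W`, which vanishes on `∂Ω` and is
therefore `O(|ρ|)`, compensating the growing derivative of the cutoff. In Green's formula the
boundary term is formally `∑ nₖ vᵢ ∂ₖuᵢ`. Tangential parts of `∇uᵢ` drop out, normality of `v`
permits exchanging `nₖ vᵢ` with `nᵢ vₖ`, and what remains contains `n · ∂ₙu = 0`.

Compactness of `J` (`tendsto_zero_of_weakGradient_bounded`) avoids extension operators. By the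
uniform inner cone condition, a field can be compared with its averages over cones inside `Ω`. The
difference at scale `t` is dominated by a potential of the gradient whose `L²` norm is `O(t)` by a
Schur test, while averages at a fixed scale turn weak convergence into strong convergence. The same
comparison, with zero gradient, shows that a field with zero weak gradient is constant; a constant
field normal to the boundary is zero. -/

theorem contDiff_gradient {ρ : E3 → ℝ} (h : ContDiff ℝ ∞ ρ) : ContDiff ℝ ∞ (gradient ρ) := by
  have h1 : ContDiff ℝ ∞ (fderiv ℝ ρ) := h.fderiv_right (by simp)
  exact (InnerProductSpace.toDual ℝ E3).symm.contDiff.comp h1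

theorem IsLocalDefiningFunction.eventually {Ω : Set E3} {x : E3} {ρ : E3 → ℝ}
    (h : IsLocalDefiningFunction Ω x ρ) : ∀ᶠ y in 𝓝 x, IsLocalDefiningFunction Ω y ρ := by
  have h1 : ∀ᶠ y in 𝓝 x, gradient ρ y ≠ 0 :=
    (contDiff_gradient h.1).continuous.continuousAt.eventually_ne h.2.1
  filter_upwards [h1, h.2.2.eventually_nhds] with y hy1 hy2
  exact ⟨h.1, hy1, hy2⟩

theorem IsLocalDefiningFunction.outwardUnitNormal {Ω : Set E3} {x : E3} {ρ : E3 → ℝ}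
    (h : IsLocalDefiningFunction Ω x ρ) :
    IsOutwardUnitNormal Ω x (‖gradient ρ x‖⁻¹ • gradient ρ x) := ⟨ρ, h, rfl⟩

theorem IsLocalDefiningFunction.eq_zero {Ω : Set E3} (hΩ : IsOpen Ω) {x : E3} {ρ : E3 → ℝ}
    (h : IsLocalDefiningFunction Ω x ρ) (hx : x ∈ frontier Ω) : ρ x = 0 := by
  have hx1 : x ∉ Ω := by rw [hΩ.frontier_eq] at hx; exact hx.2
  have h1 : ¬ ρ x < 0 := fun hn => hx1 (h.2.2.self_of_nhds.2 hn)
  refine le_antisymm ?_ (not_lt.1 h1)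
  by_contra hpos
  have h2 : ∀ᶠ y in 𝓝 x, 0 < ρ y :=
    continuousAt_const.eventually_lt h.1.continuous.continuousAt (not_le.1 hpos)
  have h3 : ∃ᶠ y in 𝓝 x, y ∈ Ω := mem_closure_iff_frequently.1 (frontier_subset_closure hx)
  obtain ⟨y, hy, hy2, hy3⟩ := (h3.and_eventually (h2.and h.2.2)).exists
  exact absurd (hy3.1 hy) (not_lt.2 hy2.le)

theorem eventually_neg_of_fderiv_neg {ρ : E3 → ℝ} {x v : E3} (hρ : DifferentiableAt ℝ ρ x)
    (h0 : ρ x = 0) (hv : fderiv ℝ ρ x v < 0) : ∀ᶠ t in 𝓝[>] (0 : ℝ), ρ (x + t • v) < 0 := by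
  have hd : HasDerivAt (fun t : ℝ => ρ (x + t • v)) (fderiv ℝ ρ x v) 0 := by
    have h1 : HasDerivAt (fun t : ℝ => x + t • v) v 0 := by
      simpa using ((hasDerivAt_id (0 : ℝ)).smul_const v).const_add x
    have h2 : HasFDerivAt ρ (fderiv ℝ ρ x) (x + (0 : ℝ) • v) := by simpa using hρ.hasFDerivAt
    exact h2.comp_hasDerivAt 0 h1
  have h3 := (hasDerivWithinAt_iff_tendsto_slope' (s := Ioi (0 : ℝ)) (by simp)).1
    hd.hasDerivWithinAt
  filter_upwards [h3.eventually_lt_const hv, self_mem_nhdsWithin] with t ht ht0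
  have ht0' : (0 : ℝ) < t := ht0
  rw [slope_def_field] at ht
  simp only [zero_smul, add_zero, h0, sub_zero] at ht
  by_contra hc
  exact absurd ht (not_lt.2 (div_nonneg (not_lt.1 hc) ht0'.le))

/-- Moving from a zero of `ρ` against its gradient enters `{ρ < 0}`, so the zero is a limit of
points of `Ω`. -/
theorem IsLocalDefiningFunction.mem_frontier {Ω : Set E3} (hΩ : IsOpen Ω) {x : E3} {ρ : E3 → ℝ}
    (h : IsLocalDefiningFunction Ω x ρ) (h0 : ρ x = 0) : x ∈ frontier Ω := by
  rw [hΩ.frontier_eq]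
  refine ⟨?_, fun hx => by simpa [h0] using h.2.2.self_of_nhds.1 hx⟩
  have hneg : fderiv ℝ ρ x (-gradient ρ x) < 0 := by
    rw [← inner_gradient_left, inner_neg_right, neg_lt_zero, real_inner_self_eq_norm_sq]
    have := norm_pos_iff.2 h.2.1
    positivity
  have h1 := eventually_neg_of_fderiv_neg (h.1.differentiable (by simp) x) h0 hneg
  have ht : Tendsto (fun t : ℝ => x + t • (-gradient ρ x)) (𝓝[>] 0) (𝓝 x) := by
    have : Continuous (fun t : ℝ => x + t • (-gradient ρ x)) := by fun_prop
    simpa using (this.tendsto 0).mono_left nhdsWithin_le_nhds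
  refine mem_closure_of_frequently_of_tendsto (Eventually.frequently ?_) ht
  filter_upwards [h1, ht.eventually h.2.2] with t ht1 ht2 using ht2.2 ht1

/-- If `m ≠ n` are unit vectors, then `⟪m, n - m⟫ < 0 < ⟪n, n - m⟫`. A short step along `n - m`
therefore makes one defining function negative and the other positive, so the same point would lie
both in `Ω` and outside it. -/
theorem outwardUnitNormal_unique {Ω : Set E3} (hΩ : IsOpen Ω) {x m n : E3}
    (hx : x ∈ frontier Ω) (hm : IsOutwardUnitNormal Ω x m) (hn : IsOutwardUnitNormal Ω x n) :
    m = n := by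
  obtain ⟨ρ, hρ, rfl⟩ := hm
  obtain ⟨σ, hσ, rfl⟩ := hn
  set m := ‖gradient ρ x‖⁻¹ • gradient ρ x with hm
  set n := ‖gradient σ x‖⁻¹ • gradient σ x with hn
  have hρ0 : 0 < ‖gradient ρ x‖ := norm_pos_iff.2 hρ.2.1
  have hσ0 : 0 < ‖gradient σ x‖ := norm_pos_iff.2 hσ.2.1
  have hm1 : ‖m‖ = 1 := by rw [hm, norm_smul, norm_inv, norm_norm, inv_mul_cancel₀ hρ0.ne']
  have hn1 : ‖n‖ = 1 := by rw [hn, norm_smul, norm_inv, norm_norm, inv_mul_cancel₀ hσ0.ne']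
  by_contra hne
  have hlt : ⟪m, n⟫_ℝ < 1 := (inner_lt_one_iff_real_of_norm_eq_one hm1 hn1).2 hne
  have hgm : gradient ρ x = ‖gradient ρ x‖ • m := by
    rw [hm, smul_smul, mul_inv_cancel₀ hρ0.ne', one_smul]
  have hgn : gradient σ x = ‖gradient σ x‖ • n := by
    rw [hn, smul_smul, mul_inv_cancel₀ hσ0.ne', one_smul]
  have h1 : fderiv ℝ ρ x (n - m) < 0 := by
    rw [← inner_gradient_left, hgm, real_inner_smul_left, inner_sub_right,
      real_inner_self_eq_norm_sq, hm1]
    nlinarith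
  have h2 : fderiv ℝ (-σ) x (n - m) < 0 := by
    have : fderiv ℝ (-σ) x = -fderiv ℝ σ x := fderiv_neg
    rw [this, neg_apply, ← inner_gradient_left, hgn, real_inner_smul_left,
      inner_sub_right, real_inner_self_eq_norm_sq, hn1, real_inner_comm]
    nlinarith
  have e1 := eventually_neg_of_fderiv_neg (hρ.1.differentiable (by simp) x)
    (hρ.eq_zero hΩ hx) h1
  have e2 := eventually_neg_of_fderiv_neg (ρ := -σ) (hσ.1.neg.differentiable (by simp) x)
    (by simp [hσ.eq_zero hΩ hx]) h2
  have ht : Tendsto (fun t : ℝ => x + t • (n - m)) (𝓝[>] 0) (𝓝 x) := by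
    have : Continuous (fun t : ℝ => x + t • (n - m)) := by fun_prop
    simpa using (this.tendsto 0).mono_left nhdsWithin_le_nhds
  obtain ⟨t, h3, h4, h5, h6⟩ := (e1.and (e2.and ((ht.eventually hρ.2.2).and
    (ht.eventually hσ.2.2)))).exists
  have h7 := h6.1 (h5.2 h3)
  simp only [Pi.neg_apply] at h4
  linarith

/-- The outward unit normal has a smooth extension to the whole space. -/
theorem exists_smooth_normal {Ω : Set E3} (hΩ : IsSmoothBoundedDomain Ω) :
    ∃ N : E3 → E3, ContDiff ℝ ∞ N ∧
      ∀ x ∈ frontier Ω, ∀ n, IsOutwardUnitNormal Ω x n → n = N x := by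
  -- Off the boundary the constraint is void; on it, it fixes the value. Both constraints are
  -- convex, so local normals can be glued by a partition of unity.
  let t : E3 → Set E3 := fun x => {v | x ∈ frontier Ω → ∀ n, IsOutwardUnitNormal Ω x n → n = v}
  have hconv : ∀ x, Convex ℝ (t x) := by
    intro x v hv w hw a b _ _ hab hx n hn
    rw [← hv hx n hn, ← hw hx n hn, ← add_smul, hab, one_smul]
  obtain ⟨g, hg⟩ := exists_contMDiffMap_forall_mem_convex_of_local (n := ⊤) 𝓘(ℝ, E3) hconv (by
    intro x
    by_cases hx : x ∈ frontier Ω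
    · obtain ⟨ρ, hρ⟩ := hΩ.smooth_boundary x hx
      refine ⟨_, hρ.eventually, fun y => ‖gradient ρ y‖⁻¹ • gradient ρ y, ?_, ?_⟩
      · intro y hy
        refine ContMDiffAt.contMDiffWithinAt (ContDiffAt.contMDiffAt ?_)
        have h1 := (contDiff_gradient hρ.1).contDiffAt (x := y)
        exact ((h1.norm ℝ hy.2.1).inv (norm_ne_zero_iff.2 hy.2.1)).smul h1
      · intro y hy hyf n hn
        exact outwardUnitNormal_unique hΩ.isOpen hyf hn hy.outwardUnitNormal
    · refine ⟨(frontier Ω)ᶜ, isClosed_frontier.isOpen_compl.mem_nhds hx, fun _ => 0,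
        contMDiffOn_const, fun y hy hyf => absurd hyf hy⟩)
  exact ⟨g, g.contMDiff.contDiff, fun x hx n hn => hg x hx n hn⟩

/-- Uniform inner cone condition: short segments from a point of the closure in directions close to
the inward normal direction stay in the domain. -/
theorem exists_cone {Ω : Set E3} (hΩ : IsSmoothBoundedDomain Ω) {N : E3 → E3}
    (hN : Continuous N) (hNn : ∀ x ∈ frontier Ω, ∀ n, IsOutwardUnitNormal Ω x n → n = N x) :
    ∃ t₀ : ℝ, 0 < t₀ ∧ ∀ x ∈ Ω, ∀ s ∈ Ioc 0 t₀, ∀ y : E3, ‖y‖ ≤ 1 / 2 →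
      x + s • (y - N x) ∈ Ω := by
  have hc : IsCompact (closure Ω) := hΩ.isBounded.isCompact_closure
  have key : ∀ x₀ ∈ closure Ω, ∀ᶠ p : ℝ × E3 in 𝓝 0 ×ˢ 𝓝 x₀, p.2 ∈ Ω → 0 < p.1 →
      ∀ y : E3, ‖y‖ ≤ 1 / 2 → p.2 + p.1 • (y - N p.2) ∈ Ω := by
    intro x₀ hx₀
    -- The parameter `θ` runs along the segment from `p.2` to its endpoint; compactness in `(y, θ)`
    -- keeps all these segments in `U` at once.
    have hsmall : ∀ U ∈ 𝓝 x₀, ∀ᶠ p : ℝ × E3 in 𝓝 0 ×ˢ 𝓝 x₀,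
        ∀ y ∈ Metric.closedBall (0 : E3) (1 / 2), ∀ θ ∈ Icc (0 : ℝ) 1,
          p.2 + (θ * p.1) • (y - N p.2) ∈ U := by
      intro U hU
      have hK : IsCompact (Metric.closedBall (0 : E3) (1 / 2) ×ˢ Icc (0 : ℝ) 1) :=
        (isCompact_closedBall _ _).prod isCompact_Icc
      have := hK.eventually_forall_of_forall_eventually
        (x₀ := ((0 : ℝ), x₀))
        (P := fun (p : ℝ × E3) (q : E3 × ℝ) => p.2 + (q.2 * p.1) • (q.1 - N p.2) ∈ U) (by
          intro q hq
          have hcont : Continuous fun z : (ℝ × E3) × (E3 × ℝ) =>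
              z.1.2 + (z.2.2 * z.1.1) • (z.2.1 - N z.1.2) := by fun_prop
          have := hcont.tendsto ((0, x₀), q)
          simp only [mul_zero, zero_smul, add_zero] at this
          exact this hU)
      rw [nhds_prod_eq] at this
      filter_upwards [this] with p hp y hy θ hθ using hp (y, θ) ⟨hy, hθ⟩
    by_cases hx : x₀ ∈ Ω
    · filter_upwards [hsmall Ω (hΩ.isOpen.mem_nhds hx)] with p hp _ _ y hy
      simpa using hp y (by simpa using hy) 1 (by simp)
    · have hxf : x₀ ∈ frontier Ω := by rw [hΩ.isOpen.frontier_eq]; exact ⟨hx₀, hx⟩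
      obtain ⟨ρ, hρ⟩ := hΩ.smooth_boundary x₀ hxf
      have hg0 : 0 < ‖gradient ρ x₀‖ := norm_pos_iff.2 hρ.2.1
      have hgN : gradient ρ x₀ = ‖gradient ρ x₀‖ • N x₀ := by
        rw [← hNn x₀ hxf _ hρ.outwardUnitNormal, smul_smul, mul_inv_cancel₀ hg0.ne', one_smul]
      have hN1 : ‖N x₀‖ = 1 := by
        rw [← hNn x₀ hxf _ hρ.outwardUnitNormal, norm_smul, norm_inv, norm_norm,
          inv_mul_cancel₀ hg0.ne']
      -- The gradient and `N` are taken at independent points, since below the gradient is evaluated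
      -- along the segment and `N` at its start. The factor `1 / 2` is the size allowed for the
      -- perturbation `y`.
      have hder : ∀ᶠ q : E3 × E3 in 𝓝 x₀ ×ˢ 𝓝 x₀,
          ‖gradient ρ q.1‖ * (1 / 2) < ⟪gradient ρ q.1, N q.2⟫_ℝ := by
        rw [← nhds_prod_eq]
        have hcg := (contDiff_gradient hρ.1).continuous
        refine ContinuousAt.eventually_lt (f := fun q : E3 × E3 => ‖gradient ρ q.1‖ * (1 / 2))
          (g := fun q : E3 × E3 => ⟪gradient ρ q.1, N q.2⟫_ℝ) (by fun_prop) (by fun_prop) ?_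
        show ‖gradient ρ x₀‖ * (1 / 2) < ⟪gradient ρ x₀, N x₀⟫_ℝ
        conv_rhs => rw [hgN]
        rw [real_inner_smul_left, real_inner_self_eq_norm_sq, hN1]
        nlinarith
      obtain ⟨U, hU, V, hV, hUV⟩ := Filter.mem_prod_iff.1 hder
      have hU' : U ∩ {y | y ∈ Ω ↔ ρ y < 0} ∈ 𝓝 x₀ := inter_mem hU hρ.2.2
      have hV' : ∀ᶠ p : ℝ × E3 in 𝓝 0 ×ˢ 𝓝 x₀, p.2 ∈ V := tendsto_snd.eventually hV
      filter_upwards [hsmall _ hU', hV'] with p hp hpV hpΩ hp0 y hy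
      have hyb : y ∈ Metric.closedBall (0 : E3) (1 / 2) := by simpa using hy
      have hend := hp y hyb 1 (by simp)
      rw [one_mul] at hend
      refine hend.2.2 ?_
      have hstart := hp y hyb 0 (by simp)
      simp only [zero_mul, zero_smul, add_zero] at hstart
      have hneg : ρ p.2 < 0 := hstart.2.1 hpΩ
      -- Along the segment `ρ` cannot increase: `⟪∇ρ, y - N⟫ ≤ ‖∇ρ‖ / 2 - ⟪∇ρ, N⟫ < 0`. It starts
      -- negative, hence ends negative.
      let f : ℝ → ℝ := fun θ => ρ (p.2 + (θ * p.1) • (y - N p.2))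
      have hf : ∀ θ, HasDerivAt f
          (fderiv ℝ ρ (p.2 + (θ * p.1) • (y - N p.2)) (p.1 • (y - N p.2))) θ := by
        intro θ
        have h1 : HasDerivAt (fun θ : ℝ => p.2 + (θ * p.1) • (y - N p.2))
            (p.1 • (y - N p.2)) θ := by
          simpa using (((hasDerivAt_id θ).mul_const p.1).smul_const (y - N p.2)).const_add p.2
        exact ((hρ.1.differentiable (by simp) _).hasFDerivAt).comp_hasDerivAt θ h1
      have hanti : AntitoneOn f (Icc 0 1) := by
        refine antitoneOn_of_deriv_nonpos (convex_Icc 0 1)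
          (fun θ _ => (hf θ).continuousAt.continuousWithinAt)
          (fun θ _ => (hf θ).differentiableAt.differentiableWithinAt) ?_
        intro θ hθ
        rw [interior_Icc] at hθ
        rw [(hf θ).deriv, ← inner_gradient_left, real_inner_smul_right, inner_sub_right]
        have hq := hUV (show (p.2 + (θ * p.1) • (y - N p.2), p.2) ∈ U ×ˢ V from
          ⟨(hp y hyb θ ⟨hθ.1.le, hθ.2.le⟩).1, hpV⟩)
        simp only [mem_ofPred_eq] at hq
        have h2 := real_inner_le_norm (gradient ρ (p.2 + (θ * p.1) • (y - N p.2))) y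
        have h3 : ‖gradient ρ (p.2 + (θ * p.1) • (y - N p.2))‖ * ‖y‖
            ≤ ‖gradient ρ (p.2 + (θ * p.1) • (y - N p.2))‖ * (1 / 2) := by gcongr
        exact mul_nonpos_of_nonneg_of_nonpos hp0.le (by linarith)
      have h01 : f 1 ≤ f 0 := hanti (by simp) (by simp) zero_le_one
      simp only [f, one_mul, zero_mul, zero_smul, add_zero] at h01
      exact h01.trans_lt hneg
  have := hc.eventually_forall_of_forall_eventually (x₀ := (0 : ℝ))
    (P := fun s x => x ∈ Ω → 0 < s → ∀ y : E3, ‖y‖ ≤ 1 / 2 → x + s • (y - N x) ∈ Ω)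
    (fun x hx => by rw [nhds_prod_eq]; exact key x hx)
  obtain ⟨ε, hε, hball⟩ := Metric.eventually_nhds_iff.1 this
  refine ⟨ε / 2, by positivity, fun x hx s hs y hy => ?_⟩
  refine hball (y := s) ?_ x (subset_closure hx) hx hs.1 y hy
  rw [Real.dist_eq, sub_zero, abs_of_pos hs.1]
  linarith [hs.2]

end VectorLaplacian

end

noncomputable section

open scoped Manifold

namespace VectorLaplacian

/-! ### The divergence theorem for tangential fields -/

/-- The `k`-th vector of the standard basis. -/
abbrev stdVec (k : Fin 3) : E3 := EuclideanSpace.single k (1 : ℝ)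

theorem integrableOn_continuous_mul {Ω : Set E3} (hΩ : IsOpen Ω) (hb : Bornology.IsBounded Ω)
    {f c : E3 → ℝ} (hf : IntegrableOn f Ω) (hc : Continuous c) :
    IntegrableOn (fun x => c x * f x) Ω := by
  obtain ⟨C, hC⟩ := hb.isCompact_closure.exists_bound_of_continuousOn hc.continuousOn
  refine Integrable.bdd_mul (c := C) hf hc.aestronglyMeasurable ?_
  filter_upwards [ae_restrict_mem hΩ.measurableSet] with x hx using hC x (subset_closure hx)

theorem continuous_fderiv_apply_const {c : E3 → ℝ} (hc : ContDiff ℝ ∞ c) (v : E3) :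
    Continuous fun x => fderiv ℝ c x v :=
  (hc.continuous_fderiv (by simp)).clm_apply continuous_const

theorem contDiff_fderiv_apply_const {c : E3 → ℝ} (hc : ContDiff ℝ ∞ c) (v : E3) :
    ContDiff ℝ ∞ fun x => fderiv ℝ c x v :=
  ContDiff.clm_apply (hc.fderiv_right (m := ∞) (by simp)) contDiff_const

/-- `g k` is the weak partial derivative `∂_k f` in `Ω` of the scalar function `f`. -/
def IsScalarWeakGradient (Ω : Set E3) (f : E3 → ℝ) (g : Fin 3 → E3 → ℝ) : Prop :=
  IntegrableOn f Ω ∧ (∀ k, IntegrableOn (g k) Ω) ∧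
    ∀ k : Fin 3, ∀ φ : E3 → ℝ, ContDiff ℝ ∞ φ → HasCompactSupport φ → tsupport φ ⊆ Ω →
      ∫ x in Ω, fderiv ℝ φ x (stdVec k) * f x = -∫ x in Ω, φ x * g k x

/-- The divergence of `f W`, where `g` is the gradient of `f`. -/
def divProd (f : E3 → ℝ) (g W : Fin 3 → E3 → ℝ) (x : E3) : ℝ :=
  ∑ k, (fderiv ℝ (W k) x (stdVec k) * f x + W k x * g k x)

theorem integrableOn_divProd {Ω : Set E3} (hΩ : IsOpen Ω) (hb : Bornology.IsBounded Ω)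
    {f : E3 → ℝ} {g W : Fin 3 → E3 → ℝ} (h : IsScalarWeakGradient Ω f g)
    (hW : ∀ k, ContDiff ℝ ∞ (W k)) : IntegrableOn (divProd f g W) Ω := by
  refine integrable_finsetSum _ fun k _ => Integrable.add ?_ ?_
  · exact integrableOn_continuous_mul hΩ hb h.1 (continuous_fderiv_apply_const (hW k) _)
  · exact integrableOn_continuous_mul hΩ hb (h.2.1 k) (hW k).continuous

theorem integral_divProd_of_tsupport_subset {Ω : Set E3} (hΩ : IsOpen Ω)
    (hb : Bornology.IsBounded Ω) {f : E3 → ℝ} {g W : Fin 3 → E3 → ℝ}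
    (h : IsScalarWeakGradient Ω f g) (hW : ∀ k, ContDiff ℝ ∞ (W k))
    (hs : ∀ k, tsupport (W k) ⊆ Ω) : ∫ x in Ω, divProd f g W x = 0 := by
  unfold divProd
  have h1 : ∀ k, IntegrableOn (fun x => fderiv ℝ (W k) x (stdVec k) * f x) Ω := fun k =>
    integrableOn_continuous_mul hΩ hb h.1 (continuous_fderiv_apply_const (hW k) _)
  have h2 : ∀ k, IntegrableOn (fun x => W k x * g k x) Ω := fun k =>
    integrableOn_continuous_mul hΩ hb (h.2.1 k) (hW k).continuous
  rw [integral_finsetSum _ fun k _ => by exact (h1 k).add (h2 k)]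
  refine Finset.sum_eq_zero fun k _ => ?_
  have hcs : HasCompactSupport (W k) :=
    hb.isCompact_closure.of_isClosed_subset (isClosed_tsupport _) ((hs k).trans subset_closure)
  rw [integral_add (h1 k) (h2 k), h.2.2 k (W k) (hW k) hcs (hs k), neg_add_cancel]

/-- Used for the boundary cutoffs: the derivative of a rescaled transition lives in a thin layer and
grows only like the inverse thickness. -/
theorem exists_bound_deriv_smoothTransition :
    ∃ K : ℝ, ∀ t : ℝ, |deriv Real.smoothTransition t| ≤ K ∧
      (deriv Real.smoothTransition t ≠ 0 → t ∈ Icc (0 : ℝ) 1) := by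
  have hcont : Continuous (deriv Real.smoothTransition) :=
    (Real.smoothTransition.contDiff (n := 1)).continuous_deriv le_rfl
  obtain ⟨K, hK⟩ := (isCompact_Icc (a := (0 : ℝ)) (b := 1)).exists_bound_of_continuousOn
    hcont.continuousOn
  have hz : ∀ t ∉ Icc (0 : ℝ) 1, deriv Real.smoothTransition t = 0 := by
    intro t ht
    rw [mem_Icc, not_and_or, not_le, not_le] at ht
    rcases ht with ht | ht
    · have : Real.smoothTransition =ᶠ[𝓝 t] fun _ => 0 := by
        filter_upwards [Iio_mem_nhds ht] with s hs
        exact Real.smoothTransition.zero_of_nonpos (le_of_lt hs)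
      rw [this.deriv_eq, deriv_const]
    · have : Real.smoothTransition =ᶠ[𝓝 t] fun _ => 1 := by
        filter_upwards [Ioi_mem_nhds ht] with s hs
        exact Real.smoothTransition.one_of_one_le (le_of_lt hs)
      rw [this.deriv_eq, deriv_const]
  refine ⟨K, fun t => ⟨?_, fun h => by_contra fun h' => h (hz t h')⟩⟩
  by_cases ht : t ∈ Icc (0 : ℝ) 1
  · exact hK t ht
  · rw [hz t ht, abs_zero]
    exact (norm_nonneg _).trans (hK 0 (by simp))

theorem gradient_apply_eq_fderiv (ρ : E3 → ℝ) (x : E3) (k : Fin 3) :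
    gradient ρ x k = fderiv ℝ ρ x (stdVec k) := by
  rw [← inner_gradient_left, EuclideanSpace.inner_single_right]
  simp

/-- Near a boundary point, a smooth function vanishing on the boundary is bounded by the defining
function. -/
theorem exists_nhds_abs_le_of_vanish {Ω : Set E3} (hΩ : IsOpen Ω) {x₀ : E3} {ρ : E3 → ℝ}
    (hρ : IsLocalDefiningFunction Ω x₀ ρ) (hx₀ : x₀ ∈ frontier Ω) :
    ∃ r : ℝ, 0 < r ∧ (∀ y ∈ Metric.ball x₀ r, IsLocalDefiningFunction Ω y ρ) ∧
      ∀ q : E3 → ℝ, ContDiff ℝ ∞ q →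
        (∀ y ∈ frontier Ω, IsLocalDefiningFunction Ω y ρ → q y = 0) →
        ∃ C : ℝ, ∀ y ∈ Metric.ball x₀ r ∩ Ω, |q y| ≤ C * |ρ y| := by
  set ν := gradient ρ x₀ with hν
  have hν0 : 0 < ‖ν‖ := norm_pos_iff.2 hρ.2.1
  -- Half the rate at which `ρ` grows along `ν` at `x₀`; it remains a lower bound for this rate
  -- nearby.
  set c := ‖ν‖ ^ 2 / 2 with hc
  have hc0 : 0 < c := by positivity
  have hd : ∀ᶠ y in 𝓝 x₀, c < fderiv ℝ ρ y ν := by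
    refine continuousAt_const.eventually_lt (continuous_fderiv_apply_const hρ.1 ν).continuousAt ?_
    rw [← inner_gradient_left, ← hν, real_inner_self_eq_norm_sq, hc]
    nlinarith [sq_pos_of_pos hν0]
  obtain ⟨r, hr0, hr⟩ := Metric.eventually_nhds_iff_ball.1 (hρ.eventually.and hd)
  have hρ0 : ρ x₀ = 0 := hρ.eq_zero hΩ hx₀
  have hsm : ∀ᶠ y in 𝓝 x₀, |ρ y| / c * ‖ν‖ < r / 4 := by
    have : Continuous fun y => |ρ y| / c * ‖ν‖ := by
      have := hρ.1.continuous
      fun_prop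
    refine this.continuousAt.eventually_lt continuousAt_const ?_
    simp only [hρ0, abs_zero, zero_div, zero_mul]
    positivity
  obtain ⟨r', hr0', hr'⟩ := Metric.eventually_nhds_iff_ball.1 hsm
  refine ⟨min r' (r / 4), by positivity, fun y hy => (hr y ?_).1, fun q hq hq0 => ?_⟩
  · exact Metric.ball_subset_ball ((min_le_right _ _).trans (by linarith)) hy
  obtain ⟨L, hL⟩ := (isCompact_closedBall x₀ r).exists_bound_of_continuousOn
    (hq.continuous_fderiv (by simp)).continuousOn
  have hL0 : 0 ≤ L := (norm_nonneg _).trans (hL x₀ (by simp [hr0.le]))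
  refine ⟨L * ‖ν‖ / c, fun y hy => ?_⟩
  have hy1 : dist y x₀ < r / 4 := lt_of_lt_of_le hy.1 (min_le_right _ _)
  have hyr : y ∈ Metric.ball x₀ r := lt_trans hy1 (by linarith)
  have hys := hr' y (Metric.ball_subset_ball (min_le_left _ _) hy.1)
  have hyneg : ρ y < 0 := (hr y hyr).1.2.2.self_of_nhds.1 hy.2
  -- Since `ρ` grows at rate at least `c` along `ν`, time `h` suffices to climb from `ρ y < 0` to a
  -- nonnegative value. The crossing point is on the boundary, where `q` vanishes, and the Lipschitz
  -- bound for `q` over this distance gives the estimate.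
  set h := |ρ y| / c with hh
  have hh0 : 0 ≤ h := by positivity
  have hseg : ∀ s ∈ Icc 0 h, y + s • ν ∈ Metric.ball x₀ r := by
    intro s hs
    have h1 : dist (y + s • ν) y ≤ h * ‖ν‖ := by
      rw [dist_eq_norm, add_sub_cancel_left, norm_smul, Real.norm_eq_abs, abs_of_nonneg hs.1]
      gcongr
      exact hs.2
    have h2 := dist_triangle (y + s • ν) y x₀
    rw [Metric.mem_ball]
    linarith
  let p : ℝ → ℝ := fun s => ρ (y + s • ν)
  have hp : ∀ s, HasDerivAt p (fderiv ℝ ρ (y + s • ν) ν) s := by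
    intro s
    have h1 : HasDerivAt (fun s : ℝ => y + s • ν) ν s := by
      simpa using ((hasDerivAt_id s).smul_const ν).const_add y
    exact ((hρ.1.differentiable (by simp) _).hasFDerivAt).comp_hasDerivAt s h1
  have hpc : ContinuousOn p (Icc 0 h) := fun s _ => (hp s).continuousAt.continuousWithinAt
  have hend : 0 ≤ p h := by
    have := (convex_Icc (0 : ℝ) h).mul_sub_le_image_sub_of_le_deriv hpc
      (fun s _ => (hp s).differentiableAt.differentiableWithinAt) (C := c) (by
        intro s hs
        rw [interior_Icc] at hs
        rw [(hp s).deriv]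
        exact (hr _ (hseg s ⟨hs.1.le, hs.2.le⟩)).2.le) 0 (by simp [hh0]) h (by simp [hh0]) hh0
    have h3 : c * (h - 0) = |ρ y| := by rw [hh, sub_zero]; field_simp
    have h4 : p 0 = ρ y := by simp [p]
    rw [h3, h4, abs_of_neg hyneg] at this
    linarith
  obtain ⟨s, hs, hs0⟩ := intermediate_value_Icc hh0 hpc
    (show (0 : ℝ) ∈ Icc (p 0) (p h) from ⟨by simpa [p] using hyneg.le, hend⟩)
  have hb := (hr _ (hseg s hs)).1
  have hqb : q (y + s • ν) = 0 := hq0 _ (hb.mem_frontier hΩ hs0) hb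
  have hlip := (convex_closedBall x₀ r).norm_image_sub_le_of_norm_fderiv_le (𝕜 := ℝ)
    (fun z _ => hq.differentiable (by simp) z) hL
    (Metric.ball_subset_closedBall (hseg s hs)) (Metric.ball_subset_closedBall hyr)
  rw [hqb, sub_zero, Real.norm_eq_abs] at hlip
  have hn : ‖y - (y + s • ν)‖ = s * ‖ν‖ := by
    rw [sub_add_cancel_left, norm_neg, norm_smul, Real.norm_eq_abs, abs_of_nonneg hs.1]
  rw [hn] at hlip
  calc |q y| ≤ L * (s * ‖ν‖) := hlip
    _ ≤ L * (h * ‖ν‖) := by gcongr; exact hs.2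
    _ = L * ‖ν‖ / c * |ρ y| := by rw [hh]; ring

/-- The field `W` is tangential on the boundary of `Ω`. -/
def IsTangential (Ω : Set E3) (W : Fin 3 → E3 → ℝ) : Prop :=
  ∀ x ∈ frontier Ω, ∀ n, IsOutwardUnitNormal Ω x n → ∑ k, n k * W k x = 0

/-- Replace `W` by `χₘ W` with cutoffs `χₘ` vanishing near the boundary; the interior case applies
to these. The term `f ∇χₘ · W` is bounded by a multiple of `|f|`, because tangency makes `∇ρ · W =
O(|ρ|)`, and it tends to zero pointwise. Dominated convergence concludes. -/
theorem exists_nhds_integral_divProd {Ω : Set E3} (hΩ : IsOpen Ω)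
    (hb : Bornology.IsBounded Ω) {x₀ : E3} {ρ : E3 → ℝ}
    (hρ : IsLocalDefiningFunction Ω x₀ ρ) (hx₀ : x₀ ∈ frontier Ω)
    {f : E3 → ℝ} {g : Fin 3 → E3 → ℝ} (h : IsScalarWeakGradient Ω f g) :
    ∃ U : Set E3, IsOpen U ∧ x₀ ∈ U ∧ ∀ W : Fin 3 → E3 → ℝ, (∀ k, ContDiff ℝ ∞ (W k)) →
      IsTangential Ω W → (∀ k, tsupport (W k) ⊆ U) → ∫ x in Ω, divProd f g W x = 0 := by
  obtain ⟨r, hr0, hr, hq⟩ := exists_nhds_abs_le_of_vanish hΩ hρ hx₀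
  refine ⟨Metric.ball x₀ r, Metric.isOpen_ball, Metric.mem_ball_self hr0, fun W hW ht hs => ?_⟩
  let q : E3 → ℝ := fun y => ∑ k, fderiv ℝ ρ y (stdVec k) * W k y
  have hqs : ContDiff ℝ ∞ q :=
    ContDiff.sum fun k _ => (contDiff_fderiv_apply_const hρ.1 _).mul (hW k)
  obtain ⟨C, hC⟩ := hq q hqs (by
    intro y hy hyρ
    have h1 := ht y hy _ hyρ.outwardUnitNormal
    have h2 : ∑ k, (‖gradient ρ y‖⁻¹ • gradient ρ y) k * W k y = ‖gradient ρ y‖⁻¹ * q y := by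
      simp only [q, Finset.mul_sum, PiLp.smul_apply, smul_eq_mul, gradient_apply_eq_fderiv,
        mul_assoc]
    rw [h2] at h1
    exact (mul_eq_zero.1 h1).resolve_left (inv_ne_zero (norm_ne_zero_iff.2 hyρ.2.1)))
  obtain ⟨K, hK⟩ := exists_bound_deriv_smoothTransition
  have hK0 : 0 ≤ K := (abs_nonneg _).trans (hK 0).1
  let S := Real.smoothTransition
  -- With this choice `χ m` is `0` where `-ρ ≤ 1 / (m + 1)` and `1` where `-ρ ≥ 2 / (m + 1)`. The
  -- shift by `1` keeps the support of `χ m` strictly inside `{ρ < 0}`.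
  let τ : ℕ → E3 → ℝ := fun m y => -((m + 1 : ℕ) : ℝ) * ρ y - 1
  have hτ : ∀ m, ContDiff ℝ ∞ (τ m) := fun m => (contDiff_const.mul hρ.1).sub contDiff_const
  let χ : ℕ → E3 → ℝ := fun m y => S (τ m y)
  have hχ : ∀ m, ContDiff ℝ ∞ (χ m) := fun m => Real.smoothTransition.contDiff.comp (hτ m)
  have hdχ : ∀ m y v, fderiv ℝ (χ m) y v
      = deriv S (τ m y) * (-((m + 1 : ℕ) : ℝ) * fderiv ℝ ρ y v) := by
    intro m y v
    have h1 : HasFDerivAt (τ m) (-((m + 1 : ℕ) : ℝ) • fderiv ℝ ρ y) y :=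
      ((hρ.1.differentiable (by simp) y).hasFDerivAt.const_mul _).sub_const 1
    have h2 : HasDerivAt S (deriv S (τ m y)) (τ m y) :=
      ((Real.smoothTransition.contDiff (n := 1)).differentiable one_ne_zero _).hasDerivAt
    have h3 : HasFDerivAt (χ m) (deriv S (τ m y) • (-((m + 1 : ℕ) : ℝ) • fderiv ℝ ρ y)) y :=
      h2.comp_hasFDerivAt y h1
    rw [h3.fderiv]
    simp
  have hzero : ∀ y ∉ Metric.ball x₀ r, ∀ k, W k y = 0 ∧ fderiv ℝ (W k) y = 0 := by
    intro y hy k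
    have hy' : y ∉ tsupport (W k) := fun hh => hy (hs k hh)
    exact ⟨image_eq_zero_of_notMem_tsupport hy',
      image_eq_zero_of_notMem_tsupport fun hh => hy' (tsupport_fderiv_subset ℝ hh)⟩
  have hexp : ∀ m y, divProd f g (fun k y => χ m y * W k y) y
      = χ m y * divProd f g W y
        + f y * (deriv S (τ m y) * (-((m + 1 : ℕ) : ℝ) * q y)) := by
    intro m y
    have h1 : ∀ k, fderiv ℝ (fun y => χ m y * W k y) y (stdVec k)
        = χ m y * fderiv ℝ (W k) y (stdVec k) + fderiv ℝ (χ m) y (stdVec k) * W k y := by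
      intro k
      rw [fderiv_fun_mul ((hχ m).differentiable (by simp) y) ((hW k).differentiable (by simp) y)]
      simp [mul_comm]
    simp only [divProd, h1, hdχ, q, Finset.mul_sum, ← Finset.sum_add_distrib]
    refine Finset.sum_congr rfl fun k _ => ?_
    ring
  have hint0 : ∀ m, ∫ x in Ω, divProd f g (fun k y => χ m y * W k y) x = 0 := by
    intro m
    refine integral_divProd_of_tsupport_subset hΩ hb h (fun k => (hχ m).mul (hW k)) fun k => ?_
    intro y hy
    have hyU : y ∈ Metric.ball x₀ r := hs k (tsupport_mul_subset_right hy)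
    have hyχ : y ∈ {y | ρ y ≤ -((m + 1 : ℕ) : ℝ)⁻¹} := by
      refine closure_minimal ?_ (isClosed_le hρ.1.continuous continuous_const)
        (tsupport_mul_subset_left hy)
      intro z hz
      by_contra hcon
      refine hz (Real.smoothTransition.zero_of_nonpos ?_)
      simp only [mem_ofPred_eq, not_le] at hcon
      have hm : (0 : ℝ) < ((m + 1 : ℕ) : ℝ) := by positivity
      have := mul_lt_mul_of_pos_left hcon hm
      rw [mul_neg, mul_inv_cancel₀ hm.ne'] at this
      simp only [τ]
      linarith
    refine (hr y hyU).2.2.self_of_nhds.2 (lt_of_le_of_lt hyχ ?_)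
    rw [neg_lt_zero]
    positivity
  have hlim : Tendsto (fun m => ∫ x in Ω, divProd f g (fun k y => χ m y * W k y) x) atTop
      (𝓝 (∫ x in Ω, divProd f g W x)) := by
    refine tendsto_integral_of_dominated_convergence
      (fun y => |divProd f g W y| + |f y| * (K * (2 * |C|))) ?_ ?_ ?_ ?_
    · intro m
      exact (integrableOn_divProd hΩ hb h fun k => (hχ m).mul (hW k)).aestronglyMeasurable
    · exact (integrableOn_divProd hΩ hb h hW).abs.add (h.1.abs.mul_const _)
    · intro m
      filter_upwards [ae_restrict_mem hΩ.measurableSet] with y hy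
      rw [hexp, Real.norm_eq_abs]
      refine (abs_add_le _ _).trans (add_le_add ?_ ?_)
      · rw [abs_mul, abs_of_nonneg (Real.smoothTransition.nonneg _)]
        exact mul_le_of_le_one_left (abs_nonneg _) (Real.smoothTransition.le_one _)
      · rw [abs_mul]
        refine mul_le_mul_of_nonneg_left ?_ (abs_nonneg _)
        rw [abs_mul]
        by_cases hS : deriv S (τ m y) = 0
        · rw [hS, abs_zero, zero_mul]; positivity
        · refine mul_le_mul (hK _).1 ?_ (abs_nonneg _) hK0
          by_cases hyU : y ∈ Metric.ball x₀ r
          · have h1 := ((hK (τ m y)).2 hS).2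
            have h2 := hC y ⟨hyU, hy⟩
            have h3 : ρ y < 0 := (hr y hyU).2.2.self_of_nhds.1 hy
            have h4 : |ρ y| = -ρ y := abs_of_neg h3
            rw [abs_mul, abs_neg, abs_of_nonneg (Nat.cast_nonneg _)]
            -- The derivative of the cutoff is nonzero only where `τ m y ≤ 1`; this is where the `2`
            -- of the dominating function comes from.
            have h5 : ((m + 1 : ℕ) : ℝ) * |ρ y| ≤ 2 := by
              rw [h4]; simp only [τ] at h1; linarith
            calc ((m + 1 : ℕ) : ℝ) * |q y| ≤ ((m + 1 : ℕ) : ℝ) * (|C| * |ρ y|) := by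
                  gcongr
                  exact h2.trans (by gcongr; exact le_abs_self C)
              _ = (((m + 1 : ℕ) : ℝ) * |ρ y|) * |C| := by ring
              _ ≤ 2 * |C| := by gcongr
          · have : q y = 0 := Finset.sum_eq_zero fun k _ => by rw [(hzero y hyU k).1, mul_zero]
            rw [this, mul_zero, abs_zero]
            positivity
    · filter_upwards [ae_restrict_mem hΩ.measurableSet] with y hy
      simp only [hexp]
      by_cases hyU : y ∈ Metric.ball x₀ r
      · have h3 : ρ y < 0 := (hr y hyU).2.2.self_of_nhds.1 hy
        have h4 : Tendsto (fun m : ℕ => τ m y) atTop atTop := by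
          have : Tendsto (fun m : ℕ => ((m + 1 : ℕ) : ℝ) * (-ρ y)) atTop atTop :=
            (tendsto_natCast_atTop_atTop.comp (tendsto_add_atTop_nat 1)).atTop_mul_const
              (by linarith)
          refine (tendsto_atTop_add_const_right atTop (-1) this).congr fun m => ?_
          simp only [τ]; ring
        refine tendsto_const_nhds.congr' ?_
        filter_upwards [h4.eventually_gt_atTop 1] with m hm
        have h5 : deriv S (τ m y) = 0 := by
          by_contra hne
          exact absurd ((hK _).2 hne).2 (not_le.2 hm)
        have h6 : χ m y = 1 := Real.smoothTransition.one_of_one_le hm.le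
        rw [h5, h6]; ring
      · have hq0 : q y = 0 := Finset.sum_eq_zero fun k _ => by rw [(hzero y hyU k).1, mul_zero]
        have hd0 : divProd f g W y = 0 := Finset.sum_eq_zero fun k _ => by
          rw [(hzero y hyU k).1, (hzero y hyU k).2]; simp
        simp [hq0, hd0]
  refine tendsto_nhds_unique hlim ?_
  simp only [hint0]
  exact tendsto_const_nhds

/-- The divergence theorem for `f W`, where `f` is a Sobolev function and `W` is a smooth field
which is tangential on the boundary. -/
theorem integral_divProd_eq_zero {Ω : Set E3} (hΩ : IsSmoothBoundedDomain Ω)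
    {f : E3 → ℝ} {g W : Fin 3 → E3 → ℝ} (h : IsScalarWeakGradient Ω f g)
    (hW : ∀ k, ContDiff ℝ ∞ (W k)) (ht : IsTangential Ω W) :
    ∫ x in Ω, divProd f g W x = 0 := by
  have hloc : ∀ x : closure Ω, ∃ U : Set E3, IsOpen U ∧ (x : E3) ∈ U ∧ ∀ W : Fin 3 → E3 → ℝ,
      (∀ k, ContDiff ℝ ∞ (W k)) → IsTangential Ω W → (∀ k, tsupport (W k) ⊆ U) →
        ∫ x in Ω, divProd f g W x = 0 := by
    rintro ⟨x, hx⟩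
    by_cases hxΩ : x ∈ Ω
    · exact ⟨Ω, hΩ.isOpen, hxΩ, fun W hW _ hs =>
        integral_divProd_of_tsupport_subset hΩ.isOpen hΩ.isBounded h hW hs⟩
    · have hxf : x ∈ frontier Ω := by rw [hΩ.isOpen.frontier_eq]; exact ⟨hx, hxΩ⟩
      obtain ⟨ρ, hρ⟩ := hΩ.smooth_boundary x hxf
      exact exists_nhds_integral_divProd hΩ.isOpen hΩ.isBounded hρ hxf h
  choose U hUo hUx hU using hloc
  obtain ⟨t, hcov⟩ := hΩ.isBounded.isCompact_closure.elim_finite_subcover U hUo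
    (fun x hx => mem_iUnion.2 ⟨⟨x, hx⟩, hUx ⟨x, hx⟩⟩)
  obtain ⟨ψ, hψ⟩ := SmoothPartitionOfUnity.exists_isSubordinate 𝓘(ℝ, E3) isClosed_closure
    (fun i : t => U i) (fun i => hUo i) (by
      intro x hx
      obtain ⟨i, hi, hxi⟩ := mem_iUnion₂.1 (hcov hx)
      exact mem_iUnion.2 ⟨⟨i, hi⟩, hxi⟩)
  have hψs : ∀ i, ContDiff ℝ ∞ (ψ i) := fun i => (ψ i).contMDiff.contDiff
  have hsum1 : ∀ x ∈ closure Ω, ∑ i, ψ i x = 1 := by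
    intro x hx
    rw [← ψ.sum_eq_one hx, finsum_eq_sum_of_fintype]
  -- Multiplication by a scalar function preserves tangency, so each localized field satisfies the
  -- hypotheses of the local statement.
  have hpiece : ∀ i, ∫ x in Ω, divProd f g (fun k x => ψ i x * W k x) x = 0 := by
    intro i
    refine hU i _ (fun k => (hψs i).mul (hW k)) ?_ fun k =>
      (tsupport_mul_subset_left).trans (hψ i)
    intro x hx n hn
    have := ht x hx n hn
    simp only [mul_left_comm _ (ψ i x), ← Finset.mul_sum, this, mul_zero]
  have heq : ∀ x ∈ Ω, divProd f g W x = ∑ i, divProd f g (fun k x => ψ i x * W k x) x := by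
    intro x hx
    have h1 : ∀ k, W k =ᶠ[𝓝 x] fun y => ∑ i, ψ i y * W k y := by
      intro k
      filter_upwards [hΩ.isOpen.mem_nhds hx] with y hy
      rw [← Finset.sum_mul, hsum1 y (subset_closure hy), one_mul]
    have h2 : ∀ k, fderiv ℝ (W k) x (stdVec k)
        = ∑ i, fderiv ℝ (fun y => ψ i y * W k y) x (stdVec k) := by
      intro k
      rw [(h1 k).fderiv_eq, fderiv_fun_sum fun i _ =>
        ((hψs i).mul (hW k)).differentiable (by simp) x, sum_apply]
    have h3 : ∀ k, W k x = ∑ i, ψ i x * W k x := fun k => (h1 k).eq_of_nhds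
    simp only [divProd]
    rw [Finset.sum_comm]
    refine Finset.sum_congr rfl fun k _ => ?_
    rw [Finset.sum_add_distrib, ← Finset.sum_mul, ← Finset.sum_mul, ← h2, ← h3]
  rw [setIntegral_congr_fun hΩ.isOpen.measurableSet heq, integral_finsetSum]
  · exact Finset.sum_eq_zero fun i _ => hpiece i
  · exact fun i _ => integrableOn_divProd hΩ.isOpen hΩ.isBounded h fun k => (hψs i).mul (hW k)

end VectorLaplacian

end

noncomputable section

open scoped Manifold

namespace VectorLaplacian

/-! ### Sobolev fields, componentwise -/

theorem isFiniteMeasure_restrict {Ω : Set E3} (hb : Bornology.IsBounded Ω) :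
    IsFiniteMeasure ((volume : Measure E3).restrict Ω) :=
  ⟨by rw [Measure.restrict_apply_univ]; exact hb.measure_lt_top⟩

theorem integrableOn_field {Ω : Set E3} (hb : Bornology.IsBounded Ω) (A : L2Field Ω) :
    IntegrableOn A Ω :=
  have := isFiniteMeasure_restrict hb
  (Lp.memLp A).integrable one_le_two

theorem integrableOn_component {Ω : Set E3} (hb : Bornology.IsBounded Ω) (A : L2Field Ω)
    (i : Fin 3) : IntegrableOn (fun x => A x i) Ω :=
  (EuclideanSpace.proj (𝕜 := ℝ) i).integrable_comp (integrableOn_field hb A)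

theorem integrableOn_continuous_smul {Ω : Set E3} (hΩ : IsOpen Ω) (hb : Bornology.IsBounded Ω)
    (A : L2Field Ω) {c : E3 → ℝ} (hc : Continuous c) : IntegrableOn (fun x => c x • A x) Ω := by
  obtain ⟨C, hC⟩ := hb.isCompact_closure.exists_bound_of_continuousOn hc.continuousOn
  refine Integrable.bdd_smul (integrableOn_field hb A) C hc.aestronglyMeasurable ?_
  filter_upwards [ae_restrict_mem hΩ.measurableSet] with x hx using hC x (subset_closure hx)

theorem integral_smul_apply {Ω : Set E3} (hΩ : IsOpen Ω) (hb : Bornology.IsBounded Ω)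
    (A : L2Field Ω) {c : E3 → ℝ} (hc : Continuous c) (i : Fin 3) :
    (∫ x in Ω, c x • A x) i = ∫ x in Ω, c x * A x i := by
  have := (EuclideanSpace.proj (𝕜 := ℝ) i).integral_comp_comm
    (integrableOn_continuous_smul hΩ hb A hc)
  simpa using this.symm

theorem isWeakGradient_iff {Ω : Set E3} (hΩ : IsOpen Ω) (hb : Bornology.IsBounded Ω)
    (A : L2Field Ω) (G : Fin 3 → L2Field Ω) :
    IsWeakGradient Ω A G ↔
      ∀ i, IsScalarWeakGradient Ω (fun x => A x i) (fun k x => G k x i) := by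
  constructor
  · intro h i
    refine ⟨integrableOn_component hb A i, fun k => integrableOn_component hb (G k) i,
      fun k φ h1 h2 h3 => ?_⟩
    have := congrArg (fun v : E3 => v i) (h k φ h1 h2 h3)
    simp only [PiLp.neg_apply] at this
    rwa [integral_smul_apply hΩ hb A (continuous_fderiv_apply_const h1 _),
      integral_smul_apply hΩ hb (G k) h1.continuous] at this
  · intro h k φ h1 h2 h3
    ext i
    rw [PiLp.neg_apply, integral_smul_apply hΩ hb A (continuous_fderiv_apply_const h1 _),
      integral_smul_apply hΩ hb (G k) h1.continuous]
    exact (h i).2.2 k φ h1 h2 h3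

theorem contDiff_component {u : E3 → E3} (hu : ContDiff ℝ ∞ u) (i : Fin 3) :
    ContDiff ℝ ∞ fun x => u x i :=
  (EuclideanSpace.proj (𝕜 := ℝ) i).contDiff.comp hu

theorem fderiv_component {u : E3 → E3} (hu : ContDiff ℝ ∞ u) (i : Fin 3) (x v : E3) :
    fderiv ℝ (fun x => u x i) x v = (fderiv ℝ u x v) i := by
  have h := (EuclideanSpace.proj (𝕜 := ℝ) i).hasFDerivAt.comp x
    (hu.differentiable (by simp) x).hasFDerivAt
  have h2 : HasFDerivAt (fun x => u x i)
    ((EuclideanSpace.proj (𝕜 := ℝ) i).comp (fderiv ℝ u x)) x := h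
  rw [h2.fderiv]; rfl

theorem contDiff_partialDeriv {u : E3 → E3} (hu : ContDiff ℝ ∞ u) (k : Fin 3) :
    ContDiff ℝ ∞ (partialDeriv k u) :=
  ContDiff.clm_apply (hu.fderiv_right (m := ∞) (by simp)) contDiff_const

theorem isScalarWeakGradient_of_contDiff {Ω : Set E3} (hb : Bornology.IsBounded Ω)
    {f : E3 → ℝ} (hf : ContDiff ℝ ∞ f) :
    IsScalarWeakGradient Ω f (fun k x => fderiv ℝ f x (stdVec k)) := by
  have hint : ∀ c : E3 → ℝ, Continuous c → IntegrableOn c Ω := fun c hc =>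
    (hc.continuousOn.integrableOn_compact hb.isCompact_closure).mono_set subset_closure
  refine ⟨hint _ hf.continuous, fun k => hint _ (continuous_fderiv_apply_const hf _),
    fun k φ h1 h2 h3 => ?_⟩
  have hz : ∀ x ∉ Ω, φ x = 0 ∧ fderiv ℝ φ x = 0 := by
    intro x hx
    have hx' : x ∉ tsupport φ := fun hh => hx (h3 hh)
    exact ⟨image_eq_zero_of_notMem_tsupport hx',
      image_eq_zero_of_notMem_tsupport fun hh => hx' (tsupport_fderiv_subset ℝ hh)⟩
  rw [setIntegral_eq_integral_of_forall_compl_eq_zero (by intro x hx; simp [(hz x hx).2]),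
    setIntegral_eq_integral_of_forall_compl_eq_zero (by intro x hx; simp [(hz x hx).1])]
  have hsm : ∀ c : E3 → ℝ, Continuous c → Integrable (fun x => φ x * c x) := fun c hc =>
    (h1.continuous.mul hc).integrable_of_hasCompactSupport h2.mul_right
  have hsm2 : Integrable (fun x => fderiv ℝ φ x (stdVec k) * f x) :=
    ((continuous_fderiv_apply_const h1 _).mul hf.continuous).integrable_of_hasCompactSupport
      (h2.fderiv_apply ℝ _).mul_right
  rw [integral_mul_fderiv_eq_neg_fderiv_mul_of_integrable hsm2
    (hsm _ (continuous_fderiv_apply_const hf _)) (hsm _ hf.continuous)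
    (fun x _ => h1.differentiable (by simp) x) (fun x _ => hf.differentiable (by simp) x), neg_neg]

theorem isWeakGradient_of_contDiff {Ω : Set E3} (hΩ : IsOpen Ω) (hb : Bornology.IsBounded Ω)
    {u : E3 → E3} (hu : ContDiff ℝ ∞ u) {A : L2Field Ω} {G : Fin 3 → L2Field Ω}
    (hA : A =ᵐ[volume.restrict Ω] u) (hG : ∀ k, G k =ᵐ[volume.restrict Ω] partialDeriv k u) :
    IsWeakGradient Ω A G := by
  rw [isWeakGradient_iff hΩ hb]
  intro i
  have h := isScalarWeakGradient_of_contDiff hb (contDiff_component hu i)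
  refine ⟨integrableOn_component hb A i, fun k => integrableOn_component hb (G k) i,
    fun k φ h1 h2 h3 => ?_⟩
  have e1 : ∫ x in Ω, fderiv ℝ φ x (stdVec k) * A x i
      = ∫ x in Ω, fderiv ℝ φ x (stdVec k) * u x i :=
    integral_congr_ae (by filter_upwards [hA] with x hx; rw [hx])
  have e2 : ∫ x in Ω, φ x * G k x i
      = ∫ x in Ω, φ x * fderiv ℝ (fun x => u x i) x (stdVec k) :=
    integral_congr_ae (by
      filter_upwards [hG k] with x hx; rw [hx, fderiv_component hu]; rfl)
  rw [e1, e2]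
  exact h.2.2 k φ h1 h2 h3

/-! ### The boundary form -/

/-- The integral of `∂_k (v_i φ)` over `Ω`; by the Stokes formula, `∫_{∂Ω} n_k v_i φ`. -/
def bdryForm (Ω : Set E3) (v : L2Field Ω) (H : Fin 3 → L2Field Ω) (k i : Fin 3)
    (φ : E3 → ℝ) : ℝ :=
  ∫ x in Ω, (fderiv ℝ φ x (stdVec k) * v x i + φ x * H k x i)

section BdryForm

variable {Ω : Set E3} {v : L2Field Ω} {H : Fin 3 → L2Field Ω}

theorem integrableOn_bdryForm (hΩ : IsOpen Ω) (hb : Bornology.IsBounded Ω) (k i : Fin 3)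
    {φ : E3 → ℝ} (hφ : ContDiff ℝ ∞ φ) :
    IntegrableOn (fun x => fderiv ℝ φ x (stdVec k) * v x i + φ x * H k x i) Ω :=
  (integrableOn_continuous_mul hΩ hb (integrableOn_component hb v i)
    (continuous_fderiv_apply_const hφ _)).add
    (integrableOn_continuous_mul hΩ hb (integrableOn_component hb (H k) i) hφ.continuous)

/-- The boundary functional of `vᵢ` does not see tangential fields; a test field may hence be
replaced by its normal part. -/
theorem sum_bdryForm_eq_zero (hΩ : IsSmoothBoundedDomain Ω) (hH : IsWeakGradient Ω v H)
    (i : Fin 3) {W : Fin 3 → E3 → ℝ} (hW : ∀ k, ContDiff ℝ ∞ (W k)) (ht : IsTangential Ω W) :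
    ∑ k, bdryForm Ω v H k i (W k) = 0 := by
  unfold bdryForm
  rw [← integral_finsetSum _ fun k _ => integrableOn_bdryForm hΩ.isOpen hΩ.isBounded k i (hW k)]
  exact integral_divProd_eq_zero hΩ ((isWeakGradient_iff hΩ.isOpen hΩ.isBounded v H).1 hH i) hW ht

theorem bdryForm_sub (hΩ : IsOpen Ω) (hb : Bornology.IsBounded Ω) (k i : Fin 3)
    {φ ψ : E3 → ℝ} (hφ : ContDiff ℝ ∞ φ) (hψ : ContDiff ℝ ∞ ψ) :
    bdryForm Ω v H k i (fun x => φ x - ψ x)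
      = bdryForm Ω v H k i φ - bdryForm Ω v H k i ψ := by
  unfold bdryForm
  rw [← integral_sub (integrableOn_bdryForm hΩ hb k i hφ) (integrableOn_bdryForm hΩ hb k i hψ)]
  congr 1
  ext x
  rw [fderiv_fun_sub (hφ.differentiable (by simp) x) (hψ.differentiable (by simp) x)]
  simp only [sub_apply]
  ring

/-- Formally `nⱼ vᵢ = nᵢ vⱼ` on the boundary, which is how the weak normality of `v` enters. -/
theorem bdryForm_swap (hΩ : IsOpen Ω) (hb : Bornology.IsBounded Ω)
    (hz : HasZeroTangentialPart Ω v H) (i j : Fin 3) {φ : E3 → ℝ} (hφ : ContDiff ℝ ∞ φ) :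
    bdryForm Ω v H j i φ = bdryForm Ω v H i j φ := by
  rw [← sub_eq_zero]
  unfold bdryForm
  rw [← integral_sub (integrableOn_bdryForm hΩ hb j i hφ) (integrableOn_bdryForm hΩ hb i j hφ),
    ← hz i j φ hφ]
  congr 1
  ext x
  ring

/-- A field which is normal to the boundary pairs to zero with a field whose normal derivative is
tangential. -/
theorem sum_sum_bdryForm_eq_zero (hΩ : IsSmoothBoundedDomain Ω) (hH : IsWeakGradient Ω v H)
    (hz : HasZeroTangentialPart Ω v H) {b : Fin 3 → Fin 3 → E3 → ℝ}
    (hb : ∀ i k, ContDiff ℝ ∞ (b i k))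
    (hn : ∀ x ∈ frontier Ω, ∀ n, IsOutwardUnitNormal Ω x n → ∑ i, ∑ k, n i * (n k * b i k x) = 0) :
    ∑ i, ∑ k, bdryForm Ω v H k i (b i k) = 0 := by
  obtain ⟨N, hN, hNn⟩ := exists_smooth_normal hΩ
  have hNc : ∀ k, ContDiff ℝ ∞ fun x => N x k := fun k => contDiff_component hN k
  let w : Fin 3 → E3 → ℝ := fun i x => ∑ k, N x k * b i k x
  have hw : ∀ i, ContDiff ℝ ∞ (w i) := fun i => ContDiff.sum fun k _ => (hNc k).mul (hb i k)
  -- `N wᵢ` is the normal part of `bᵢ`: since `N` has unit length on the boundary, `bᵢ - N wᵢ` is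
  -- tangential there and contributes nothing.
  have hNw : ∀ i k, ContDiff ℝ ∞ fun x => N x k * w i x := fun i k => (hNc k).mul (hw i)
  have h1 : ∀ i, ∑ k, bdryForm Ω v H k i (b i k)
      = ∑ k, bdryForm Ω v H k i (fun x => N x k * w i x) := by
    intro i
    rw [← sub_eq_zero, ← Finset.sum_sub_distrib]
    simp only [← bdryForm_sub hΩ.isOpen hΩ.isBounded _ i (hb i _) (hNw i _)]
    refine sum_bdryForm_eq_zero hΩ hH i (fun k => (hb i k).sub (hNw i k)) ?_
    intro x hx n hnn
    have hnN := hNn x hx n hnn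
    have hunit : ∑ k, n k * n k = 1 := by
      obtain ⟨ρ, hρ, rfl⟩ := hnn
      have hg0 : ‖gradient ρ x‖ ≠ 0 := norm_ne_zero_iff.2 hρ.2.1
      have h2 := EuclideanSpace.real_norm_sq_eq (‖gradient ρ x‖⁻¹ • gradient ρ x)
      rw [norm_smul, norm_inv, norm_norm, inv_mul_cancel₀ hg0] at h2
      simp only [sq, mul_one] at h2
      exact h2.symm
    simp only [w, ← hnN, mul_sub, Finset.sum_sub_distrib, ← mul_assoc]
    rw [← Finset.sum_mul, hunit, one_mul, sub_self]
  simp only [h1]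
  -- After the exchange of indices, the field tested against `vₖ` is `i ↦ Nₖ wᵢ`. Its normal
  -- component is `Nₖ ∑ Nᵢ Nₗ bᵢₗ`, which is zero by `hn`.
  rw [Finset.sum_congr rfl fun i _ => Finset.sum_congr rfl fun k _ =>
    bdryForm_swap hΩ.isOpen hΩ.isBounded hz i k (hNw i k), Finset.sum_comm]
  refine Finset.sum_eq_zero fun k _ => ?_
  refine sum_bdryForm_eq_zero hΩ hH k (fun i => hNw i k) ?_
  intro x hx n hnn
  have := hn x hx n hnn
  rw [hNn x hx n hnn] at this ⊢
  have e : ∑ i, N x i * (N x k * w i x) = N x k * ∑ i, ∑ l, N x i * (N x l * b i l x) := by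
    simp only [w, Finset.mul_sum]
    refine Finset.sum_congr rfl fun i _ => Finset.sum_congr rfl fun l _ => ?_
    ring
  rw [e, this, mul_zero]

end BdryForm

/-! ### Smooth fields -/

/-- The divergence theorem with `f = 1` and `W = φ (uᵢ eⱼ - uⱼ eᵢ)`, which is tangential because `u`
is parallel to `n` on the boundary. -/
theorem hasZeroTangentialPart_of_smoothFields {Ω : Set E3} (hΩ : IsSmoothBoundedDomain Ω)
    {u : E3 → E3} (hu : u ∈ smoothFields Ω) {A : L2Field Ω} {G : Fin 3 → L2Field Ω}
    (hA : A =ᵐ[volume.restrict Ω] u) (hG : ∀ k, G k =ᵐ[volume.restrict Ω] partialDeriv k u) :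
    HasZeroTangentialPart Ω A G := by
  intro i j φ hφ
  have hui := contDiff_component hu.1 i
  have huj := contDiff_component hu.1 j
  let W : Fin 3 → E3 → ℝ := fun k x =>
    (if k = j then 1 else 0) * (u x i * φ x) - (if k = i then 1 else 0) * (u x j * φ x)
  have hW : ∀ k, ContDiff ℝ ∞ (W k) := fun k =>
    (contDiff_const.mul (hui.mul hφ)).sub (contDiff_const.mul (huj.mul hφ))
  have ht : IsTangential Ω W := by
    intro x hx n hn
    have h1 := sub_eq_zero.1 (hu.2 x hx n hn).1
    have h2 : ∀ k, u x k = ⟪n, u x⟫_ℝ * n k := fun k => by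
      have := congrArg (fun v : E3 => v k) h1
      simpa using this
    have e : ∑ k, n k * W k x = n j * (u x i * φ x) - n i * (u x j * φ x) := by
      simp [W, mul_sub, Finset.sum_sub_distrib]
    rw [e, h2 i, h2 j]
    ring
  have h1 := isScalarWeakGradient_of_contDiff hΩ.isBounded
    (contDiff_const (c := (1 : ℝ)) (n := ∞) (E := E3) (𝕜 := ℝ))
  rw [← integral_divProd_eq_zero hΩ h1 hW ht]
  refine integral_congr_ae ?_
  filter_upwards [hA, hG i, hG j] with x hx hi hj
  have hd : ∀ k, fderiv ℝ (W k) x (stdVec k)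
      = (if k = j then 1 else 0) * (u x i * fderiv ℝ φ x (stdVec k)
          + φ x * partialDeriv k u x i)
        - (if k = i then 1 else 0) * (u x j * fderiv ℝ φ x (stdVec k)
          + φ x * partialDeriv k u x j) := by
    intro k
    have d1 := hui.differentiable (by simp) x
    have d2 := huj.differentiable (by simp) x
    have d3 := hφ.differentiable (by simp) x
    simp only [W]
    rw [fderiv_fun_sub ((d1.fun_mul d3).const_mul _) ((d2.fun_mul d3).const_mul _),
      fderiv_const_mul (d1.fun_mul d3), fderiv_const_mul (d2.fun_mul d3),
      fderiv_fun_mul d1 d3, fderiv_fun_mul d2 d3]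
    simp only [sub_apply, smul_apply, add_apply, smul_eq_mul, fderiv_component hu.1]
    rfl
  have e : divProd (fun _ => 1) (fun k x => fderiv ℝ (fun _ : E3 => (1 : ℝ)) x (stdVec k)) W x
      = (u x i * fderiv ℝ φ x (stdVec j) + φ x * partialDeriv j u x i)
        - (u x j * fderiv ℝ φ x (stdVec i) + φ x * partialDeriv i u x j) := by
    simp [divProd, hd, Finset.sum_sub_distrib]
  rw [e, hx, hi, hj]
  ring

theorem laplacian_apply_eq_sum {u : E3 → E3} (hu : ContDiff ℝ ∞ u) (x : E3) (i : Fin 3) :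
    Laplacian.laplacian u x i
      = ∑ k, fderiv ℝ (fun y => partialDeriv k u y i) x (stdVec k) := by
  rw [InnerProductSpace.laplacian_eq_iteratedFDeriv_orthonormalBasis u
    (EuclideanSpace.basisFun (Fin 3) ℝ)]
  simp only [iteratedFDeriv_two_apply, WithLp.ofLp_sum, Finset.sum_apply]
  refine Finset.sum_congr rfl fun k _ => ?_
  rw [fderiv_component (contDiff_partialDeriv hu k)]
  have hd : DifferentiableAt ℝ (fderiv ℝ u) x :=
    (hu.fderiv_right (m := ∞) (by simp)).differentiable (by simp) x
  have : fderiv ℝ (partialDeriv k u) x (stdVec k)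
      = fderiv ℝ (fderiv ℝ u) x (stdVec k) (stdVec k) := by
    unfold partialDeriv
    rw [fderiv_clm_apply hd (differentiableAt_const _)]
    simp
  rw [this]
  simp

theorem inner_eq_integral_sum {Ω : Set E3} (A B : L2Field Ω) :
    ⟪A, B⟫_ℝ = ∫ x in Ω, ∑ i, A x i * B x i := by
  rw [L2.inner_def]
  congr 1
  ext x
  simp [PiLp.inner_apply, mul_comm]

/-- Green's formula for smooth fields satisfying the boundary conditions, against Sobolev fields
which are normal to the boundary. -/
theorem green_of_smoothFields {Ω : Set E3} (hΩ : IsSmoothBoundedDomain Ω)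
    {u : E3 → E3} (hu : u ∈ smoothFields Ω) {F v : L2Field Ω} {G H : Fin 3 → L2Field Ω}
    (hF : F =ᵐ[volume.restrict Ω] fun x => -Laplacian.laplacian u x)
    (hG : ∀ k, G k =ᵐ[volume.restrict Ω] partialDeriv k u)
    (hH : IsWeakGradient Ω v H) (hz : HasZeroTangentialPart Ω v H) :
    ⟪F, v⟫_ℝ = ∑ k, ⟪G k, H k⟫_ℝ := by
  let b : Fin 3 → Fin 3 → E3 → ℝ := fun i k x => partialDeriv k u x i
  have hb : ∀ i k, ContDiff ℝ ∞ (b i k) := fun i k =>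
    contDiff_component (contDiff_partialDeriv hu.1 k) i
  have h0 := sum_sum_bdryForm_eq_zero hΩ hH hz hb (by
    intro x hx n hn
    have h1 := (hu.2 x hx n hn).2
    have hn' : n = ∑ k, n k • stdVec k := by
      ext i; fin_cases i <;> simp [Fin.sum_univ_three]
    have h2 : ∀ i, (fderiv ℝ u x n) i = ∑ k, n k * b i k x := by
      intro i
      conv_lhs => rw [hn']
      simp [b, partialDeriv]
    rw [PiLp.inner_apply] at h1
    rw [← h1]
    refine Finset.sum_congr rfl fun i _ => ?_
    rw [h2, ← Finset.mul_sum]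
    simp [mul_comm])
  -- With `b i k = ∂ₖuᵢ`, the two sides differ exactly by the sum of boundary forms, since the
  -- divergence of `b i` is `Δuᵢ`.
  rw [← sub_eq_zero, ← neg_eq_zero, neg_sub, ← h0]
  have hint : ∀ i k, IntegrableOn
      (fun x => fderiv ℝ (b i k) x (stdVec k) * v x i + b i k x * H k x i) Ω := fun i k =>
    integrableOn_bdryForm hΩ.isOpen hΩ.isBounded k i (hb i k)
  have hint2 : ∀ i k, IntegrableOn (fun x => b i k x * H k x i) Ω := fun i k =>
    integrableOn_continuous_mul hΩ.isOpen hΩ.isBounded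
      (integrableOn_component hΩ.isBounded (H k) i) (hb i k).continuous
  have hint3 : ∀ i k, IntegrableOn (fun x => fderiv ℝ (b i k) x (stdVec k) * v x i) Ω :=
    fun i k => integrableOn_continuous_mul hΩ.isOpen hΩ.isBounded
      (integrableOn_component hΩ.isBounded v i) (continuous_fderiv_apply_const (hb i k) _)
  have e1 : ⟪F, v⟫_ℝ = -∑ i, ∑ k, ∫ x in Ω, fderiv ℝ (b i k) x (stdVec k) * v x i := by
    rw [inner_eq_integral_sum]
    simp only [← integral_finsetSum _ fun k _ => hint3 _ k]
    rw [← integral_finsetSum _ fun i _ => integrable_finsetSum _ fun k _ => hint3 i k,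
      ← integral_neg]
    refine integral_congr_ae ?_
    filter_upwards [hF] with x hx
    simp only [hx, PiLp.neg_apply, laplacian_apply_eq_sum hu.1, ← Finset.sum_mul, b, neg_mul,
      Finset.sum_neg_distrib]
  have e2 : ∑ k, ⟪G k, H k⟫_ℝ = ∑ i, ∑ k, ∫ x in Ω, b i k x * H k x i := by
    rw [Finset.sum_comm]
    refine Finset.sum_congr rfl fun k _ => ?_
    rw [inner_eq_integral_sum, ← integral_finsetSum _ fun i _ => hint2 i k]
    refine integral_congr_ae ?_
    filter_upwards [hG k] with x hx
    simp only [hx, b]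
  rw [e1, e2, sub_neg_eq_add, ← Finset.sum_add_distrib]
  refine Finset.sum_congr rfl fun i _ => ?_
  rw [← Finset.sum_add_distrib]
  refine Finset.sum_congr rfl fun k _ => ?_
  unfold bdryForm
  rw [integral_add (hint3 i k) (hint2 i k), add_comm]

end VectorLaplacian

end

noncomputable section

open scoped ENNReal

namespace VectorLaplacian

/-! ### Averages along cones -/

/-- A smooth bump function supported in the ball of radius `1/2`. -/
def coneBump : ContDiffBump (0 : E3) := ⟨1 / 4, 1 / 2, by norm_num, by norm_num⟩

/-- The profile of the averaging kernels: smooth, supported in the ball of radius `1/2`, of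
integral one. -/
def profile : E3 → ℝ := coneBump.normed volume

theorem contDiff_profile : ContDiff ℝ ∞ profile := coneBump.contDiff_normed

theorem integral_profile : ∫ x, profile x = 1 := coneBump.integral_normed

theorem norm_le_of_profile_ne_zero {y : E3} (h : profile y ≠ 0) : ‖y‖ ≤ 1 / 2 := by
  have h1 : y ∈ Function.support profile := h
  rw [profile, coneBump.support_normed_eq] at h1
  have h2 : y ∈ Metric.ball (0 : E3) (1 / 2) := h1
  simpa using (Metric.ball_subset_closedBall h2)

theorem exists_bound_profile : ∃ B : ℝ, 0 < B ∧ ∀ y, |profile y| ≤ B := by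
  obtain ⟨C, hC⟩ := contDiff_profile.continuous.bounded_above_of_compact_support
    coneBump.hasCompactSupport_normed
  refine ⟨max C 1, by positivity, fun y => (hC y).trans (le_max_left _ _)⟩

/-- The kernel averaging over the part at scale `s` of the cone with vertex `x` and axis `ν`. -/
def coneKernel (s : ℝ) (x ν z : E3) : ℝ := (s ^ 3)⁻¹ * profile (s⁻¹ • (z - x) - ν)

theorem contDiff_coneKernel (s : ℝ) (x ν : E3) : ContDiff ℝ ∞ (coneKernel s x ν) :=
  contDiff_const.mul (contDiff_profile.comp (by fun_prop))

theorem coneKernel_ne_zero {s : ℝ} {x ν z : E3} (h : coneKernel s x ν z ≠ 0) :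
    ‖s⁻¹ • (z - x) - ν‖ ≤ 1 / 2 :=
  norm_le_of_profile_ne_zero (right_ne_zero_of_mul h)

theorem tsupport_coneKernel {s : ℝ} (x ν : E3) :
    tsupport (coneKernel s x ν) ⊆ {z | ‖s⁻¹ • (z - x) - ν‖ ≤ 1 / 2} :=
  closure_minimal (fun _ hz => coneKernel_ne_zero hz) (isClosed_le (by fun_prop) continuous_const)

theorem norm_sub_le_of_mem_cone {s M : ℝ} (hs : 0 < s) {x ν z : E3} (hν : ‖ν‖ ≤ M)
    (h : ‖s⁻¹ • (z - x) - ν‖ ≤ 1 / 2) : ‖z - x‖ ≤ (M + 1 / 2) * s := by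
  have h1 : z - x = s • ((s⁻¹ • (z - x) - ν) + ν) := by
    rw [sub_add_cancel, smul_smul, mul_inv_cancel₀ hs.ne', one_smul]
  rw [h1, norm_smul, Real.norm_eq_abs, abs_of_pos hs, mul_comm]
  have := norm_add_le (s⁻¹ • (z - x) - ν) ν
  gcongr
  linarith

theorem mem_of_mem_cone {Ω : Set E3} {s : ℝ} (hs : 0 < s) {x ν : E3}
    (hc : ∀ y : E3, ‖y‖ ≤ 1 / 2 → x + s • (y + ν) ∈ Ω) {z : E3}
    (h : ‖s⁻¹ • (z - x) - ν‖ ≤ 1 / 2) : z ∈ Ω := by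
  have := hc _ h
  rwa [sub_add_cancel, smul_smul, mul_inv_cancel₀ hs.ne', one_smul, add_sub_cancel] at this

/-- The field along which the derivative in `s` of the averages is a gradient. -/
def coneField (s : ℝ) (x ν : E3) (k : Fin 3) (z : E3) : ℝ :=
  (s⁻¹ * (z - x) k) * coneKernel s x ν z

theorem contDiff_coneField (s : ℝ) (x ν : E3) (k : Fin 3) :
    ContDiff ℝ ∞ (coneField s x ν k) :=
  (contDiff_const.mul (contDiff_component (contDiff_id.sub contDiff_const) k)).mul
    (contDiff_coneKernel s x ν)

/-- The derivative of the cone kernel in the scale. -/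
def coneKernelDeriv (s : ℝ) (x ν z : E3) : ℝ :=
  -(3 * s ^ 2 / (s ^ 3) ^ 2) * profile (s⁻¹ • (z - x) - ν)
    + (s ^ 3)⁻¹ * fderiv ℝ profile (s⁻¹ • (z - x) - ν) (-(s ^ 2)⁻¹ • (z - x))

theorem hasDerivAt_coneKernel {s : ℝ} (hs : s ≠ 0) (x ν z : E3) :
    HasDerivAt (fun s => coneKernel s x ν z) (coneKernelDeriv s x ν z) s := by
  have h1 : HasDerivAt (fun s : ℝ => (s ^ 3)⁻¹) (-(3 * s ^ 2 / (s ^ 3) ^ 2)) s := by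
    have := (hasDerivAt_pow 3 s).fun_inv (pow_ne_zero 3 hs)
    simpa [neg_div] using this
  have h2 : HasDerivAt (fun s : ℝ => s⁻¹ • (z - x) - ν) (-(s ^ 2)⁻¹ • (z - x)) s :=
    ((hasDerivAt_inv hs).smul_const (z - x)).sub_const ν
  have h3 := ((contDiff_profile.differentiable (by simp) _).hasFDerivAt).comp_hasDerivAt s h2
  exact h1.mul h3

/-- This is the continuity equation: as `s` grows, the kernel is transported with velocity `(z - x)
/ s` at constant mass. The divergence `3 / s` of the velocity matches the derivative of the factor
`s⁻³`. -/
theorem sum_fderiv_coneField {s : ℝ} (hs : s ≠ 0) (x ν z : E3) :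
    ∑ k, fderiv ℝ (coneField s x ν k) z (stdVec k) = -coneKernelDeriv s x ν z := by
  have hK : ∀ v, fderiv ℝ (coneKernel s x ν) z v
      = (s ^ 3)⁻¹ * fderiv ℝ profile (s⁻¹ • (z - x) - ν) (s⁻¹ • v) := by
    intro v
    have h1 : HasFDerivAt (fun z : E3 => s⁻¹ • (z - x) - ν)
        (s⁻¹ • ContinuousLinearMap.id ℝ E3) z :=
      (((hasFDerivAt_id z).sub_const x).const_smul s⁻¹).sub_const ν
    have h2 := (((contDiff_profile.differentiable (by simp)
      (s⁻¹ • (z - x) - ν)).hasFDerivAt).comp z h1).const_mul (s ^ 3)⁻¹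
    have h3 : fderiv ℝ (coneKernel s x ν) z = _ := h2.fderiv
    rw [h3]; simp
  have hF : ∀ k, fderiv ℝ (coneField s x ν k) z (stdVec k)
      = s⁻¹ * coneKernel s x ν z
        + (s⁻¹ * (z - x) k) * fderiv ℝ (coneKernel s x ν) z (stdVec k) := by
    intro k
    have hu : ContDiff ℝ ∞ fun z : E3 => z - x := contDiff_id.sub contDiff_const
    have d1 := (contDiff_component hu k).differentiable (by simp) z
    have d2 := (contDiff_coneKernel s x ν).differentiable (by simp) z
    unfold coneField
    rw [fderiv_fun_mul (d1.const_mul _) d2, fderiv_const_mul d1]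
    simp only [add_apply, smul_apply, smul_eq_mul, fderiv_component hu]
    rw [fderiv_sub_const, fderiv_fun_id]
    simp
    ring
  have hsum : z - x = ∑ k, (z - x) k • stdVec k := by
    ext i; fin_cases i <;> simp [Fin.sum_univ_three]
  have hL : fderiv ℝ profile (s⁻¹ • (z - x) - ν) (z - x)
      = ∑ k, (z - x) k * fderiv ℝ profile (s⁻¹ • (z - x) - ν) (stdVec k) := by
    generalize fderiv ℝ profile (s⁻¹ • (z - x) - ν) = L
    conv_lhs => rw [hsum]
    rw [map_sum]
    simp only [map_smul, smul_eq_mul]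
  simp only [hF, hK, coneKernelDeriv, map_smul, smul_eq_mul, hL, Finset.sum_add_distrib,
    Finset.sum_const, Finset.card_univ, Fintype.card_fin, nsmul_eq_mul, Finset.mul_sum,
    coneKernel, neg_mul, Finset.sum_neg_distrib]
  rw [neg_add, neg_neg, ← Finset.sum_neg_distrib]
  congr 1
  · field_simp; norm_num; ring
  · rw [Finset.mul_sum, ← Finset.sum_neg_distrib]
    refine Finset.sum_congr rfl fun k _ => ?_
    field_simp

/-- The size of the kernels. -/
def scaleKernel (R s : ℝ) (x z : E3) : ℝ≥0∞ :=
  if dist z x ≤ R * s then ENNReal.ofReal (s ^ 3)⁻¹ else 0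

theorem enorm_coneKernel_le {B M : ℝ} (hB : ∀ y, |profile y| ≤ B) {s : ℝ} (hs : 0 < s)
    {x ν : E3} (hν : ‖ν‖ ≤ M) (z : E3) :
    ‖coneKernel s x ν z‖ₑ ≤ ENNReal.ofReal B * scaleKernel (M + 1 / 2) s x z := by
  by_cases h : coneKernel s x ν z = 0
  · rw [h, enorm_zero]; exact zero_le
  · have h1 := norm_sub_le_of_mem_cone hs hν (coneKernel_ne_zero h)
    have hB0 : 0 ≤ B := (abs_nonneg _).trans (hB 0)
    rw [scaleKernel, if_pos (by rwa [dist_eq_norm]), ← ENNReal.ofReal_mul hB0,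
      ← ofReal_norm]
    refine ENNReal.ofReal_le_ofReal ?_
    rw [coneKernel, norm_mul, norm_inv, norm_pow, Real.norm_eq_abs, Real.norm_eq_abs,
      abs_of_pos hs, mul_comm]
    gcongr
    exact hB _

theorem enorm_coneField_le {B M : ℝ} (hB : ∀ y, |profile y| ≤ B) {s : ℝ} (hs : 0 < s)
    {x ν : E3} (hν : ‖ν‖ ≤ M) (k : Fin 3) (z : E3) :
    ‖coneField s x ν k z‖ₑ
      ≤ ENNReal.ofReal ((M + 1 / 2) * B) * scaleKernel (M + 1 / 2) s x z := by
  by_cases h : coneKernel s x ν z = 0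
  · rw [coneField, h, mul_zero, enorm_zero]; exact zero_le
  · have h1 := norm_sub_le_of_mem_cone hs hν (coneKernel_ne_zero h)
    have hM0 : 0 ≤ M + 1 / 2 := by linarith [norm_nonneg ν]
    rw [coneField, enorm_mul, ENNReal.ofReal_mul hM0, mul_assoc]
    refine mul_le_mul' ?_ (enorm_coneKernel_le hB hs hν z)
    rw [← ofReal_norm]
    refine ENNReal.ofReal_le_ofReal ?_
    rw [norm_mul, norm_inv, Real.norm_eq_abs s, abs_of_pos hs]
    calc s⁻¹ * ‖(z - x) k‖ ≤ s⁻¹ * ((M + 1 / 2) * s) := by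
          gcongr
          exact (PiLp.norm_apply_le (z - x) k).trans h1
      _ = M + 1 / 2 := by field_simp

theorem integral_coneKernel {s : ℝ} (hs : 0 < s) (x ν : E3) :
    ∫ z, coneKernel s x ν z = 1 := by
  unfold coneKernel
  rw [integral_const_mul, integral_sub_right_eq_self (fun z : E3 => profile (s⁻¹ • z - ν)) x,
    Measure.integral_comp_inv_smul_of_nonneg volume (fun z : E3 => profile (z - ν)) hs.le,
    integral_sub_right_eq_self (fun z : E3 => profile z) ν, integral_profile]
  simp [hs.ne']

section Averages

variable {Ω : Set E3} (hΩ : IsOpen Ω) (hb : Bornology.IsBounded Ω)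

/-- The average of a field over the part at scale `s` of the cone with vertex `x` and axis `ν`. -/
def coneAverage (Ω : Set E3) (A : L2Field Ω) (s : ℝ) (x ν : E3) : E3 :=
  ∫ z in Ω, coneKernel s x ν z • A z

/-- The potential dominating the difference between a field and its cone averages. -/
def conePotential (Ω : Set E3) (R t : ℝ) (G : Fin 3 → L2Field Ω) (x : E3) : ℝ≥0∞ :=
  ∫⁻ s in Ioc 0 t, ∫⁻ z in Ω, scaleKernel R s x z * ∑ k, ‖G k z‖ₑ

include hΩ hb

/-- Differentiate under the integral and write the derivative of the kernel as minus a divergence.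
The cone condition puts the support of the kernel inside `Ω`, so `coneField` is an admissible test
function and the derivative moves onto `A`. -/
theorem hasDerivAt_coneAverage {A : L2Field Ω} {G : Fin 3 → L2Field Ω}
    (hG : IsWeakGradient Ω A G) {s : ℝ} (hs : 0 < s) {x ν : E3}
    (hc : ∀ y : E3, ‖y‖ ≤ 1 / 2 → x + s • (y + ν) ∈ Ω) :
    HasDerivAt (fun s => coneAverage Ω A s x ν)
      (∑ k, ∫ z in Ω, coneField s x ν k z • G k z) s := by
  -- Scales in `[s / 2, 2 s]` stay away from zero, so compactness gives a uniform bound on the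
  -- derivative of the kernel.
  have hcont : ContinuousOn (fun p : ℝ × E3 => coneKernelDeriv p.1 x ν p.2)
      (Icc (s / 2) (2 * s) ×ˢ closure Ω) := by
    have h0 : ∀ p ∈ Icc (s / 2) (2 * s) ×ˢ closure Ω, (p : ℝ × E3).1 ≠ 0 := by
      rintro p ⟨hp, -⟩
      have := hp.1
      intro h
      linarith
    have hp1 := contDiff_profile.continuous
    have hp2 := contDiff_profile.continuous_fderiv (by simp)
    unfold coneKernelDeriv
    have h3 : ContinuousOn (fun p : ℝ × E3 => p.1⁻¹ • (p.2 - x) - ν)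
        (Icc (s / 2) (2 * s) ×ˢ closure Ω) :=
      ((continuousOn_fst.inv₀ h0).smul (continuousOn_snd.sub continuousOn_const)).sub
        continuousOn_const
    refine ContinuousOn.add (ContinuousOn.mul (ContinuousOn.neg (ContinuousOn.div (by fun_prop)
      (by fun_prop) fun p hp => pow_ne_zero 2 (pow_ne_zero 3 (h0 p hp))))
      (hp1.comp_continuousOn h3)) (ContinuousOn.mul (ContinuousOn.inv₀ (by fun_prop)
      fun p hp => pow_ne_zero 3 (h0 p hp)) (ContinuousOn.clm_apply (hp2.comp_continuousOn h3)
      (ContinuousOn.smul (ContinuousOn.neg (ContinuousOn.inv₀ (by fun_prop)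
        fun p hp => pow_ne_zero 2 (h0 p hp))) (by fun_prop))))
  obtain ⟨C, hC⟩ := (isCompact_Icc.prod hb.isCompact_closure).exists_bound_of_continuousOn hcont
  have hcd : Continuous (coneKernelDeriv s x ν) := by
    have : coneKernelDeriv s x ν = fun z => -∑ k, fderiv ℝ (coneField s x ν k) z (stdVec k) := by
      ext z; rw [sum_fderiv_coneField hs.ne', neg_neg]
    rw [this]
    exact (continuous_finsetSum _ fun k _ =>
      continuous_fderiv_apply_const (contDiff_coneField s x ν k) _).neg
  have hder := (hasDerivAt_integral_of_dominated_loc_of_deriv_le (μ := volume.restrict Ω)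
    (F := fun s z => coneKernel s x ν z • A z)
    (F' := fun s z => coneKernelDeriv s x ν z • A z) (bound := fun z => C * ‖A z‖)
    (Icc_mem_nhds (show s / 2 < s by linarith) (show s < 2 * s by linarith))
    (Eventually.of_forall fun s => (integrableOn_continuous_smul hΩ hb A
      (contDiff_coneKernel s x ν).continuous).aestronglyMeasurable)
    (integrableOn_continuous_smul hΩ hb A (contDiff_coneKernel s x ν).continuous)
    (integrableOn_continuous_smul hΩ hb A hcd).aestronglyMeasurable
    (by
      filter_upwards [ae_restrict_mem hΩ.measurableSet] with z hz t ht
      rw [norm_smul]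
      gcongr
      exact hC (t, z) ⟨ht, subset_closure hz⟩)
    ((integrableOn_field hb A).norm.const_mul C)
    (by
      refine Eventually.of_forall fun z t ht => ?_
      have ht0 : t ≠ 0 := by
        intro h
        have := ht.1
        linarith
      exact (hasDerivAt_coneKernel ht0 x ν z).smul_const (A z))).2
  convert! hder using 1
  have hts : ∀ k, tsupport (coneField s x ν k) ⊆ Ω := by
    intro k z hz
    exact mem_of_mem_cone hs hc (tsupport_coneKernel x ν (tsupport_mul_subset_right hz))
  have hcs : ∀ k, HasCompactSupport (coneField s x ν k) := fun k =>
    hb.isCompact_closure.of_isClosed_subset (isClosed_tsupport _) ((hts k).trans subset_closure)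
  have h1 : ∀ k, ∫ z in Ω, coneField s x ν k z • G k z
      = -∫ z in Ω, fderiv ℝ (coneField s x ν k) z (stdVec k) • A z := fun k => by
    rw [hG k _ (contDiff_coneField s x ν k) (hcs k) (hts k), neg_neg]
  simp only [h1]
  rw [Finset.sum_neg_distrib, ← integral_finsetSum _ fun k _ => integrableOn_continuous_smul hΩ hb A
    (continuous_fderiv_apply_const (contDiff_coneField s x ν k) _), ← integral_neg]
  congr 1
  ext1 z
  rw [← Finset.sum_smul, sum_fderiv_coneField hs.ne', neg_smul, neg_neg]

theorem enorm_coneAverage_sub_le {B M : ℝ} (hB : ∀ y, |profile y| ≤ B)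
    {A : L2Field Ω} {G : Fin 3 → L2Field Ω}
    (hG : IsWeakGradient Ω A G) {t : ℝ} {x ν : E3} (hν : ‖ν‖ ≤ M)
    (hc : ∀ s ∈ Ioc 0 t, ∀ y : E3, ‖y‖ ≤ 1 / 2 → x + s • (y + ν) ∈ Ω)
    {ε : ℝ} (hε : ε ∈ Ioc 0 t) :
    ‖coneAverage Ω A t x ν - coneAverage Ω A ε x ν‖ₑ
      ≤ ENNReal.ofReal ((M + 1 / 2) * B) * conePotential Ω (M + 1 / 2) t G x := by
  -- If the right side is infinite there is nothing to prove; otherwise its finiteness is what makes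
  -- the derivative integrable for the fundamental theorem of calculus.
  by_cases htop : ENNReal.ofReal ((M + 1 / 2) * B) * conePotential Ω (M + 1 / 2) t G x = ⊤
  · rw [htop]; exact le_top
  set U := fun s => coneAverage Ω A s x ν with hU
  have hd : ∀ s ∈ Ioc 0 t, HasDerivAt U (∑ k, ∫ z in Ω, coneField s x ν k z • G k z) s :=
    fun s hs => hasDerivAt_coneAverage hΩ hb hG hs.1 (hc s hs)
  have hbd : ∀ s ∈ Ioc 0 t, ‖deriv U s‖ₑ ≤ ENNReal.ofReal ((M + 1 / 2) * B)
      * ∫⁻ z in Ω, scaleKernel (M + 1 / 2) s x z * ∑ k, ‖G k z‖ₑ := by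
    intro s hs
    rw [(hd s hs).deriv]
    calc ‖∑ k, ∫ z in Ω, coneField s x ν k z • G k z‖ₑ
        ≤ ∑ k, ‖∫ z in Ω, coneField s x ν k z • G k z‖ₑ := enorm_sum_le _ _
      _ ≤ ∑ k, ∫⁻ z in Ω, ENNReal.ofReal ((M + 1 / 2) * B)
            * (scaleKernel (M + 1 / 2) s x z * ‖G k z‖ₑ) := by
          refine Finset.sum_le_sum fun k _ => (enorm_integral_le_lintegral_enorm _).trans ?_
          refine lintegral_mono fun z => ?_
          rw [enorm_smul, ← mul_assoc]
          gcongr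
          exact enorm_coneField_le hB hs.1 hν k z
      _ = _ := by
          rw [← lintegral_const_mul' _ _ ENNReal.ofReal_ne_top, ← lintegral_finsetSum']
          · simp only [Finset.mul_sum]
          · intro k _
            refine AEMeasurable.const_mul (AEMeasurable.mul ?_ ?_) _
            · refine (Measurable.ite ?_ measurable_const measurable_const).aemeasurable
              exact (isClosed_le (by fun_prop) continuous_const).measurableSet
            · exact (Lp.aestronglyMeasurable (G k)).enorm
  have hle : ∫⁻ s in Ioc ε t, ‖deriv U s‖ₑ
      ≤ ENNReal.ofReal ((M + 1 / 2) * B) * conePotential Ω (M + 1 / 2) t G x := by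
    rw [conePotential, ← lintegral_const_mul' _ _ ENNReal.ofReal_ne_top]
    calc ∫⁻ s in Ioc ε t, ‖deriv U s‖ₑ ≤ ∫⁻ s in Ioc 0 t, ‖deriv U s‖ₑ :=
          lintegral_mono_set (Ioc_subset_Ioc_left hε.1.le)
      _ ≤ _ := setLIntegral_mono' measurableSet_Ioc hbd
  have hint : IntervalIntegrable (deriv U) volume ε t := by
    rw [intervalIntegrable_iff_integrableOn_Ioc_of_le hε.2]
    exact ⟨(measurable_deriv U).aestronglyMeasurable,
      lt_of_le_of_lt hle (lt_top_iff_ne_top.2 htop)⟩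
  have hsub : ∀ s ∈ uIcc ε t, s ∈ Ioc 0 t := by
    intro s hs
    rw [uIcc_of_le hε.2] at hs
    exact ⟨hε.1.trans_le hs.1, hs.2⟩
  have hftc := intervalIntegral.integral_eq_sub_of_hasDerivAt
    (fun s hs => (hd s (hsub s hs)).differentiableAt.hasDerivAt) hint
  show ‖U t - U ε‖ₑ ≤ _
  rw [← hftc, intervalIntegral.integral_of_le hε.2]
  exact (enorm_integral_le_lintegral_enorm _).trans hle

/-- The cone averages converge almost everywhere, uniformly in the choice of the axes. -/
theorem ae_tendsto_coneAverage {M : ℝ} (hM : 0 ≤ M) (A : L2Field Ω) :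
    ∀ᵐ x ∂(volume.restrict Ω), ∀ ν : E3, ‖ν‖ ≤ M → ∀ t : ℝ, 0 < t →
      (∀ s ∈ Ioc 0 t, ∀ y : E3, ‖y‖ ≤ 1 / 2 → x + s • (y + ν) ∈ Ω) →
      Tendsto (fun s => coneAverage Ω A s x ν) (𝓝[>] 0) (𝓝 (A x)) := by
  obtain ⟨B, hB0, hB⟩ := exists_bound_profile
  have hR : 0 < M + 1 / 2 := by linarith
  set f : E3 → E3 := Ω.indicator A with hf
  have hfi : Integrable f := (integrable_indicator_iff hΩ.measurableSet).2 (integrableOn_field hb A)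
  -- The exceptional null set is that of the Lebesgue points of the zero extension. It does not
  -- depend on the axis, because every kernel is dominated by the indicator of a ball centred at
  -- `x`.
  have hleb := IsUnifLocDoublingMeasure.ae_tendsto_average_norm_sub volume
    hfi.locallyIntegrable 1
  filter_upwards [ae_restrict_of_ae hleb, ae_restrict_mem hΩ.measurableSet] with x hx hxΩ
  intro ν hν t ht hc
  have hfx : f x = A x := indicator_of_mem hxΩ A
  have hlim : Tendsto (fun s : ℝ => (M + 1 / 2) * s) (𝓝[>] 0) (𝓝[>] 0) := by
    refine tendsto_nhdsWithin_iff.2 ⟨?_, ?_⟩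
    · have : Continuous fun s : ℝ => (M + 1 / 2) * s := by fun_prop
      simpa using (this.tendsto 0).mono_left nhdsWithin_le_nhds
    · filter_upwards [self_mem_nhdsWithin] with s hs
      exact mul_pos hR hs
  have h1 := hx (fun _ => x) (fun s : ℝ => (M + 1 / 2) * s) hlim (by
    filter_upwards [self_mem_nhdsWithin] with s hs
    have : 0 < (M + 1 / 2) * s := mul_pos hR hs
    exact Metric.mem_closedBall_self (by linarith))
  -- The product of the bound `B s⁻³` for the kernel and the volume of the ball of radius `(M + 1 /
  -- 2) s` that contains its support; the powers of `s` cancel.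
  set κ := B * (M + 1 / 2) ^ 3 * volume.real (Metric.ball (0 : E3) 1) with hκ
  have h2 := h1.const_mul κ
  rw [mul_zero] at h2
  rw [tendsto_iff_norm_sub_tendsto_zero]
  refine squeeze_zero' (Eventually.of_forall fun _ => norm_nonneg _) ?_ h2
  filter_upwards [Ioc_mem_nhdsGT ht] with s hs
  have hs0 := hs.1
  have hKf : coneAverage Ω A s x ν = ∫ z, coneKernel s x ν z • f z := by
    rw [coneAverage, ← integral_indicator hΩ.measurableSet]
    congr 1
    ext1 z
    simp only [hf, indicator]
    split_ifs <;> simp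
  have hKc := (contDiff_coneKernel s x ν).continuous
  have hKcs : HasCompactSupport (coneKernel s x ν) := by
    refine hb.isCompact_closure.of_isClosed_subset (isClosed_tsupport _) fun z hz => ?_
    exact subset_closure (mem_of_mem_cone hs0 (hc s hs) (tsupport_coneKernel x ν hz))
  have hKi : Integrable (coneKernel s x ν) := hKc.integrable_of_hasCompactSupport hKcs
  have hKfi : Integrable fun z => coneKernel s x ν z • f z := by
    obtain ⟨C, hC⟩ := hKc.bounded_above_of_compact_support hKcs
    exact hfi.bdd_smul C hKc.aestronglyMeasurable (Eventually.of_forall hC)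
  have e : coneAverage Ω A s x ν - A x = ∫ z, coneKernel s x ν z • (f z - f x) := by
    simp only [smul_sub]
    rw [integral_sub hKfi (hKi.smul_const _), integral_smul_const, integral_coneKernel hs0,
      one_smul, hKf, hfx]
  rw [e]
  set D := Metric.closedBall x ((M + 1 / 2) * s) with hD
  have hzero : ∀ z ∉ D, coneKernel s x ν z = 0 := by
    intro z hz
    by_contra hne
    refine hz ?_
    rw [hD, Metric.mem_closedBall, dist_eq_norm]
    exact norm_sub_le_of_mem_cone hs0 hν (coneKernel_ne_zero hne)
  rw [← setIntegral_eq_integral_of_forall_compl_eq_zero (s := D)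
    (fun z hz => by rw [hzero z hz, zero_smul])]
  have hDi : IntegrableOn (fun z => ‖f z - f x‖) D := by
    refine (hfi.integrableOn.sub ?_).norm
    exact integrableOn_const (measure_closedBall_lt_top.ne)
  have hvol : volume.real D = ((M + 1 / 2) * s) ^ 3 * volume.real (Metric.ball (0 : E3) 1) := by
    rw [hD, measureReal_def, Measure.addHaar_closedBall _ _ (by positivity), ENNReal.toReal_mul,
      ENNReal.toReal_ofReal (by positivity), measureReal_def]
    simp
  have hvol0 : 0 < volume.real D := by
    rw [hvol]
    have : 0 < volume.real (Metric.ball (0 : E3) 1) :=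
      ENNReal.toReal_pos (Metric.measure_ball_pos _ _ one_pos).ne' measure_ball_lt_top.ne
    positivity
  calc ‖∫ z in D, coneKernel s x ν z • (f z - f x)‖
      ≤ ∫ z in D, (B * (s ^ 3)⁻¹) * ‖f z - f x‖ := by
        refine norm_integral_le_of_norm_le (hDi.const_mul _) (Eventually.of_forall fun z => ?_)
        rw [norm_smul]
        gcongr
        rw [coneKernel, norm_mul, norm_inv, norm_pow, Real.norm_eq_abs, Real.norm_eq_abs,
          abs_of_pos hs0, mul_comm]
        gcongr
        exact hB _
    _ = (B * (s ^ 3)⁻¹) * ∫ z in D, ‖f z - f x‖ := integral_const_mul _ _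
    _ = κ * ⨍ z in D, ‖f z - f x‖ := by
        rw [setAverage_eq, smul_eq_mul, ← mul_assoc]
        congr 1
        rw [hvol, hκ]
        rw [hvol] at hvol0
        have hne := (pos_of_mul_pos_right hvol0 (by positivity)).ne'
        field_simp

/-- A Sobolev field differs from its cone averages by at most the potential of its gradient. -/
theorem ae_enorm_coneAverage_sub_le {B M : ℝ} (hB : ∀ y, |profile y| ≤ B) (hM : 0 ≤ M)
    {A : L2Field Ω} {G : Fin 3 → L2Field Ω} (hG : IsWeakGradient Ω A G) :
    ∀ᵐ x ∂(volume.restrict Ω), ∀ ν : E3, ‖ν‖ ≤ M → ∀ t : ℝ, 0 < t →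
      (∀ s ∈ Ioc 0 t, ∀ y : E3, ‖y‖ ≤ 1 / 2 → x + s • (y + ν) ∈ Ω) →
      ‖coneAverage Ω A t x ν - A x‖ₑ
        ≤ ENNReal.ofReal ((M + 1 / 2) * B) * conePotential Ω (M + 1 / 2) t G x := by
  filter_upwards [ae_tendsto_coneAverage hΩ hb hM A] with x hx ν hν t ht hc
  have h1 := (tendsto_const_nhds (x := coneAverage Ω A t x ν)).sub (hx ν hν t ht hc)
  refine le_of_tendsto h1.enorm ?_
  filter_upwards [Ioc_mem_nhdsGT ht] with ε hε
  exact enorm_coneAverage_sub_le hΩ hb hB hG hν hc hε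

end Averages

end VectorLaplacian

end

noncomputable section

open scoped ENNReal

namespace VectorLaplacian

/-! ### The Schur bound for the potential -/

/-- Cauchy–Schwarz after splitting the weight as `k = √k · √k`. -/
theorem sq_lintegral_mul_le {α : Type*} [MeasurableSpace α] (μ : Measure α)
    {k g : α → ℝ≥0∞} (hk : AEMeasurable k μ) (hg : AEMeasurable g μ) :
    (∫⁻ a, k a * g a ∂μ) ^ 2 ≤ (∫⁻ a, k a ∂μ) * ∫⁻ a, k a * g a ^ 2 ∂μ := by
  have h := ENNReal.lintegral_mul_le_Lp_mul_Lq μ Real.HolderConjugate.two_two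
    (hk.pow_const (1 / 2 : ℝ)) ((hk.pow_const (1 / 2 : ℝ)).mul hg)
  have e0 : ∀ a, k a ^ (1 / 2 : ℝ) * k a ^ (1 / 2 : ℝ) = k a := fun a => by
    rw [← ENNReal.rpow_add_of_nonneg _ _ (by norm_num) (by norm_num)]; norm_num
  have e1 : ∀ a, ((fun a => k a ^ (1 / 2 : ℝ)) * ((fun a => k a ^ (1 / 2 : ℝ)) * g)) a
      = k a * g a := fun a => by
    simp only [Pi.mul_apply]; rw [← mul_assoc, e0]
  have e2 : ∀ a, (k a ^ (1 / 2 : ℝ)) ^ (2 : ℝ) = k a := fun a => by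
    rw [← ENNReal.rpow_mul]; norm_num
  have e3 : ∀ a, ((fun a => k a ^ (1 / 2 : ℝ)) * g) a ^ (2 : ℝ) = k a * g a ^ 2 := fun a => by
    rw [Pi.mul_apply, ENNReal.mul_rpow_of_nonneg _ _ (by norm_num), e2]; norm_num
  simp only [e1, e2, e3] at h
  calc (∫⁻ a, k a * g a ∂μ) ^ 2
      ≤ ((∫⁻ a, k a ∂μ) ^ (1 / 2 : ℝ) * (∫⁻ a, k a * g a ^ 2 ∂μ) ^ (1 / 2 : ℝ)) ^ 2 := by gcongr
    _ = _ := by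
      rw [mul_pow]
      congr 1 <;> rw [← ENNReal.rpow_natCast, ← ENNReal.rpow_mul] <;> norm_num

theorem measurable_scaleKernel (R : ℝ) :
    Measurable fun p : ℝ × E3 × E3 => scaleKernel R p.1 p.2.1 p.2.2 := by
  refine Measurable.ite (IsClosed.measurableSet (isClosed_le ?_ ?_)) ?_ measurable_const
  · fun_prop
  · fun_prop
  · fun_prop

theorem scaleKernel_comm (R s : ℝ) (x z : E3) : scaleKernel R s x z = scaleKernel R s z x := by
  rw [scaleKernel, scaleKernel, dist_comm]

/-- The mass of the kernels. -/
def kernelMass (R : ℝ) : ℝ≥0∞ := ENNReal.ofReal (R ^ 3) * volume (Metric.ball (0 : E3) 1)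

theorem lintegral_scaleKernel {R s : ℝ} (hR : 0 ≤ R) (hs : 0 < s) (x : E3) :
    ∫⁻ z, scaleKernel R s x z = kernelMass R := by
  have h1 : (fun z => scaleKernel R s x z)
      = (Metric.closedBall x (R * s)).indicator fun _ => ENNReal.ofReal (s ^ 3)⁻¹ := by
    ext z
    simp only [scaleKernel, indicator, Metric.mem_closedBall]
  rw [h1, lintegral_indicator_const measurableSet_closedBall,
    Measure.addHaar_closedBall _ _ (by positivity), ← mul_assoc, kernelMass,
    ← ENNReal.ofReal_mul (by positivity)]
  congr 2
  simp only [finrank_euclideanSpace, Fintype.card_fin]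
  field_simp

/-- The Schur test with the scale as an additional variable: Cauchy–Schwarz in `(s, z)` with weight
`k` uses the mass in `z`, and after exchanging the integrals the mass in `x` is used. -/
theorem lintegral_sq_lintegral_le {S X : Type*} [MeasurableSpace S] [MeasurableSpace X]
    (μ : Measure S) [SFinite μ] (m : Measure X) [SFinite m] {k : S → X → X → ℝ≥0∞}
    (hk : Measurable fun p : S × X × X => k p.1 p.2.1 p.2.2) {g : X → ℝ≥0∞} (hg : Measurable g)
    {a : ℝ≥0∞} (h1 : ∀ᵐ s ∂μ, ∀ x, ∫⁻ z, k s x z ∂m ≤ a)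
    (h2 : ∀ᵐ s ∂μ, ∀ z, ∫⁻ x, k s x z ∂m ≤ a) :
    ∫⁻ x, (∫⁻ s, ∫⁻ z, k s x z * g z ∂m ∂μ) ^ 2 ∂m
      ≤ (μ univ * a) ^ 2 * ∫⁻ z, g z ^ 2 ∂m := by
  have hk1 : ∀ x, Measurable fun p : S × X => k p.1 x p.2 := fun x =>
    hk.comp (measurable_fst.prodMk (measurable_const.prodMk measurable_snd))
  have hpt : ∀ x, (∫⁻ s, ∫⁻ z, k s x z * g z ∂m ∂μ) ^ 2
      ≤ (μ univ * a) * ∫⁻ p, k p.1 x p.2 * g p.2 ^ 2 ∂(μ.prod m) := by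
    intro x
    have e : ∫⁻ s, ∫⁻ z, k s x z * g z ∂m ∂μ = ∫⁻ p, k p.1 x p.2 * g p.2 ∂(μ.prod m) := by
      have hm : AEMeasurable (fun p : S × X => k p.1 x p.2 * g p.2) (μ.prod m) :=
        ((hk1 x).mul (hg.comp measurable_snd)).aemeasurable
      exact (lintegral_prod _ hm).symm
    rw [e]
    refine (sq_lintegral_mul_le _ (hk1 x).aemeasurable
      (hg.comp measurable_snd).aemeasurable).trans ?_
    refine mul_le_mul' ?_ le_rfl
    rw [lintegral_prod _ (hk1 x).aemeasurable]
    calc ∫⁻ s, ∫⁻ z, k s x z ∂m ∂μ ≤ ∫⁻ _, a ∂μ := lintegral_mono_ae (h1.mono fun s hs => hs x)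
      _ = μ univ * a := by rw [lintegral_const, mul_comm]
  have hmeas : Measurable fun p : X × S × X => k p.2.1 p.1 p.2.2 * g p.2.2 ^ 2 :=
    (hk.comp ((measurable_fst.comp measurable_snd).prodMk
      (measurable_fst.prodMk (measurable_snd.comp measurable_snd)))).mul
      ((hg.comp (measurable_snd.comp measurable_snd)).pow_const 2)
  have hmeas2 : Measurable fun q : S × X => ∫⁻ x, k q.1 x q.2 * g q.2 ^ 2 ∂m :=
    (hmeas.comp measurable_swap).lintegral_prod_right'
  calc ∫⁻ x, (∫⁻ s, ∫⁻ z, k s x z * g z ∂m ∂μ) ^ 2 ∂m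
      ≤ ∫⁻ x, (μ univ * a) * ∫⁻ p, k p.1 x p.2 * g p.2 ^ 2 ∂(μ.prod m) ∂m := lintegral_mono hpt
    _ = (μ univ * a) * ∫⁻ x, ∫⁻ p, k p.1 x p.2 * g p.2 ^ 2 ∂(μ.prod m) ∂m :=
        lintegral_const_mul _ hmeas.lintegral_prod_right'
    _ = (μ univ * a) * ∫⁻ p, ∫⁻ x, k p.1 x p.2 * g p.2 ^ 2 ∂m ∂(μ.prod m) := by
        rw [lintegral_lintegral_swap hmeas.aemeasurable]
    _ ≤ (μ univ * a) * ∫⁻ _, ∫⁻ z, a * g z ^ 2 ∂m ∂μ := by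
        refine mul_le_mul' le_rfl ?_
        rw [lintegral_prod _ hmeas2.aemeasurable]
        refine lintegral_mono_ae (h2.mono fun s hs => lintegral_mono fun z => ?_)
        have hkm : Measurable fun x => k s x z :=
          hk.comp (measurable_const.prodMk (measurable_id.prodMk measurable_const))
        simp only
        rw [lintegral_mul_const _ hkm]
        exact mul_le_mul' (hs z) le_rfl
    _ = _ := by
        rw [lintegral_const, lintegral_const_mul _ (hg.pow_const 2)]
        ring

/-- Each scale contributes a kernel of mass at most `kernelMass R`, so integrating over scales up to
`t` yields the factor `t`. This smallness drives the Rellich theorem. -/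
theorem lintegral_conePotential_sq_le {Ω : Set E3} {R t : ℝ} (hR : 0 ≤ R)
    (G : Fin 3 → L2Field Ω) :
    ∫⁻ x in Ω, conePotential Ω R t G x ^ 2
      ≤ (ENNReal.ofReal t * kernelMass R) ^ 2 * ∫⁻ z in Ω, (∑ k, ‖G k z‖ₑ) ^ 2 := by
  have hgm : Measurable fun z => ∑ k, ‖G k z‖ₑ :=
    Finset.measurable_fun_sum _ fun k _ => (Lp.stronglyMeasurable (G k)).measurable.enorm
  have hle : ∀ᵐ s ∂(volume : Measure ℝ).restrict (Ioc 0 t), ∀ x,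
      ∫⁻ z in Ω, scaleKernel R s x z ≤ kernelMass R := by
    filter_upwards [ae_restrict_mem measurableSet_Ioc] with s hs x
    exact (setLIntegral_le_lintegral _ _).trans (lintegral_scaleKernel hR hs.1 x).le
  have h := lintegral_sq_lintegral_le ((volume : Measure ℝ).restrict (Ioc 0 t))
    ((volume : Measure E3).restrict Ω) (measurable_scaleKernel R) hgm hle (by
      filter_upwards [hle] with s hs z
      rw [lintegral_congr fun x => scaleKernel_comm R s x z]
      exact hs z)
  rw [Measure.restrict_apply_univ, Real.volume_Ioc, sub_zero] at h
  exact h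

theorem lintegral_enorm_sq {Ω : Set E3} (A : L2Field Ω) :
    ∫⁻ x in Ω, ‖A x‖ₑ ^ 2 = ENNReal.ofReal (‖A‖ ^ 2) := by
  have h := eLpNorm_nnreal_pow_eq_lintegral (f := A) (μ := volume.restrict Ω) (p := 2) two_ne_zero
  have h2 : ‖A‖ₑ = eLpNorm A 2 (volume.restrict Ω) := Lp.enorm_def A
  have h3 : ((2 : NNReal) : ℝ≥0∞) = 2 := rfl
  rw [h3, ← h2] at h
  have h4 : ((2 : NNReal) : ℝ) = ((2 : ℕ) : ℝ) := rfl
  simp only [h4, ENNReal.rpow_natCast] at h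
  rw [← h, ← ofReal_norm, ENNReal.ofReal_pow (norm_nonneg _)]

theorem lintegral_sum_enorm_sq_le {Ω : Set E3} (G : Fin 3 → L2Field Ω) :
    ∫⁻ z in Ω, (∑ k, ‖G k z‖ₑ) ^ 2 ≤ ENNReal.ofReal (3 * ∑ k, ‖G k‖ ^ 2) := by
  have h1 : ∀ z, (∑ k, ‖G k z‖ₑ) ^ 2 ≤ 3 * ∑ k, ‖G k z‖ₑ ^ 2 := by
    intro z
    have := ENNReal.rpow_sum_le_const_mul_sum_rpow (s := Finset.univ)
      (f := fun k => ‖G k z‖ₑ) (p := 2) (by norm_num)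
    norm_num at this
    exact this
  calc ∫⁻ z in Ω, (∑ k, ‖G k z‖ₑ) ^ 2 ≤ ∫⁻ z in Ω, 3 * ∑ k, ‖G k z‖ₑ ^ 2 := lintegral_mono h1
    _ = 3 * ∑ k, ∫⁻ z in Ω, ‖G k z‖ₑ ^ 2 := by
        have hm : ∀ k, Measurable fun z => ‖G k z‖ₑ ^ 2 := fun k =>
          (Lp.stronglyMeasurable (G k)).measurable.enorm.pow_const 2
        rw [lintegral_const_mul _ (Finset.measurable_fun_sum _ fun k _ => hm k),
          lintegral_finsetSum _ fun k _ => hm k]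
    _ = _ := by
        simp only [lintegral_enorm_sq]
        rw [← ENNReal.ofReal_sum_of_nonneg fun k _ => by positivity,
          ENNReal.ofReal_mul (by norm_num)]
        norm_num

end VectorLaplacian

end

noncomputable section

namespace VectorLaplacian

/-! ### Weak sequential compactness -/

/-- Sequential Banach–Alaoglu in the separable dual pair, transported through the Riesz isomorphism.
-/
theorem exists_subseq_tendsto_inner {V : Type*} [NormedAddCommGroup V] [InnerProductSpace ℝ V]
    [CompleteSpace V] [TopologicalSpace.SeparableSpace V] {M : ℝ} (x : ℕ → V)
    (hx : ∀ n, ‖x n‖ ≤ M) :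
    ∃ v : V, ‖v‖ ≤ M ∧ ∃ φ : ℕ → ℕ, StrictMono φ ∧
      ∀ w, Tendsto (fun n => ⟪x (φ n), w⟫_ℝ) atTop (𝓝 ⟪v, w⟫_ℝ) := by
  let f : ℕ → WeakDual ℝ V := fun n =>
    StrongDual.toWeakDual (InnerProductSpace.toDual ℝ V (x n))
  obtain ⟨g, hg, φ, hφ, hlim⟩ := WeakDual.isSeqCompact_closedBall ℝ V
    (0 : StrongDual ℝ V) M (x := f) (fun n => by
      show InnerProductSpace.toDual ℝ V (x n) ∈ Metric.closedBall 0 M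
      simpa using hx n)
  refine ⟨(InnerProductSpace.toDual ℝ V).symm (WeakDual.toStrongDual g), ?_, φ, hφ, fun w => ?_⟩
  · have : WeakDual.toStrongDual g ∈ Metric.closedBall (0 : StrongDual ℝ V) M := hg
    simpa using this
  · have := (WeakDual.eval_continuous w).continuousAt.tendsto.comp hlim
    rw [InnerProductSpace.toDual_symm_apply]
    exact this

theorem isCompactOperator_of_tendsto_zero {V X : Type*} [NormedAddCommGroup V]
    [InnerProductSpace ℝ V] [CompleteSpace V] [TopologicalSpace.SeparableSpace V]
    [NormedAddCommGroup X] [InnerProductSpace ℝ X] (J : V →L[ℝ] X)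
    (hJ : ∀ (x : ℕ → V) (M : ℝ), (∀ n, ‖x n‖ ≤ M) →
      (∀ w, Tendsto (fun n => ⟪x n, w⟫_ℝ) atTop (𝓝 0)) →
        Tendsto (fun n => J (x n)) atTop (𝓝 0)) : IsCompactOperator J := by
  have hc : IsCompact (J '' Metric.closedBall 0 1) := by
    refine IsSeqCompact.isCompact fun y hy => ?_
    choose x hx hxy using hy
    have hx' : ∀ n, ‖x n‖ ≤ 1 := fun n => by simpa using hx n
    obtain ⟨v, hv, φ, hφ, hlim⟩ := exists_subseq_tendsto_inner x hx'
    refine ⟨J v, ⟨v, by simpa using hv, rfl⟩, φ, hφ, ?_⟩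
    have h1 := hJ (fun n => x (φ n) - v) (1 + 1)
      (fun n => (norm_sub_le _ _).trans (add_le_add (hx' _) hv)) (fun w => by
        have := (hlim w).sub_const ⟪v, w⟫_ℝ
        simpa only [inner_sub_left, sub_self] using this)
    have h2 := h1.add_const (J v)
    simp only [map_sub, sub_add_cancel, zero_add] at h2
    refine h2.congr fun n => ?_
    simp [hxy]
  exact (isCompactOperator_iff_image_closedBall_subset_compact J.toLinearMap one_pos).2
    ⟨_, hc, Subset.rfl⟩

/-! ### The operator with a given resolvent -/

section Resolvent

variable {X : Type*} [NormedAddCommGroup X] [InnerProductSpace ℝ X]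

/-- The operator `K⁻¹ - 1`, defined on the range of the injective operator `K`. -/
def inverseSubOne (K : X →L[ℝ] X) (hK : Function.Injective K) : X →ₗ.[ℝ] X where
  domain := LinearMap.range K.toLinearMap
  toFun := (LinearEquiv.ofInjective K.toLinearMap hK).symm.toLinearMap
    - (LinearMap.range K.toLinearMap).subtype

variable {K : X →L[ℝ] X} {hK : Function.Injective K}

theorem mem_domain_inverseSubOne (f : X) : K f ∈ (inverseSubOne K hK).domain := ⟨f, rfl⟩

theorem inverseSubOne_apply (f : X) (h : K f ∈ (inverseSubOne K hK).domain) :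
    inverseSubOne K hK ⟨K f, h⟩ = f - K f := by
  show (LinearEquiv.ofInjective K.toLinearMap hK).symm ⟨K f, h⟩ - K f = f - K f
  congr 1
  rw [LinearEquiv.symm_apply_eq]
  rfl

theorem exists_eq_of_domain (x : (inverseSubOne K hK).domain) :
    ∃ f, x = ⟨K f, mem_domain_inverseSubOne f⟩ := by
  obtain ⟨x, f, rfl⟩ := x
  exact ⟨f, rfl⟩

theorem inner_inverseSubOne_comm (hs : ∀ x y, ⟪K x, y⟫_ℝ = ⟪x, K y⟫_ℝ)
    (x y : (inverseSubOne K hK).domain) :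
    ⟪inverseSubOne K hK x, (y : X)⟫_ℝ = ⟪(x : X), inverseSubOne K hK y⟫_ℝ := by
  obtain ⟨f, rfl⟩ := exists_eq_of_domain x
  obtain ⟨g, rfl⟩ := exists_eq_of_domain y
  rw [inverseSubOne_apply, inverseSubOne_apply, inner_sub_left, inner_sub_right, hs f g]

/-- For `y` in the domain of the adjoint with image `w`, testing against `K f` gives `K w = y - K
y`. Hence `y = K (w + y)` lies in the range of `K`, so the adjoint has no larger domain. -/
theorem isSelfAdjoint_inverseSubOne [CompleteSpace X] (hs : ∀ x y, ⟪K x, y⟫_ℝ = ⟪x, K y⟫_ℝ)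
    (hd : Dense ((inverseSubOne K hK).domain : Set X)) : IsSelfAdjoint (inverseSubOne K hK) := by
  rw [LinearPMap.isSelfAdjoint_def]
  have hle : inverseSubOne K hK ≤ (inverseSubOne K hK).adjoint := by
    refine LinearPMap.IsFormalAdjoint.le_adjoint hd fun x y => ?_
    exact inner_inverseSubOne_comm hs x y
  refine (LinearPMap.eq_of_le_of_domain_eq hle (le_antisymm hle.1 fun y hy => ?_)).symm
  set w := (inverseSubOne K hK).adjoint ⟨y, hy⟩ with hw
  have h1 : ∀ f, ⟪K w, f⟫_ℝ = ⟪y - K y, f⟫_ℝ := by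
    intro f
    have := LinearPMap.adjoint_isFormalAdjoint hd ⟨y, hy⟩ ⟨K f, mem_domain_inverseSubOne f⟩
    rw [inverseSubOne_apply, inner_sub_right, ← hs y f, ← hw] at this
    rw [hs, inner_sub_left]
    exact this
  have h2 : K w = y - K y := ext_inner_right ℝ h1
  refine ⟨w + y, ?_⟩
  show K (w + y) = y
  rw [map_add, h2, sub_add_cancel]

theorem isSelfAdjoint_of_isResolvent [CompleteSpace X] {T : X →ₗ.[ℝ] X} {z : ℝ} {R : X →L[ℝ] X}
    (hs : ∀ x y : T.domain, ⟪T x, (y : X)⟫_ℝ = ⟪(x : X), T y⟫_ℝ) (hR : IsResolvent T z R) :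
    IsSelfAdjoint R := by
  rw [ContinuousLinearMap.isSelfAdjoint_iff_isSymmetric]
  intro x y
  obtain ⟨hx, hx'⟩ := hR.1 x
  obtain ⟨hy, hy'⟩ := hR.1 y
  have h := hs ⟨R x, hx⟩ ⟨R y, hy⟩
  show ⟪R x, y⟫_ℝ = ⟪x, R y⟫_ℝ
  conv_lhs => rw [← hy']
  conv_rhs => rw [← hx']
  simp only [inner_sub_left, inner_sub_right, real_inner_smul_left, real_inner_smul_right, h]

/-! ### Resolvents and spectrum of `K⁻¹ - 1` for compact `K`. -/

variable [CompleteSpace X]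

/-- On the range of `K` one has `(T - z) K = 1 - (1 + z) K`, so the resolvent is `K (1 - (1 + z)
K)⁻¹`. The inverse exists by the Fredholm alternative, and the factor `K` makes the resolvent
compact. -/
theorem exists_isResolvent_of_ker_eq (hc : IsCompactOperator K) {z : ℝ}
    (hz : ∀ f, f = (1 + z) • K f → f = 0) :
    ∃ R : X →L[ℝ] X, IsResolvent (inverseSubOne K hK) z R ∧ IsCompactOperator R := by
  obtain ⟨L, hL1, hL2⟩ : ∃ L : X →L[ℝ] X, (∀ f, L f - (1 + z) • K (L f) = f) ∧
      ∀ f, L (f - (1 + z) • K f) = f := by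
    -- At `z = -1` the resolvent is `K` itself; the alternative is stated for a nonzero spectral
    -- parameter `(1 + z)⁻¹`.
    by_cases h0 : 1 + z = 0
    · exact ⟨ContinuousLinearMap.id ℝ X, by simp [h0], by simp [h0]⟩
    · have hμ : (1 + z)⁻¹ ≠ 0 := inv_ne_zero h0
      have hmem := (hc.hasEigenvalue_or_mem_resolventSet hμ).resolve_left (by
        intro hev
        obtain ⟨f, hf⟩ := hev.exists_hasEigenvector
        refine hf.2 (hz f ?_)
        have hf1 : K f = (1 + z)⁻¹ • f := hf.apply_eq_smul
        rw [hf1, smul_smul, mul_inv_cancel₀ h0, one_smul])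
      rw [spectrum.mem_resolventSet_iff] at hmem
      obtain ⟨u, hu⟩ := hmem
      have hu' : ∀ f, (u : X →L[ℝ] X) f = (1 + z)⁻¹ • f - K f := fun f => by
        rw [hu]; simp [Algebra.algebraMap_eq_smul_one]
      have hu1 : ∀ f, (u : X →L[ℝ] X) ((↑u⁻¹ : X →L[ℝ] X) f) = f := fun f => by
        exact DFunLike.congr_fun u.mul_inv f
      have hu2 : ∀ f, (↑u⁻¹ : X →L[ℝ] X) ((u : X →L[ℝ] X) f) = f := fun f => by
        exact DFunLike.congr_fun u.inv_mul f
      refine ⟨(1 + z)⁻¹ • (↑u⁻¹ : X →L[ℝ] X), fun f => ?_, fun f => ?_⟩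
      · have := hu1 f
        rw [hu'] at this
        rw [smul_apply, map_smul, smul_smul, mul_inv_cancel₀ h0, one_smul]
        exact this
      · have h1 : f - (1 + z) • K f = (1 + z) • (u : X →L[ℝ] X) f := by
          rw [hu', smul_sub, smul_smul, mul_inv_cancel₀ h0, one_smul]
        rw [h1, smul_apply, map_smul, hu2, smul_smul, inv_mul_cancel₀ h0, one_smul]
  refine ⟨K.comp L, ⟨fun x => ⟨mem_domain_inverseSubOne (L x), ?_⟩, fun x => ?_⟩, hc.comp_clm L⟩
  · have h1 : inverseSubOne K hK ⟨(K.comp L) x, mem_domain_inverseSubOne (L x)⟩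
        = L x - K (L x) := inverseSubOne_apply (L x) _
    rw [h1, ContinuousLinearMap.comp_apply]
    have := hL1 x
    rw [add_smul, one_smul] at this
    rw [sub_sub]
    exact this
  · obtain ⟨f, rfl⟩ := exists_eq_of_domain x
    rw [inverseSubOne_apply, ContinuousLinearMap.comp_apply]
    have := hL2 f
    rw [add_smul, one_smul] at this
    rw [sub_sub, this]

theorem exists_eq_smul_of_mem_spectrumSet (hc : IsCompactOperator K) {z : ℝ}
    (hz : z ∈ spectrumSet (inverseSubOne K hK)) : ∃ f, f = (1 + z) • K f ∧ f ≠ 0 := by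
  by_contra! hcon
  obtain ⟨R, hR, -⟩ := exists_isResolvent_of_ker_eq (hK := hK) hc hcon
  exact hz ⟨R, hR⟩

/-- Infinitely many spectral points in `[-r, r]` would give unit vectors with `fₙ = (1 + zₙ) K fₙ`.
Their images under `K` are mutually orthogonal and of norm at least `(1 + r)⁻¹`, so no subsequence
of them is Cauchy, against compactness. -/
theorem finite_spectrumSet_inter (hc : IsCompactOperator K)
    (hs : ∀ x y, ⟪K x, y⟫_ℝ = ⟪x, K y⟫_ℝ) (r : ℝ) :
    (spectrumSet (inverseSubOne K hK) ∩ Icc (-r) r).Finite := by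
  by_contra hinf
  let z := Set.Infinite.natEmbedding _ hinf
  have hex : ∀ n, ∃ f : X, f = (1 + (z n : ℝ)) • K f ∧ ‖f‖ = 1 := by
    intro n
    obtain ⟨f, hf, hf0⟩ := exists_eq_smul_of_mem_spectrumSet hc (z n).2.1
    refine ⟨‖f‖⁻¹ • f, ?_, ?_⟩
    · rw [map_smul, smul_comm, ← hf]
    · rw [norm_smul, norm_inv, norm_norm, inv_mul_cancel₀ (norm_ne_zero_iff.2 hf0)]
  choose f hf hf1 using hex
  have horth : ∀ n m, n ≠ m → ⟪K (f n), K (f m)⟫_ℝ = 0 := by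
    intro n m hnm
    have h1 : ⟪f n, K (f m)⟫_ℝ = (1 + (z n : ℝ)) * ⟪K (f n), K (f m)⟫_ℝ := by
      conv_lhs => rw [hf n]
      rw [real_inner_smul_left]
    have h2 : ⟪K (f n), f m⟫_ℝ = (1 + (z m : ℝ)) * ⟪K (f n), K (f m)⟫_ℝ := by
      conv_lhs => rw [hf m]
      rw [real_inner_smul_right]
    rw [hs] at h2
    have hne : (z n : ℝ) ≠ z m := fun h => hnm (z.injective (Subtype.ext h))
    have h3 : ((z n : ℝ) - z m) * ⟪K (f n), K (f m)⟫_ℝ = 0 := by linarith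
    exact (mul_eq_zero.1 h3).resolve_left (sub_ne_zero.2 hne)
  have hr : 0 ≤ r := by
    have := (z 0).2.2
    linarith [this.1, this.2]
  have hlow : ∀ n, 1 ≤ (1 + r) * ‖K (f n)‖ := by
    intro n
    have h1 : ‖f n‖ = |1 + (z n : ℝ)| * ‖K (f n)‖ := by
      conv_lhs => rw [hf n]
      rw [norm_smul, Real.norm_eq_abs]
    rw [hf1] at h1
    rw [h1]
    gcongr
    have := (z n).2.2
    exact abs_le.2 ⟨by linarith [this.1], by linarith [this.2]⟩
  obtain ⟨C, hC, hC'⟩ := hc.image_closedBall_subset_compact (f := K.toLinearMap) 1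
  obtain ⟨y, -, ψ, hψ, hψy⟩ := hC.tendsto_subseq
    (fun n => hC' ⟨f n, by simp [hf1], rfl⟩)
  have hcau := Metric.cauchySeq_iff'.1 hψy.cauchySeq (1 + r)⁻¹ (by positivity)
  obtain ⟨m, hm⟩ := hcau
  have h1 : ‖K (f (ψ (m + 1))) - K (f (ψ m))‖ < (1 + r)⁻¹ := by
    simpa [dist_eq_norm] using hm (m + 1) (Nat.le_succ m)
  have h2 := horth (ψ (m + 1)) (ψ m) (hψ.injective.ne (Nat.succ_ne_self m))
  have h3 := norm_sub_sq_eq_norm_sq_add_norm_sq_real h2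
  have h4 : ‖K (f (ψ (m + 1)))‖ ≤ ‖K (f (ψ (m + 1))) - K (f (ψ m))‖ := by
    refine (pow_le_pow_iff_left₀ (norm_nonneg _) (norm_nonneg _) two_ne_zero).1 ?_
    nlinarith [norm_nonneg (K (f (ψ m)))]
  have h5 := hlow (ψ (m + 1))
  have h6 : (1 + r)⁻¹ ≤ ‖K (f (ψ (m + 1)))‖ := by
    rw [inv_le_iff_one_le_mul₀ (by positivity)]; linarith
  linarith

theorem hasDiscreteSpectrum_inverseSubOne (hc : IsCompactOperator K)
    (hs : ∀ x y, ⟪K x, y⟫_ℝ = ⟪x, K y⟫_ℝ) : HasDiscreteSpectrum (inverseSubOne K hK) := by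
  refine ⟨finite_spectrumSet_inter hc hs, fun z hz => ?_⟩
  obtain ⟨f, hf, hf0⟩ := exists_eq_smul_of_mem_spectrumSet hc hz
  have hz0 : 1 + z ≠ 0 := fun h => hf0 (by rw [hf, h, zero_smul])
  constructor
  · refine (Submodule.ne_bot_iff _).2 ⟨⟨K f, mem_domain_inverseSubOne f⟩, ?_, ?_⟩
    · rw [eigenspaceOf, LinearMap.mem_ker]
      show inverseSubOne K hK ⟨K f, mem_domain_inverseSubOne f⟩ - z • K f = 0
      rw [inverseSubOne_apply, sub_sub, sub_eq_zero]
      conv_lhs => rw [hf]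
      rw [add_smul, one_smul]
    · intro h
      have h1 : K f = 0 := congrArg Subtype.val h
      exact hf0 (by rw [hf, h1, smul_zero])
  · have hfd : FiniteDimensional ℝ (Module.End.eigenspace K.toLinearMap (1 + z)⁻¹) :=
      ContinuousLinearMap.finite_dimensional_eigenspace hc _ (inv_ne_zero hz0)
    let ι : eigenspaceOf (inverseSubOne K hK) z →ₗ[ℝ] X :=
      (inverseSubOne K hK).domain.subtype.comp (eigenspaceOf (inverseSubOne K hK) z).subtype
    have hι : ∀ x, ι x ∈ Module.End.eigenspace K.toLinearMap (1 + z)⁻¹ := by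
      rintro ⟨x, hx⟩
      obtain ⟨g, rfl⟩ := exists_eq_of_domain x
      rw [eigenspaceOf, LinearMap.mem_ker] at hx
      have hx' : inverseSubOne K hK ⟨K g, mem_domain_inverseSubOne g⟩ - z • K g = 0 := hx
      rw [inverseSubOne_apply, sub_sub, sub_eq_zero] at hx'
      have hg : g = (1 + z) • K g := by rw [add_smul, one_smul]; exact hx'
      rw [Module.End.mem_eigenspace_iff]
      show K (K g) = (1 + z)⁻¹ • K g
      conv_rhs => rw [hg]
      rw [map_smul, smul_smul, inv_mul_cancel₀ hz0, one_smul]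
    refine FiniteDimensional.of_injective (ι.codRestrict _ hι) ?_
    intro x y hxy
    have : ι x = ι y := by simpa using congrArg Subtype.val hxy
    exact Subtype.ext (Subtype.ext this)

end Resolvent

end VectorLaplacian

end

noncomputable section

open scoped ENNReal

namespace VectorLaplacian

/-! ### Test fields -/

/-- The class of the field `c eᵢ`. -/
def testField (Ω : Set E3) (c : E3 → ℝ) (i : Fin 3) : L2Field Ω :=
  open scoped Classical in
  -- The default `0` is never used for a continuous `c` on a bounded `Ω`.
  if h : MemLp (fun x => c x • stdVec i) 2 (volume.restrict Ω) then h.toLp _ else 0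

theorem coeFn_testField {Ω : Set E3} (hb : Bornology.IsBounded Ω) {c : E3 → ℝ}
    (hc : Continuous c) (i : Fin 3) :
    testField Ω c i =ᵐ[volume.restrict Ω] fun x => c x • stdVec i := by
  have h : MemLp (fun x => c x • stdVec i) 2 (volume.restrict Ω) :=
    memLp_of_continuous hb (hc.smul continuous_const)
  rw [testField, dif_pos h]
  exact h.coeFn_toLp

theorem inner_testField {Ω : Set E3} (hb : Bornology.IsBounded Ω) {c : E3 → ℝ}
    (hc : Continuous c) (i : Fin 3) (A : L2Field Ω) :
    ⟪testField Ω c i, A⟫_ℝ = ∫ x in Ω, c x * A x i := by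
  rw [L2.inner_def]
  refine integral_congr_ae ?_
  filter_upwards [coeFn_testField hb hc i] with x hx
  rw [hx, real_inner_smul_left, EuclideanSpace.inner_single_left]
  simp

/-- A cone average is a continuous functional of the field, so weak convergence implies its
convergence. -/
theorem coneAverage_apply {Ω : Set E3} (hΩ : IsOpen Ω) (hb : Bornology.IsBounded Ω)
    (A : L2Field Ω) (t : ℝ) (x ν : E3) (i : Fin 3) :
    coneAverage Ω A t x ν i = ⟪testField Ω (coneKernel t x ν) i, A⟫_ℝ := by
  rw [inner_testField hb (contDiff_coneKernel t x ν).continuous, coneAverage,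
    integral_smul_apply hΩ hb A (contDiff_coneKernel t x ν).continuous]

/-! ### Compactness -/

theorem measurable_coneAverage {Ω : Set E3} (A : L2Field Ω) (t : ℝ) {N : E3 → E3}
    (hN : Continuous N) : Measurable fun x => coneAverage Ω A t x (-N x) := by
  refine StronglyMeasurable.measurable ?_
  have hk : Continuous fun p : E3 × E3 => coneKernel t p.1 (-N p.1) p.2 := by
    have := contDiff_profile.continuous
    unfold coneKernel
    fun_prop
  have h : StronglyMeasurable fun p : E3 × E3 => coneKernel t p.1 (-N p.1) p.2 • A p.2 :=
    hk.stronglyMeasurable.smul ((Lp.stronglyMeasurable A).comp_measurable measurable_snd)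
  exact h.integral_prod_right

theorem tendsto_coneAverage_zero {Ω : Set E3} (hΩ : IsOpen Ω) (hb : Bornology.IsBounded Ω)
    {A : ℕ → L2Field Ω} (hw : ∀ B, Tendsto (fun n => ⟪A n, B⟫_ℝ) atTop (𝓝 0)) (t : ℝ) (x ν : E3) :
    Tendsto (fun n => coneAverage Ω (A n) t x ν) atTop (𝓝 0) := by
  have h1 : ∀ u : E3, u = ∑ i, u i • stdVec i := by
    intro u; ext i; fin_cases i <;> simp [Fin.sum_univ_three]
  have h2 : Tendsto (fun n => ∑ i, coneAverage Ω (A n) t x ν i • stdVec i) atTop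
      (𝓝 (∑ i : Fin 3, (0 : ℝ) • stdVec i)) := by
    refine tendsto_finsetSum _ fun i _ => Tendsto.smul_const ?_ _
    simp only [coneAverage_apply hΩ hb]
    refine (hw (testField Ω (coneKernel t x ν) i)).congr fun n => real_inner_comm _ _
  simp only [zero_smul, Finset.sum_const_zero] at h2
  exact h2.congr fun n => (h1 _).symm

/-- At a fixed scale the averages tend to zero pointwise and are bounded uniformly in `n` and `x`,
so dominated convergence on a set of finite measure applies. -/
theorem tendsto_lintegral_coneAverage_sq {Ω : Set E3} (hΩ : IsOpen Ω) (hb : Bornology.IsBounded Ω)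
    {A : ℕ → L2Field Ω} {M : ℝ} (hA : ∀ n, ‖A n‖ ≤ M)
    (hw : ∀ B, Tendsto (fun n => ⟪A n, B⟫_ℝ) atTop (𝓝 0)) (t : ℝ) {N : E3 → E3}
    (hN : Continuous N) :
    Tendsto (fun n => ∫⁻ x in Ω, ‖coneAverage Ω (A n) t x (-N x)‖ₑ ^ 2) atTop (𝓝 0) := by
  obtain ⟨B, hB0, hB⟩ := exists_bound_profile
  have hfin := isFiniteMeasure_restrict hb
  set c : ℝ≥0∞ := ‖(t ^ 3)⁻¹‖ₑ * ENNReal.ofReal B with hc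
  set a : ℝ≥0∞ := c * (volume Ω + ENNReal.ofReal (M ^ 2)) with ha
  have hatop : a ≠ ⊤ := by
    refine ENNReal.mul_ne_top (ENNReal.mul_ne_top enorm_ne_top ENNReal.ofReal_ne_top) ?_
    exact ENNReal.add_ne_top.2 ⟨hb.measure_lt_top.ne, ENNReal.ofReal_ne_top⟩
  have hbound : ∀ n x, ‖coneAverage Ω (A n) t x (-N x)‖ₑ ≤ a := by
    intro n x
    calc ‖coneAverage Ω (A n) t x (-N x)‖ₑ
        ≤ ∫⁻ z in Ω, ‖coneKernel t x (-N x) z • A n z‖ₑ := enorm_integral_le_lintegral_enorm _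
      _ ≤ ∫⁻ z in Ω, c * (1 + ‖A n z‖ₑ ^ 2) := by
          refine lintegral_mono fun z => ?_
          rw [enorm_smul, coneKernel, enorm_mul]
          refine mul_le_mul' (mul_le_mul' le_rfl ?_) ?_
          · rw [Real.enorm_eq_ofReal_abs]; exact ENNReal.ofReal_le_ofReal (hB _)
          · rcases le_total (‖A n z‖ₑ) 1 with h | h
            · exact h.trans le_self_add
            · refine le_trans ?_ le_add_self
              rw [sq]
              exact le_mul_of_one_le_left' h
      _ = c * (volume Ω + ENNReal.ofReal (‖A n‖ ^ 2)) := by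
          rw [lintegral_const_mul' _ _
            (ENNReal.mul_ne_top enorm_ne_top ENNReal.ofReal_ne_top),
            lintegral_add_left measurable_const, lintegral_enorm_sq, lintegral_const,
            Measure.restrict_apply_univ, one_mul]
      _ ≤ a := by
          rw [ha]
          gcongr
          exact hA n
  have := tendsto_lintegral_of_dominated_convergence (μ := volume.restrict Ω)
    (F := fun n x => ‖coneAverage Ω (A n) t x (-N x)‖ₑ ^ 2) (f := fun _ => 0) (fun _ => a ^ 2)
    (fun n => (measurable_coneAverage (A n) t hN).enorm.pow_const 2)
    (fun n => Eventually.of_forall fun x => pow_le_pow_left' (hbound n x) 2)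
    (by
      rw [lintegral_const]
      exact ENNReal.mul_ne_top (ENNReal.pow_ne_top hatop) (measure_ne_top _ _))
    (Eventually.of_forall fun x => by
      have h1 := (tendsto_coneAverage_zero hΩ hb hw t x (-N x)).enorm
      rw [enorm_zero] at h1
      have h2 := ((ENNReal.continuous_pow 2).tendsto 0).comp h1
      rw [zero_pow two_ne_zero] at h2
      exact h2)
  simpa using this

/-- The Rellich theorem: sequences which are bounded in the Sobolev norm and converge weakly to
zero converge to zero. -/
theorem tendsto_zero_of_weakGradient_bounded {Ω : Set E3} (hΩ : IsSmoothBoundedDomain Ω)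
    {A : ℕ → L2Field Ω} {G : ℕ → Fin 3 → L2Field Ω} (hG : ∀ n, IsWeakGradient Ω (A n) (G n))
    {M : ℝ} (hA : ∀ n, ‖A n‖ ≤ M) (hGM : ∀ n k, ‖G n k‖ ≤ M)
    (hw : ∀ B, Tendsto (fun n => ⟪A n, B⟫_ℝ) atTop (𝓝 0)) :
    Tendsto A atTop (𝓝 0) := by
  have hb := hΩ.isBounded
  obtain ⟨N, hN, hNn⟩ := exists_smooth_normal hΩ
  obtain ⟨t₀, ht₀, hcone⟩ := exists_cone hΩ hN.continuous hNn
  obtain ⟨K, hK⟩ := hb.isCompact_closure.exists_bound_of_continuousOn hN.continuous.continuousOn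
  have hK' : ∀ x ∈ Ω, ‖-N x‖ ≤ max K 0 := fun x hx => by
    rw [norm_neg]; exact (hK x (subset_closure hx)).trans (le_max_left _ _)
  obtain ⟨B, hB0, hB⟩ := exists_bound_profile
  set R := max K 0 + 1 / 2 with hR
  have hR0 : 0 ≤ R := by positivity
  set c := ENNReal.ofReal (R * B) with hc
  set E : ℝ≥0∞ := 2 * (c ^ 2 * (kernelMass R ^ 2 * ENNReal.ofReal (3 * (3 * M ^ 2)))) with hE
  have hEtop : E ≠ ⊤ := by
    have : kernelMass R ≠ ⊤ := ENNReal.mul_ne_top ENNReal.ofReal_ne_top measure_ball_lt_top.ne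
    exact ENNReal.mul_ne_top (by norm_num) (ENNReal.mul_ne_top
      (ENNReal.pow_ne_top ENNReal.ofReal_ne_top)
      (ENNReal.mul_ne_top (ENNReal.pow_ne_top this) ENNReal.ofReal_ne_top))
  -- The constant `E` depends neither on `t` nor on `n`: the first term is small for small `t`
  -- uniformly in `n`, and the second tends to zero once `t` is fixed.
  have key : ∀ t ∈ Ioc 0 t₀, ∀ n, ENNReal.ofReal (‖A n‖ ^ 2)
      ≤ ENNReal.ofReal t ^ 2 * E
        + 2 * ∫⁻ x in Ω, ‖coneAverage Ω (A n) t x (-N x)‖ₑ ^ 2 := by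
    intro t ht n
    have hae := ae_enorm_coneAverage_sub_le hΩ.isOpen hb hB (le_max_right K 0) (hG n)
    have hpt : ∀ᵐ x ∂(volume.restrict Ω), ‖A n x‖ₑ ^ 2
        ≤ 2 * (c * conePotential Ω R t (G n) x) ^ 2
          + 2 * ‖coneAverage Ω (A n) t x (-N x)‖ₑ ^ 2 := by
      filter_upwards [hae, ae_restrict_mem hΩ.isOpen.measurableSet] with x hx hxΩ
      have h1 := hx (-N x) (hK' x hxΩ) t ht.1 fun s hs y hy => by
        rw [← sub_eq_add_neg]
        exact hcone x hxΩ s ⟨hs.1, hs.2.trans ht.2⟩ y hy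
      have h2 : ‖A n x‖ₑ ≤ c * conePotential Ω R t (G n) x
          + ‖coneAverage Ω (A n) t x (-N x)‖ₑ := by
        have h3 : A n x = coneAverage Ω (A n) t x (-N x)
            - (coneAverage Ω (A n) t x (-N x) - A n x) := by abel
        conv_lhs => rw [h3]
        refine (enorm_sub_le).trans ?_
        rw [add_comm]
        gcongr
      calc ‖A n x‖ₑ ^ 2 ≤ (c * conePotential Ω R t (G n) x
          + ‖coneAverage Ω (A n) t x (-N x)‖ₑ) ^ 2 := by gcongr
        _ ≤ _ := by
          have := ENNReal.rpow_add_le_mul_rpow_add_rpow (c * conePotential Ω R t (G n) x)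
            ‖coneAverage Ω (A n) t x (-N x)‖ₑ (p := 2) (by norm_num)
          norm_num at this
          rwa [mul_add] at this
    rw [← lintegral_enorm_sq]
    calc ∫⁻ x in Ω, ‖A n x‖ₑ ^ 2
        ≤ ∫⁻ x in Ω, (2 * (c * conePotential Ω R t (G n) x) ^ 2
          + 2 * ‖coneAverage Ω (A n) t x (-N x)‖ₑ ^ 2) := lintegral_mono_ae hpt
      _ = 2 * (c ^ 2 * ∫⁻ x in Ω, conePotential Ω R t (G n) x ^ 2)
          + 2 * ∫⁻ x in Ω, ‖coneAverage Ω (A n) t x (-N x)‖ₑ ^ 2 := by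
        have hm := (measurable_coneAverage (A n) t hN.continuous).enorm.pow_const 2
        rw [lintegral_add_right _ (hm.const_mul 2), lintegral_const_mul _ hm,
          lintegral_const_mul' _ _ (by norm_num)]
        simp only [mul_pow]
        rw [lintegral_const_mul' _ _ (ENNReal.pow_ne_top ENNReal.ofReal_ne_top)]
      _ ≤ 2 * (c ^ 2 * ((ENNReal.ofReal t * kernelMass R) ^ 2 * ENNReal.ofReal (3 * (3 * M ^ 2))))
          + 2 * ∫⁻ x in Ω, ‖coneAverage Ω (A n) t x (-N x)‖ₑ ^ 2 := by
        gcongr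
        refine (lintegral_conePotential_sq_le hR0 (G n)).trans ?_
        gcongr
        refine (lintegral_sum_enorm_sq_le (G n)).trans (ENNReal.ofReal_le_ofReal ?_)
        gcongr
        calc ∑ k, ‖G n k‖ ^ 2 ≤ ∑ _k : Fin 3, M ^ 2 := by
              gcongr with k _
              exact hGM n k
          _ = 3 * M ^ 2 := by simp
      _ = _ := by rw [hE]; ring
  rw [tendsto_zero_iff_norm_tendsto_zero]
  have hsq : Tendsto (fun n => ENNReal.ofReal (‖A n‖ ^ 2)) atTop (𝓝 0) := by
    rw [ENNReal.tendsto_nhds_zero]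
    intro δ hδ
    have hlim : Tendsto (fun t : ℝ => ENNReal.ofReal t ^ 2 * E) (𝓝[>] 0) (𝓝 0) := by
      have h1 : Tendsto (fun t : ℝ => ENNReal.ofReal t ^ 2) (𝓝[>] 0) (𝓝 0) := by
        have : Continuous fun t : ℝ => ENNReal.ofReal t ^ 2 :=
          (ENNReal.continuous_pow 2).comp ENNReal.continuous_ofReal
        simpa using (this.tendsto 0).mono_left nhdsWithin_le_nhds
      simpa using ENNReal.Tendsto.mul_const h1 (Or.inr hEtop)
    have hδ2 : (0 : ℝ≥0∞) < δ / 2 := ENNReal.half_pos hδ.ne'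
    obtain ⟨t, ht1, ht2⟩ := ((ENNReal.tendsto_nhds_zero.1 hlim _ hδ2).and
      (Ioc_mem_nhdsGT ht₀)).exists
    have h2 := ENNReal.Tendsto.const_mul
      (tendsto_lintegral_coneAverage_sq hΩ.isOpen hb hA hw t hN.continuous)
      (Or.inr (show (2 : ℝ≥0∞) ≠ ⊤ by norm_num))
    rw [mul_zero] at h2
    filter_upwards [ENNReal.tendsto_nhds_zero.1 h2 _ hδ2] with n hn
    calc ENNReal.ofReal (‖A n‖ ^ 2) ≤ _ := key t ht2 n
      _ ≤ δ / 2 + δ / 2 := add_le_add ht1 hn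
      _ = δ := ENNReal.add_halves δ
  have h3 := (ENNReal.tendsto_toReal ENNReal.zero_ne_top).comp hsq
  have h4 : Tendsto (fun n => ‖A n‖ ^ 2) atTop (𝓝 0) := by
    refine h3.congr fun n => ?_
    simp only [Function.comp]
    rw [ENNReal.toReal_ofReal (by positivity)]
  have h5 := h4.sqrt
  simpa [Real.sqrt_sq (norm_nonneg _)] using h5

/-! ### Fields with zero gradient -/

/-- With zero gradient the potential vanishes, so almost everywhere `A x` equals its cone averages.
For `x` near `x₀` the axis can be tilted so that the cone at scale `d` is cut in the same ball
around `x₀`, which gives a value independent of `x`. -/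
theorem exists_ball_ae_eq_const {Ω : Set E3} (hΩ : IsOpen Ω) (hb : Bornology.IsBounded Ω)
    {A : L2Field Ω} (hA : IsWeakGradient Ω A 0) {x₀ : E3} (hx₀ : x₀ ∈ Ω) :
    ∃ c : E3, ∃ d > 0, ∀ᵐ x, x ∈ Metric.ball x₀ d → x ∈ Ω ∧ A x = c := by
  obtain ⟨r, hr0, hr⟩ := Metric.isOpen_iff.1 hΩ x₀ hx₀
  obtain ⟨B, hB0, hB⟩ := exists_bound_profile
  -- The cone points are within `d + (3 / 2) d < r` of `x₀`.
  set d := r / 3 with hd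
  have hd0 : 0 < d := by positivity
  have hpot : ∀ x, conePotential Ω (1 + 1 / 2) d (0 : Fin 3 → L2Field Ω) x = 0 := by
    intro x
    have h1 : ∀ s, ∫⁻ z in Ω, scaleKernel (1 + 1 / 2) s x z
        * ∑ k, ‖(0 : Fin 3 → L2Field Ω) k z‖ₑ = 0 := by
      intro s
      rw [lintegral_congr_ae (g := fun _ => 0), lintegral_zero]
      filter_upwards [Lp.coeFn_zero E3 2 (volume.restrict Ω)] with z hz
      have hz' : ∀ k, (0 : Fin 3 → L2Field Ω) k z = 0 := fun _ => hz
      simp only [hz', enorm_zero, Finset.sum_const_zero, mul_zero]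
    simp only [conePotential, h1, lintegral_zero]
  refine ⟨coneAverage Ω A d x₀ 0, d, hd0, ?_⟩
  have hae := (ae_restrict_iff' hΩ.measurableSet).1
    (ae_enorm_coneAverage_sub_le hΩ hb hB zero_le_one hA)
  filter_upwards [hae] with x hx hxd
  have hxn : ‖x - x₀‖ < d := by rwa [← dist_eq_norm]
  have hxΩ : x ∈ Ω := hr (Metric.ball_subset_ball (by rw [hd]; linarith) hxd)
  refine ⟨hxΩ, ?_⟩
  -- Then `x + d • ν = x₀`, so the kernel at scale `d` no longer depends on `x`.
  set ν := d⁻¹ • (x₀ - x) with hν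
  have hν1 : ‖ν‖ ≤ 1 := by
    rw [hν, norm_smul, norm_inv, Real.norm_eq_abs, abs_of_pos hd0, norm_sub_rev,
      inv_mul_le_iff₀ hd0]
    linarith
  have h := hx hxΩ ν hν1 d hd0 (by
    intro s hs y hy
    refine hr ?_
    rw [Metric.mem_ball, dist_eq_norm]
    have h1 : x + s • (y + ν) - x₀ = (x - x₀) + s • (y + ν) := by abel
    have h2 : ‖s • (y + ν)‖ ≤ d * (3 / 2) := by
      rw [norm_smul, Real.norm_eq_abs, abs_of_pos hs.1]
      have := norm_add_le y ν
      exact mul_le_mul hs.2 (by linarith) (norm_nonneg _) hd0.le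
    rw [h1]
    have := norm_add_le (x - x₀) (s • (y + ν))
    have h3 : r = 3 * d := by rw [hd]; ring
    linarith)
  rw [hpot, mul_zero, nonpos_iff_eq_zero, enorm_eq_zero, sub_eq_zero] at h
  rw [← h, coneAverage, coneAverage]
  congr 1
  ext1 z
  congr 1
  simp only [coneKernel, hν]
  congr 2
  module

theorem ae_eq_const_of_isWeakGradient_zero {Ω : Set E3} (hΩ : IsOpen Ω) (hcon : IsConnected Ω)
    (hb : Bornology.IsBounded Ω) {A : L2Field Ω} (hA : IsWeakGradient Ω A 0) :
    ∃ a : E3, A =ᵐ[volume.restrict Ω] fun _ => a := by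
  have hloc : ∀ x : Ω, ∃ c : E3, ∃ d > 0, ∀ᵐ y, y ∈ Metric.ball (x : E3) d → y ∈ Ω ∧ A y = c :=
    fun x => exists_ball_ae_eq_const hΩ hb hA x.2
  choose c d hd hc using hloc
  have hlc : IsLocallyConstant c := by
    rw [IsLocallyConstant.iff_eventually_eq]
    intro x
    have h1 : ∀ᶠ y : Ω in 𝓝 x, (y : E3) ∈ Metric.ball (x : E3) (d x) :=
      continuous_subtype_val.continuousAt.eventually (Metric.ball_mem_nhds _ (hd x))
    filter_upwards [h1] with y hy
    have hopen : IsOpen (Metric.ball (x : E3) (d x) ∩ Metric.ball (y : E3) (d y)) :=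
      Metric.isOpen_ball.inter Metric.isOpen_ball
    have hpos := hopen.measure_pos volume ⟨(y : E3), hy, Metric.mem_ball_self (hd y)⟩
    obtain ⟨z, hz, hz1, hz2⟩ := ((frequently_ae_mem_iff.2 hpos.ne').and_eventually
      ((hc x).and (hc y))).exists
    exact (hz2 hz.2).2.symm.trans (hz1 hz.1).2
  have : PreconnectedSpace Ω := isPreconnected_iff_preconnectedSpace.1 hcon.isPreconnected
  obtain ⟨x₀, hx₀⟩ := hcon.nonempty
  refine ⟨c ⟨x₀, hx₀⟩, ?_⟩
  have hnull : volume {x | x ∈ Ω ∧ A x ≠ c ⟨x₀, hx₀⟩} = 0 := by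
    refine measure_null_of_locally_null _ fun x hx => ?_
    refine ⟨Metric.ball x (d ⟨x, hx.1⟩) ∩ {x | x ∈ Ω ∧ A x ≠ c ⟨x₀, hx₀⟩},
      inter_mem (mem_nhdsWithin_of_mem_nhds (Metric.ball_mem_nhds _ (hd _)))
        self_mem_nhdsWithin, ?_⟩
    refine measure_mono_null (fun y hy => ?_) (ae_iff.1 (hc ⟨x, hx.1⟩))
    show ¬ _
    intro hcon2
    refine hy.2.2 ?_
    rw [(hcon2 hy.1).2]
    exact hlc.apply_eq_of_preconnectedSpace _ _
  refine (ae_restrict_iff' hΩ.measurableSet).2 ?_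
  rw [ae_iff]
  convert! hnull using 2
  ext x
  simp

/-- The field is a constant `a`. Testing its normality with the coordinate function `φ = xⱼ`, `j ≠
i`, gives `aᵢ |Ω| = 0`. -/
theorem eq_zero_of_isWeakGradient_zero {Ω : Set E3} (hΩ : IsSmoothBoundedDomain Ω)
    {A : L2Field Ω} (hA : IsWeakGradient Ω A 0) (hz : HasZeroTangentialPart Ω A 0) : A = 0 := by
  obtain ⟨a, ha⟩ := ae_eq_const_of_isWeakGradient_zero hΩ.isOpen hΩ.isConnected hΩ.isBounded hA
  have ha0 : ∀ i, a i = 0 := by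
    intro i
    obtain ⟨j, hj⟩ : ∃ j : Fin 3, j ≠ i := exists_ne i
    have hφ : ContDiff ℝ ∞ fun x : E3 => x j := contDiff_component contDiff_id j
    have hd : ∀ x l, fderiv ℝ (fun x : E3 => x j) x (stdVec l) = if j = l then 1 else 0 := by
      intro x l
      have := fderiv_component contDiff_id j x (stdVec l)
      simp only [id] at this
      rw [this, fderiv_id]
      simp
    have h := hz i j _ hφ
    have h2 : ∫ x in Ω, a i = 0 := by
      rw [← h]
      refine integral_congr_ae ?_
      filter_upwards [ha, Lp.coeFn_zero E3 2 (volume.restrict Ω)] with x hx hx0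
      have hz' : ∀ k l, (0 : Fin 3 → L2Field Ω) k x l = 0 := fun _ l => by
        rw [Pi.zero_apply, hx0]; rfl
      rw [hd, hd, if_pos rfl, if_neg hj, hx, hz', hz']
      simp
    rw [setIntegral_const, smul_eq_mul] at h2
    refine (mul_eq_zero.1 h2).resolve_left ?_
    exact (ENNReal.toReal_pos (hΩ.isOpen.measure_pos volume hΩ.isConnected.nonempty).ne'
      hΩ.isBounded.measure_lt_top.ne).ne'
  refine Lp.ext ?_
  filter_upwards [ha, Lp.coeFn_zero E3 2 (volume.restrict Ω)] with x hx hx0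
  rw [hx, hx0]
  ext i
  simpa using ha0 i

end VectorLaplacian

end

noncomputable section

namespace VectorLaplacian

/-! ### The operator of a compactly embedded form domain -/

section FormDomain

variable {V X : Type*} [NormedAddCommGroup V] [InnerProductSpace ℝ V] [CompleteSpace V]
  [NormedAddCommGroup X] [InnerProductSpace ℝ X]

/-- If no constant works, there are vectors with `‖J xₙ‖ = 1` and `‖xₙ‖ → 1`. A weak limit `v` has
`‖J v‖ = 1` by strong convergence of the images and `‖v‖ ≤ 1` by weak lower semicontinuity, so
equality holds and `h0` forces `v = 0`. -/
theorem exists_coercivity_constant [TopologicalSpace.SeparableSpace V] (J : V →L[ℝ] X)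
    (hJ : ∀ (x : ℕ → V) (M : ℝ), (∀ n, ‖x n‖ ≤ M) →
      (∀ w, Tendsto (fun n => ⟪x n, w⟫_ℝ) atTop (𝓝 0)) →
        Tendsto (fun n => J (x n)) atTop (𝓝 0))
    (h1 : ∀ v, ‖J v‖ ≤ ‖v‖) (h0 : ∀ v, ‖J v‖ = ‖v‖ → v = 0) :
    ∃ C : ℝ, 0 < C ∧ ∀ v, ‖J v‖ ^ 2 ≤ C * (‖v‖ ^ 2 - ‖J v‖ ^ 2) := by
  by_contra! hcon
  have hex : ∀ n : ℕ, ∃ x : V, ‖J x‖ = 1 ∧ ‖x‖ ^ 2 ≤ 1 + 1 / ((n : ℝ) + 1) := by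
    intro n
    have hn : (0 : ℝ) < n + 1 := by positivity
    obtain ⟨v, hv⟩ := hcon (n + 1) hn
    have hsq : ‖J v‖ ^ 2 ≤ ‖v‖ ^ 2 := pow_le_pow_left₀ (norm_nonneg _) (h1 v) 2
    have hpos : 0 < ‖J v‖ := by
      refine (norm_nonneg _).lt_of_ne' fun h => ?_
      have := (mul_nonneg hn.le (sub_nonneg.2 hsq)).trans_lt hv
      rw [h, zero_pow two_ne_zero] at this
      exact this.false
    refine ⟨‖J v‖⁻¹ • v, ?_, ?_⟩
    · rw [map_smul, norm_smul, norm_inv, norm_norm, inv_mul_cancel₀ hpos.ne']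
    · rw [norm_smul, norm_inv, norm_norm, mul_pow, inv_pow, inv_mul_le_iff₀ (by positivity),
        mul_add, mul_one, mul_one_div, ← sub_le_iff_le_add', le_div_iff₀ hn]
      linarith
  choose x hx1 hx2 using hex
  have hxM : ∀ n, ‖x n‖ ≤ 2 := by
    intro n
    refine (pow_le_pow_iff_left₀ (norm_nonneg _) zero_le_two two_ne_zero).1 ((hx2 n).trans ?_)
    have : 1 / ((n : ℝ) + 1) ≤ 1 := by
      rw [div_le_one (by positivity)]; linarith [n.cast_nonneg (α := ℝ)]
    linarith
  obtain ⟨v, hv, φ, hφ, hlim⟩ := exists_subseq_tendsto_inner x hxM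
  have h2 : Tendsto (fun n => J (x (φ n) - v)) atTop (𝓝 0) :=
    hJ _ (2 + 2) (fun n => (norm_sub_le _ _).trans (add_le_add (hxM _) hv)) fun w => by
      simpa only [inner_sub_left, sub_self] using (hlim w).sub_const ⟪v, w⟫_ℝ
  have h3 : ‖J v‖ = 1 := by
    have h4 := (h2.add_const (J v)).norm
    simp only [map_sub, sub_add_cancel, zero_add, hx1] at h4
    exact tendsto_nhds_unique h4 tendsto_const_nhds
  -- Lower semicontinuity by hand: pass to the limit in `2 ⟪xₙ, v⟫ ≤ ‖xₙ‖² + ‖v‖²`.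
  have h5 : ‖v‖ ^ 2 ≤ (1 + 0 + ‖v‖ ^ 2) / 2 := by
    have h6 : Tendsto (fun n => (1 + 1 / ((φ n : ℝ) + 1) + ‖v‖ ^ 2) / 2) atTop
        (𝓝 ((1 + 0 + ‖v‖ ^ 2) / 2)) :=
      (((tendsto_one_div_add_atTop_nhds_zero_nat.comp hφ.tendsto_atTop).const_add 1).add_const
        _).div_const 2
    have h7 := hlim v
    rw [real_inner_self_eq_norm_sq] at h7
    refine le_of_tendsto_of_tendsto' h7 h6 fun n => ?_
    have h8 := norm_sub_sq_real (x (φ n)) v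
    have h9 := hx2 (φ n)
    nlinarith [sq_nonneg ‖x (φ n) - v‖]
  have h6 : ‖v‖ ≤ 1 := by
    refine (pow_le_pow_iff_left₀ (norm_nonneg _) zero_le_one two_ne_zero).1 ?_
    linarith
  have h7 := h0 v (le_antisymm (h1 v) (by rw [h3]; exact h6))
  rw [h7, map_zero, norm_zero] at h3
  exact zero_ne_one h3

variable [CompleteSpace X]

/-- A coercive form `⟪v, w⟫ - ⟪J v, J w⟫`, whose domain `V` is compactly and densely embedded into
`X` by `J`, is the form of a self-adjoint operator with compact resolvent. -/
theorem exists_operator_of_form (J : V →L[ℝ] X) (hc : IsCompactOperator J) (hd : DenseRange J)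
    {C : ℝ} (hC : 0 < C) (hJ : ∀ v, ‖J v‖ ^ 2 ≤ C * (‖v‖ ^ 2 - ‖J v‖ ^ 2)) :
    ∃ T : X →ₗ.[ℝ] X, IsSelfAdjoint T ∧
      (∀ A : T.domain, ∃ v, J v = A ∧ ∀ w, ⟪T A, J w⟫_ℝ = ⟪v, w⟫_ℝ - ⟪J v, J w⟫_ℝ) ∧
      (∀ v F, (∀ w, ⟪F, J w⟫_ℝ = ⟪v, w⟫_ℝ - ⟪J v, J w⟫_ℝ) → (J v, F) ∈ T.graph) ∧
      (∀ z : ℝ, z < 0 → ∃ R : X →L[ℝ] X,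
        IsResolvent T z R ∧ IsCompactOperator R ∧ IsSelfAdjoint R) ∧
      HasDiscreteSpectrum T ∧
      ∃ δ : ℝ, 0 < δ ∧ ∀ A : T.domain, δ * ‖(A : X)‖ ^ 2 ≤ ⟪(A : X), T A⟫_ℝ := by
  -- `J* f` is the Riesz representative in `V` of `w ↦ ⟪f, J w⟫`, so `K f` is the weak solution `A`
  -- of `T A + A = f`.
  let K : X →L[ℝ] X := J.comp (ContinuousLinearMap.adjoint J)
  have hKc : IsCompactOperator K := hc.comp_clm (ContinuousLinearMap.adjoint J)
  have hKs : ∀ x y, ⟪K x, y⟫_ℝ = ⟪x, K y⟫_ℝ := fun x y => by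
    show ⟪J (ContinuousLinearMap.adjoint J x), y⟫_ℝ = ⟪x, J (ContinuousLinearMap.adjoint J y)⟫_ℝ
    rw [← ContinuousLinearMap.adjoint_inner_right, ContinuousLinearMap.adjoint_inner_left]
  have hK0 : ∀ f, K f = 0 → f = 0 := by
    intro f hf
    have h1 : ContinuousLinearMap.adjoint J f = 0 := by
      rw [← inner_self_eq_zero (𝕜 := ℝ), ContinuousLinearMap.adjoint_inner_left]
      show ⟪f, K f⟫_ℝ = 0
      rw [hf, inner_zero_right]
    refine hd.eq_zero_of_inner_left ℝ fun w => ?_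
    rw [← ContinuousLinearMap.adjoint_inner_left, h1, inner_zero_left]
  have hKi : Function.Injective K := (injective_iff_map_eq_zero K).2 hK0
  let T : X →ₗ.[ℝ] X := inverseSubOne K hKi
  have hT : ∀ f, T ⟨K f, mem_domain_inverseSubOne f⟩ = f - K f := fun f => inverseSubOne_apply f _
  have hdom : Dense (T.domain : Set X) := by
    rw [Submodule.dense_iff_topologicalClosure_eq_top, Submodule.topologicalClosure_eq_top_iff,
      Submodule.eq_bot_iff]
    intro f hf
    refine hK0 f (ext_inner_left ℝ fun g => ?_)
    rw [inner_zero_right, ← hKs]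
    exact (Submodule.mem_orthogonal _ _).1 hf _ (mem_domain_inverseSubOne g)
  have hform : ∀ A : T.domain, ∃ v, J v = A ∧ ∀ w, ⟪T A, J w⟫_ℝ = ⟪v, w⟫_ℝ - ⟪J v, J w⟫_ℝ := by
    intro A
    obtain ⟨f, rfl⟩ := exists_eq_of_domain A
    refine ⟨ContinuousLinearMap.adjoint J f, rfl, fun w => ?_⟩
    rw [hT, inner_sub_left, ContinuousLinearMap.adjoint_inner_left]
    rfl
  have hcoer : ∀ A : T.domain, C⁻¹ * ‖(A : X)‖ ^ 2 ≤ ⟪(A : X), T A⟫_ℝ := by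
    intro A
    obtain ⟨v, hv, hw⟩ := hform A
    have h1 := hw v
    rw [real_inner_self_eq_norm_sq, real_inner_self_eq_norm_sq] at h1
    rw [real_inner_comm, ← hv, h1, inv_mul_le_iff₀ hC]
    exact hJ v
  refine ⟨T, isSelfAdjoint_inverseSubOne hKs hdom, hform, fun v F hF => ?_, fun z hz => ?_,
    hasDiscreteSpectrum_inverseSubOne hKc hKs, C⁻¹, inv_pos.2 hC, hcoer⟩
  · have h1 : ContinuousLinearMap.adjoint J (F + J v) = v := ext_inner_right ℝ fun w => by
      rw [ContinuousLinearMap.adjoint_inner_left, inner_add_left, hF w, sub_add_cancel]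
    have h2 : K (F + J v) = J v := congrArg J h1
    refine (LinearPMap.mem_graph_iff _).2 ⟨⟨K (F + J v), mem_domain_inverseSubOne _⟩, h2, ?_⟩
    rw [hT, h2, add_sub_cancel_right]
  -- A kernel vector `f` would satisfy `T (K f) = z K f`, hence `0 ≤ z ‖K f‖²` by coercivity; with
  -- `z < 0` this forces `K f = 0`.
  · obtain ⟨R, hR, hRc⟩ := exists_isResolvent_of_ker_eq (hK := hKi) hKc (z := z) (by
      intro f hf
      have h1 := hcoer ⟨K f, mem_domain_inverseSubOne f⟩
      rw [hT] at h1
      have h2 : f - K f = z • K f := by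
        rw [sub_eq_iff_eq_add, add_comm]
        rwa [add_smul, one_smul] at hf
      rw [h2, real_inner_smul_right, real_inner_self_eq_norm_sq] at h1
      have h3 : 0 ≤ C⁻¹ * ‖K f‖ ^ 2 := by positivity
      have h4 : ‖K f‖ ^ 2 = 0 := by nlinarith [sq_nonneg ‖K f‖]
      exact hK0 f (norm_eq_zero.1 (pow_eq_zero_iff two_ne_zero |>.1 h4)))
    exact ⟨R, hR, hRc, isSelfAdjoint_of_isResolvent (inner_inverseSubOne_comm hKs) hR⟩

end FormDomain

end VectorLaplacian

end

noncomputable section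

namespace VectorLaplacian

/-! ### The Hilbert space of Sobolev fields -/

/-- The Hilbert space of the pairs of a field and three candidates for its partial derivatives. -/
abbrev FieldPair (Ω : Set E3) : Type :=
  WithLp 2 (L2Field Ω × PiLp 2 fun _ : Fin 3 => L2Field Ω)

variable {Ω : Set E3}

/-- The element of `FieldPair Ω` with the given components. -/
def fieldPair (A : L2Field Ω) (G : Fin 3 → L2Field Ω) : FieldPair Ω :=
  WithLp.toLp 2 (A, WithLp.toLp 2 G)

theorem inner_fieldPair (p q : FieldPair Ω) :
    ⟪p, q⟫_ℝ = ⟪p.fst, q.fst⟫_ℝ + ∑ k, ⟪p.snd k, q.snd k⟫_ℝ := by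
  rw [WithLp.prod_inner_apply, PiLp.inner_apply]
  rfl

theorem norm_sq_fieldPair (p : FieldPair Ω) :
    ‖p‖ ^ 2 = ‖p.fst‖ ^ 2 + ∑ k, ‖p.snd k‖ ^ 2 := by
  rw [← real_inner_self_eq_norm_sq, inner_fieldPair]
  simp only [real_inner_self_eq_norm_sq]

/-- The vector which tests the `i`-th component of the weak derivative `∂_k`. -/
def gradientTest (Ω : Set E3) (φ : E3 → ℝ) (k i : Fin 3) : FieldPair Ω :=
  fieldPair (testField Ω (fun x => fderiv ℝ φ x (stdVec k)) i) (Pi.single k (testField Ω φ i))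

/-- The vector which tests the `i, j` components of the tangential part at the boundary. -/
def tangentialTest (Ω : Set E3) (φ : E3 → ℝ) (i j : Fin 3) : FieldPair Ω :=
  gradientTest Ω φ j i - gradientTest Ω φ i j

theorem inner_gradientTest (hb : Bornology.IsBounded Ω) {φ : E3 → ℝ} (hφ : ContDiff ℝ ∞ φ)
    (k i : Fin 3) (p : FieldPair Ω) :
    ⟪gradientTest Ω φ k i, p⟫_ℝ
      = (∫ x in Ω, fderiv ℝ φ x (stdVec k) * p.fst x i) + ∫ x in Ω, φ x * p.snd k x i := by
  rw [inner_fieldPair]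
  show ⟪testField Ω (fun x => fderiv ℝ φ x (stdVec k)) i, p.fst⟫_ℝ
    + ∑ l, ⟪(Pi.single k (testField Ω φ i) : Fin 3 → L2Field Ω) l, p.snd l⟫_ℝ = _
  rw [Finset.sum_eq_single k (fun l _ hl => by rw [Pi.single_eq_of_ne hl, inner_zero_left])
    (by simp), Pi.single_eq_same, inner_testField hb (continuous_fderiv_apply_const hφ _),
    inner_testField hb hφ.continuous]

/-- The Sobolev fields, with their weak gradients, which are normal to the boundary. -/
def sobolevSpace (Ω : Set E3) : Submodule ℝ (FieldPair Ω) :=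
  (Submodule.span ℝ ({p | ∃ φ : E3 → ℝ, ContDiff ℝ ∞ φ ∧
    ((HasCompactSupport φ ∧ tsupport φ ⊆ Ω ∧ ∃ k i, p = gradientTest Ω φ k i) ∨
      ∃ i j, p = tangentialTest Ω φ i j)} : Set (FieldPair Ω)))ᗮ

theorem mem_orthogonal_span_iff {E : Type*} [NormedAddCommGroup E] [InnerProductSpace ℝ E]
    {s : Set E} {p : E} : p ∈ (Submodule.span ℝ s)ᗮ ↔ ∀ u ∈ s, ⟪u, p⟫_ℝ = 0 := by
  rw [Submodule.mem_orthogonal]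
  refine ⟨fun h u hu => h u (Submodule.subset_span hu), fun h u hu => ?_⟩
  induction hu using Submodule.span_induction with
  | mem u hu => exact h u hu
  | zero => exact inner_zero_left p
  | add u v _ _ hu hv => rw [inner_add_left, hu, hv, add_zero]
  | smul c u _ hu => rw [real_inner_smul_left, hu, mul_zero]

/-- Both conditions are families of linear equations given by continuous functionals on the pair.
Writing the space as an orthogonal complement makes it closed, which is the source of its
completeness. -/
theorem mem_sobolevSpace (hΩ : IsOpen Ω) (hb : Bornology.IsBounded Ω) (p : FieldPair Ω) :
    p ∈ sobolevSpace Ω ↔ IsWeakGradient Ω p.fst (fun k => p.snd k)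
      ∧ HasZeroTangentialPart Ω p.fst (fun k => p.snd k) := by
  have h1 : p ∈ sobolevSpace Ω ↔ ∀ φ : E3 → ℝ, ContDiff ℝ ∞ φ →
      (HasCompactSupport φ → tsupport φ ⊆ Ω → ∀ k i, ⟪gradientTest Ω φ k i, p⟫_ℝ = 0) ∧
      ∀ i j, ⟪tangentialTest Ω φ i j, p⟫_ℝ = 0 := by
    rw [sobolevSpace, mem_orthogonal_span_iff]
    constructor
    · intro h φ hφ
      exact ⟨fun h2 h3 k i => h _ ⟨φ, hφ, Or.inl ⟨h2, h3, k, i, rfl⟩⟩,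
        fun i j => h _ ⟨φ, hφ, Or.inr ⟨i, j, rfl⟩⟩⟩
    · rintro h _ ⟨φ, hφ, ⟨h2, h3, k, i, rfl⟩ | ⟨i, j, rfl⟩⟩
      · exact (h φ hφ).1 h2 h3 k i
      · exact (h φ hφ).2 i j
  rw [h1, isWeakGradient_iff hΩ hb]
  have h2 : ∀ φ : E3 → ℝ, ContDiff ℝ ∞ φ → ∀ k i, ⟪gradientTest Ω φ k i, p⟫_ℝ
      = ∫ x in Ω, (fderiv ℝ φ x (stdVec k) * p.fst x i + φ x * p.snd k x i) := by
    intro φ hφ k i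
    rw [inner_gradientTest hb hφ, integral_add]
    · exact integrableOn_continuous_mul hΩ hb (integrableOn_component hb _ i)
        (continuous_fderiv_apply_const hφ _)
    · exact integrableOn_continuous_mul hΩ hb (integrableOn_component hb _ i) hφ.continuous
  have h3 : ∀ φ : E3 → ℝ, ContDiff ℝ ∞ φ → ∀ i j, ⟪tangentialTest Ω φ i j, p⟫_ℝ
      = ∫ x in Ω, ((p.snd j x i - p.snd i x j) * φ x
      + (p.fst x i * fderiv ℝ φ x (EuclideanSpace.single j 1)
        - p.fst x j * fderiv ℝ φ x (EuclideanSpace.single i 1))) := by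
    intro φ hφ i j
    rw [tangentialTest, inner_sub_left, h2 φ hφ, h2 φ hφ, ← integral_sub]
    · congr 1
      ext x
      ring
    · exact integrableOn_bdryForm (H := fun k => p.snd k) hΩ hb j i hφ
    · exact integrableOn_bdryForm (H := fun k => p.snd k) hΩ hb i j hφ
  constructor
  · intro h
    refine ⟨fun i => ⟨integrableOn_component hb _ i, fun k => integrableOn_component hb _ i,
      fun k φ hφ hc hs => ?_⟩, fun i j φ hφ => ?_⟩
    · have := (h φ hφ).1 hc hs k i
      rw [inner_gradientTest hb hφ] at this
      exact eq_neg_of_add_eq_zero_left this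
    · rw [← h3 φ hφ]
      exact (h φ hφ).2 i j
  · rintro ⟨h, h'⟩ φ hφ
    refine ⟨fun hc hs k i => ?_, fun i j => ?_⟩
    · rw [inner_gradientTest hb hφ, (h i).2.2 k φ hφ hc hs, neg_add_cancel]
    · rw [h3 φ hφ]
      exact h' i j φ hφ

/-- The embedding of the Sobolev fields into the square integrable fields. -/
def sobolevEmbedding (Ω : Set E3) : sobolevSpace Ω →L[ℝ] L2Field Ω :=
  (WithLp.fstL 2 ℝ (L2Field Ω) (PiLp 2 fun _ : Fin 3 => L2Field Ω)).comp (sobolevSpace Ω).subtypeL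

theorem sobolevEmbedding_apply (v : sobolevSpace Ω) :
    sobolevEmbedding Ω v = (v : FieldPair Ω).fst := rfl

instance : TopologicalSpace.SeparableSpace (sobolevSpace Ω) := by
  have : Fact ((2 : ENNReal) ≠ ⊤) := ⟨by norm_num⟩
  have h1 : SecondCountableTopology (L2Field Ω) := Lp.SecondCountableTopology
  have h2 : SecondCountableTopology (PiLp 2 fun _ : Fin 3 => L2Field Ω) :=
    PiLp.secondCountableTopology 2 _
  have h3 : SecondCountableTopology (FieldPair Ω) := WithLp.secondCountableTopology _ _ _
  have h4 : SecondCountableTopology (sobolevSpace Ω) := TopologicalSpace.Subtype.secondCountableTopology _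
  exact TopologicalSpace.SecondCountableTopology.to_separableSpace

instance : CompleteSpace (sobolevSpace Ω) := by
  unfold sobolevSpace
  infer_instance

theorem tendsto_sobolevEmbedding_zero (hΩ : IsSmoothBoundedDomain Ω) (x : ℕ → sobolevSpace Ω)
    (M : ℝ) (hx : ∀ n, ‖x n‖ ≤ M) (hw : ∀ w, Tendsto (fun n => ⟪x n, w⟫_ℝ) atTop (𝓝 0)) :
    Tendsto (fun n => sobolevEmbedding Ω (x n)) atTop (𝓝 0) := by
  have hsq : ∀ n, ‖(x n : FieldPair Ω).fst‖ ^ 2 + ∑ k, ‖(x n : FieldPair Ω).snd k‖ ^ 2 ≤ M ^ 2 := by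
    intro n
    rw [← norm_sq_fieldPair]
    exact pow_le_pow_left₀ (norm_nonneg _) (hx n) 2
  have hM : 0 ≤ M := (norm_nonneg _).trans (hx 0)
  refine tendsto_zero_of_weakGradient_bounded hΩ
    (fun n => ((mem_sobolevSpace hΩ.isOpen hΩ.isBounded _).1 (x n).2).1) (M := M)
    (fun n => ?_) (fun n k => ?_) fun B => ?_
  · refine (pow_le_pow_iff_left₀ (norm_nonneg _) hM two_ne_zero).1 (le_trans ?_ (hsq n))
    exact le_add_of_nonneg_right (by positivity)
  · refine (pow_le_pow_iff_left₀ (norm_nonneg _) hM two_ne_zero).1 (le_trans ?_ (hsq n))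
    refine le_trans ?_ (le_add_of_nonneg_left (by positivity))
    exact Finset.single_le_sum (f := fun k => ‖(x n : FieldPair Ω).snd k‖ ^ 2)
      (fun _ _ => by positivity) (Finset.mem_univ k)
  -- Weak convergence in the Sobolev space passes to `L²` by testing against the adjoint image of
  -- `B`.
  · refine (hw (ContinuousLinearMap.adjoint (𝕜 := ℝ) (sobolevEmbedding Ω) B)).congr fun n => ?_
    rw [ContinuousLinearMap.adjoint_inner_right, sobolevEmbedding_apply]

theorem norm_sq_sobolevSpace (v : sobolevSpace Ω) :
    ‖v‖ ^ 2 = ‖sobolevEmbedding Ω v‖ ^ 2 + ∑ k, ‖(v : FieldPair Ω).snd k‖ ^ 2 :=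
  norm_sq_fieldPair (v : FieldPair Ω)

/-- Here `‖v‖² - ‖J v‖²` is the Dirichlet energy; equality of the norms means zero gradient, which
for fields normal to the boundary means zero. -/
theorem exists_poincare_constant (hΩ : IsSmoothBoundedDomain Ω) :
    ∃ C : ℝ, 0 < C ∧ ∀ v : sobolevSpace Ω,
      ‖sobolevEmbedding Ω v‖ ^ 2 ≤ C * (‖v‖ ^ 2 - ‖sobolevEmbedding Ω v‖ ^ 2) := by
  have hle : ∀ v : sobolevSpace Ω, ‖sobolevEmbedding Ω v‖ ≤ ‖v‖ := fun v => by
    refine (pow_le_pow_iff_left₀ (norm_nonneg _) (norm_nonneg _) two_ne_zero).1 ?_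
    rw [norm_sq_sobolevSpace v]
    exact le_add_of_nonneg_right (by positivity)
  have heq : ∀ v : sobolevSpace Ω, ‖sobolevEmbedding Ω v‖ = ‖v‖ → v = 0 := fun v hv => by
    have h1 := norm_sq_sobolevSpace v
    rw [← hv, left_eq_add, Finset.sum_eq_zero_iff_of_nonneg (fun _ _ => by positivity)] at h1
    have h2 : (fun k => (v : FieldPair Ω).snd k) = 0 := funext fun k =>
      norm_eq_zero.1 (pow_eq_zero_iff two_ne_zero |>.1 (h1 k (Finset.mem_univ k)))
    have h3 := (mem_sobolevSpace hΩ.isOpen hΩ.isBounded _).1 v.2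
    rw [h2] at h3
    have h4 := eq_zero_of_isWeakGradient_zero hΩ h3.1 h3.2
    rw [← norm_eq_zero, ← hv, sobolevEmbedding_apply, h4, norm_zero]
  have h := exists_coercivity_constant (V := sobolevSpace Ω) (sobolevEmbedding Ω)
  exact h (tendsto_sobolevEmbedding_zero hΩ) hle heq

end VectorLaplacian

end

noncomputable section

namespace VectorLaplacian

/-! ### Density of the smooth fields -/

theorem smul_stdVec_mem_smoothFields {Ω : Set E3} (hΩ : IsOpen Ω) {φ : E3 → ℝ}
    (hφ : ContDiff ℝ ∞ φ) (hs : tsupport φ ⊆ Ω) (i : Fin 3) :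
    (fun x => φ x • stdVec i) ∈ smoothFields Ω := by
  refine ⟨hφ.smul contDiff_const, fun x hx n _ => ?_⟩
  have hx' : x ∉ tsupport φ := fun h => by
    rw [hΩ.frontier_eq] at hx
    exact hx.2 (hs h)
  have h0 : (fun x => φ x • stdVec i) =ᶠ[𝓝 x] fun _ => 0 := by
    filter_upwards [notMem_tsupport_iff_eventuallyEq.1 hx'] with y hy
    rw [hy, Pi.zero_apply, zero_smul]
  constructor
  · rw [show (fun x => φ x • stdVec i) x = 0 from h0.eq_of_nhds]
    simp
  · rw [h0.fderiv_eq]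
    simp

/-- Fields `φ eᵢ` with `φ` supported in `Ω` satisfy the boundary conditions trivially; a field
orthogonal to all of them vanishes by the fundamental lemma of the calculus of variations. -/
theorem dense_domain_vecLaplacian {Ω : Set E3} (hΩ : IsSmoothBoundedDomain Ω) :
    Dense ((vecLaplacian Ω).domain : Set (L2Field Ω)) := by
  rw [Submodule.dense_iff_topologicalClosure_eq_top, Submodule.topologicalClosure_eq_top_iff,
    Submodule.eq_bot_iff]
  intro f hf
  have h1 : ∀ i, ∀ᵐ x, x ∈ Ω → f x i = 0 := by
    intro i
    refine hΩ.isOpen.ae_eq_zero_of_integral_contDiff_smul_eq_zero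
      (integrableOn_component hΩ.isBounded f i).locallyIntegrableOn fun φ hφ _ hs => ?_
    obtain ⟨A, hA, -⟩ :=
      exists_vecLaplacian_apply hΩ (smul_stdVec_mem_smoothFields hΩ.isOpen hφ hs i)
    have h2 : (A : L2Field Ω) = testField Ω φ i :=
      Lp.ext (hA.trans (coeFn_testField hΩ.isBounded hφ.continuous i).symm)
    have h3 := (Submodule.mem_orthogonal _ _).1 hf A A.2
    rw [h2, inner_testField hΩ.isBounded hφ.continuous] at h3
    rw [← h3, setIntegral_eq_integral_of_forall_compl_eq_zero]
    · rfl
    · intro x hx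
      rw [image_eq_zero_of_notMem_tsupport fun h => hx (hs h), zero_mul]
  refine Lp.ext ?_
  filter_upwards [(ae_restrict_iff' hΩ.isOpen.measurableSet).2 (ae_all_iff.2 h1 |>.mono
    fun x hx hxΩ i => hx i hxΩ), Lp.coeFn_zero E3 2 (volume.restrict Ω)] with x hx hx0
  rw [hx0]
  ext i
  exact hx i

/-! ### The form of the vector Laplacian -/

theorem inner_sobolevSpace {Ω : Set E3} (v w : sobolevSpace Ω) :
    ⟪v, w⟫_ℝ = ⟪sobolevEmbedding Ω v, sobolevEmbedding Ω w⟫_ℝ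
      + ∑ k, ⟪(v : FieldPair Ω).snd k, (w : FieldPair Ω).snd k⟫_ℝ :=
  inner_fieldPair (v : FieldPair Ω) (w : FieldPair Ω)

theorem exists_sobolevEmbedding_eq {Ω : Set E3} (hΩ : IsOpen Ω) (hb : Bornology.IsBounded Ω)
    {A : L2Field Ω} {G : Fin 3 → L2Field Ω} (hA : IsWeakGradient Ω A G)
    (hz : HasZeroTangentialPart Ω A G) :
    ∃ v : sobolevSpace Ω, sobolevEmbedding Ω v = A ∧ ∀ k, (v : FieldPair Ω).snd k = G k :=
  ⟨⟨fieldPair A G, (mem_sobolevSpace hΩ hb _).2 ⟨hA, hz⟩⟩, rfl, fun _ => rfl⟩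

/-- The bridge from the classical operator to the form: symmetry, the energy identity and the
extension property are all read off from this representation. -/
theorem exists_sobolev_of_smoothFields {Ω : Set E3} (hΩ : IsSmoothBoundedDomain Ω)
    {u : E3 → E3} (hu : u ∈ smoothFields Ω) {A F : L2Field Ω}
    (hA : A =ᵐ[volume.restrict Ω] u)
    (hF : F =ᵐ[volume.restrict Ω] fun x => -Laplacian.laplacian u x) :
    ∃ v : sobolevSpace Ω, sobolevEmbedding Ω v = A ∧
      (∀ k, (v : FieldPair Ω).snd k =ᵐ[volume.restrict Ω] partialDeriv k u) ∧
      ∀ w, ⟪F, sobolevEmbedding Ω w⟫_ℝ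
        = ⟪v, w⟫_ℝ - ⟪sobolevEmbedding Ω v, sobolevEmbedding Ω w⟫_ℝ := by
  have hm : ∀ k, MemLp (partialDeriv k u) 2 (volume.restrict Ω) := fun k =>
    memLp_of_continuous hΩ.isBounded (contDiff_partialDeriv hu.1 k).continuous
  have hG : ∀ k, (hm k).toLp (partialDeriv k u) =ᵐ[volume.restrict Ω] partialDeriv k u :=
    fun k => (hm k).coeFn_toLp
  obtain ⟨v, hv, hvG⟩ := exists_sobolevEmbedding_eq hΩ.isOpen hΩ.isBounded
    (isWeakGradient_of_contDiff hΩ.isOpen hΩ.isBounded hu.1 hA hG)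
    (hasZeroTangentialPart_of_smoothFields hΩ hu hA hG)
  have hG' : ∀ k, (v : FieldPair Ω).snd k =ᵐ[volume.restrict Ω] partialDeriv k u := fun k => by
    rw [hvG]
    exact hG k
  refine ⟨v, hv, hG', fun w => ?_⟩
  have hw := (mem_sobolevSpace hΩ.isOpen hΩ.isBounded _).1 w.2
  rw [inner_sobolevSpace, add_sub_cancel_left]
  exact green_of_smoothFields hΩ hu hF hG' hw.1 hw.2

theorem exists_sobolev_of_domain {Ω : Set E3} (hΩ : IsSmoothBoundedDomain Ω)
    (A : (vecLaplacian Ω).domain) :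
    ∃ v : sobolevSpace Ω, sobolevEmbedding Ω v = A ∧
      ∀ w, ⟪vecLaplacian Ω A, sobolevEmbedding Ω w⟫_ℝ
        = ⟪v, w⟫_ℝ - ⟪sobolevEmbedding Ω v, sobolevEmbedding Ω w⟫_ℝ := by
  have hA := (vecLaplacian Ω).mem_graph A
  rw [graph_vecLaplacian hΩ.isOpen] at hA
  obtain ⟨u, hu, h1, h2⟩ := hA
  obtain ⟨v, hv, -, hw⟩ := exists_sobolev_of_smoothFields hΩ hu h1 h2
  exact ⟨v, hv, hw⟩

theorem inner_vecLaplacian_comm {Ω : Set E3} (hΩ : IsSmoothBoundedDomain Ω)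
    (A B : (vecLaplacian Ω).domain) :
    ⟪vecLaplacian Ω A, (B : L2Field Ω)⟫_ℝ = ⟪(A : L2Field Ω), vecLaplacian Ω B⟫_ℝ := by
  obtain ⟨v, hv, hv'⟩ := exists_sobolev_of_domain hΩ A
  obtain ⟨w, hw, hw'⟩ := exists_sobolev_of_domain hΩ B
  rw [← hv, ← hw, hv' w, real_inner_comm (vecLaplacian Ω B), hw' v, real_inner_comm v w,
    real_inner_comm (sobolevEmbedding Ω v)]

theorem norm_sq_eq_integral {Ω : Set E3} (A : L2Field Ω) : ‖A‖ ^ 2 = ∫ x in Ω, ‖A x‖ ^ 2 := by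
  rw [← real_inner_self_eq_norm_sq, L2.inner_def]
  simp only [real_inner_self_eq_norm_sq]

theorem inner_vecLaplacian_self {Ω : Set E3} (hΩ : IsSmoothBoundedDomain Ω)
    (A : (vecLaplacian Ω).domain) {u : E3 → E3} (hu : u ∈ smoothFields Ω)
    (hA : (A : L2Field Ω) =ᵐ[volume.restrict Ω] u) :
    ⟪(A : L2Field Ω), vecLaplacian Ω A⟫_ℝ
      = ∑ k : Fin 3, ∫ x in Ω, ‖partialDeriv k u x‖ ^ 2 := by
  obtain ⟨A', hA', hF⟩ := exists_vecLaplacian_apply hΩ hu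
  obtain rfl : A' = A := Subtype.ext (Lp.ext (hA'.trans hA.symm))
  obtain ⟨v, hv, hvG, hw⟩ := exists_sobolev_of_smoothFields hΩ hu hA hF
  rw [real_inner_comm, ← hv, hw v, real_inner_self_eq_norm_sq, real_inner_self_eq_norm_sq,
    norm_sq_sobolevSpace, add_sub_cancel_left]
  refine Finset.sum_congr rfl fun k _ => ?_
  rw [norm_sq_eq_integral]
  refine integral_congr_ae ?_
  filter_upwards [hvG k] with x hx
  rw [hx]

theorem inner_vecLaplacian_self_nonneg {Ω : Set E3} (hΩ : IsSmoothBoundedDomain Ω)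
    (A : (vecLaplacian Ω).domain) : 0 ≤ ⟪(A : L2Field Ω), vecLaplacian Ω A⟫_ℝ := by
  obtain ⟨v, hv, hw⟩ := exists_sobolev_of_domain hΩ A
  rw [real_inner_comm, ← hv, hw v, real_inner_self_eq_norm_sq, real_inner_self_eq_norm_sq,
    norm_sq_sobolevSpace, add_sub_cancel_left]
  positivity

theorem denseRange_sobolevEmbedding {Ω : Set E3} (hΩ : IsSmoothBoundedDomain Ω) :
    DenseRange (sobolevEmbedding Ω) := by
  refine (dense_domain_vecLaplacian hΩ).mono fun A hA => ?_
  obtain ⟨v, hv, -⟩ := exists_sobolev_of_domain hΩ ⟨A, hA⟩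
  exact ⟨v, hv⟩

theorem isCompactOperator_sobolevEmbedding {Ω : Set E3} (hΩ : IsSmoothBoundedDomain Ω) :
    IsCompactOperator (sobolevEmbedding Ω) := by
  have h := isCompactOperator_of_tendsto_zero (V := sobolevSpace Ω) (sobolevEmbedding Ω)
  exact h (tendsto_sobolevEmbedding_zero hΩ)

/-- The Friedrichs extension of the vector Laplacian. -/
theorem exists_selfAdjoint_extension {Ω : Set E3} (hΩ : IsSmoothBoundedDomain Ω) :
    ∃ T : L2Field Ω →ₗ.[ℝ] L2Field Ω, vecLaplacian Ω ≤ T ∧ IsSelfAdjoint T ∧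
      (∀ A : T.domain, IsWeakSolution Ω (A : L2Field Ω) (T A)) ∧
      (∀ z : ℝ, z < 0 → ∃ R : L2Field Ω →L[ℝ] L2Field Ω,
        IsResolvent T z R ∧ IsCompactOperator R ∧ IsSelfAdjoint R) ∧
      HasDiscreteSpectrum T ∧
      ∃ δ : ℝ, 0 < δ ∧ ∀ A : T.domain,
        δ * ‖(A : L2Field Ω)‖ ^ 2 ≤ ⟪(A : L2Field Ω), T A⟫_ℝ := by
  obtain ⟨C, hC, hJ⟩ := exists_poincare_constant hΩ
  have h := exists_operator_of_form (V := sobolevSpace Ω) (sobolevEmbedding Ω)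
  obtain ⟨T, hsa, hform, hgraph, hres, hspec, hδ⟩ := h
    (isCompactOperator_sobolevEmbedding hΩ) (denseRange_sobolevEmbedding hΩ) hC hJ
  refine ⟨T, LinearPMap.le_of_le_graph ?_, hsa, fun A => ?_, hres, hspec, hδ⟩
  · rintro ⟨A, F⟩ hAF
    rw [graph_vecLaplacian hΩ.isOpen] at hAF
    obtain ⟨u, hu, h1, h2⟩ := hAF
    obtain ⟨v, rfl, -, hw⟩ := exists_sobolev_of_smoothFields hΩ hu h1 h2
    exact hgraph v F hw
  · obtain ⟨v, hv, hw⟩ := hform A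
    have hvV := (mem_sobolevSpace hΩ.isOpen hΩ.isBounded _).1 v.2
    rw [← hv]
    refine ⟨fun k => (v : FieldPair Ω).snd k, hvV.1, hvV.2, fun B H hB hBz => ?_⟩
    obtain ⟨w, rfl, hwH⟩ := exists_sobolevEmbedding_eq hΩ.isOpen hΩ.isBounded hB hBz
    rw [hw w, inner_sobolevSpace, add_sub_cancel_left]
    simp only [hwH]

theorem exists_poincare_bound {Ω : Set E3} (hΩ : IsSmoothBoundedDomain Ω) :
    ∃ C : ℝ, 0 < C ∧ ∀ (A : L2Field Ω) (G : Fin 3 → L2Field Ω),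
      IsWeakGradient Ω A G → HasZeroTangentialPart Ω A G →
        ‖A‖ ^ 2 ≤ C * ∑ k : Fin 3, ‖G k‖ ^ 2 := by
  obtain ⟨C, hC, hJ⟩ := exists_poincare_constant hΩ
  refine ⟨C, hC, fun A G hA hz => ?_⟩
  obtain ⟨v, rfl, hvG⟩ := exists_sobolevEmbedding_eq hΩ.isOpen hΩ.isBounded hA hz
  have h := hJ v
  rw [norm_sq_sobolevSpace, add_sub_cancel_left] at h
  simpa only [hvG] using h

end VectorLaplacian

end

open VectorLaplacian in
theorem mainTheorem3 (Ω : Set E3) (hΩ : IsSmoothBoundedDomain Ω) :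
    -- the domain of `Λ = -Δ` is dense, and `Λ` is symmetric and nonnegative
    Dense ((vecLaplacian Ω).domain : Set (L2Field Ω)) ∧
    (∀ A B : (vecLaplacian Ω).domain,
      ⟪vecLaplacian Ω A, (B : L2Field Ω)⟫_ℝ = ⟪(A : L2Field Ω), vecLaplacian Ω B⟫_ℝ) ∧
    (∀ A : (vecLaplacian Ω).domain, 0 ≤ ⟪(A : L2Field Ω), vecLaplacian Ω A⟫_ℝ) ∧
    -- the energy identity
    (∀ (A : (vecLaplacian Ω).domain) (u : E3 → E3), u ∈ smoothFields Ω →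
      (A : L2Field Ω) =ᵐ[volume.restrict Ω] u →
        ⟪(A : L2Field Ω), vecLaplacian Ω A⟫_ℝ
          = ∑ k : Fin 3, ∫ x in Ω, ‖partialDeriv k u x‖ ^ 2) ∧
    -- a coercive self-adjoint extension with discrete spectrum
    (∃ T : L2Field Ω →ₗ.[ℝ] L2Field Ω, vecLaplacian Ω ≤ T ∧ IsSelfAdjoint T ∧
      (∀ A : T.domain, IsWeakSolution Ω (A : L2Field Ω) (T A)) ∧
      (∀ z : ℝ, z < 0 → ∃ R : L2Field Ω →L[ℝ] L2Field Ω,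
        IsResolvent T z R ∧ IsCompactOperator R ∧ IsSelfAdjoint R) ∧
      HasDiscreteSpectrum T ∧
      ∃ δ : ℝ, 0 < δ ∧ ∀ A : T.domain,
        δ * ‖(A : L2Field Ω)‖ ^ 2 ≤ ⟪(A : L2Field Ω), T A⟫_ℝ) ∧
    -- the Poincare-type bound
    (∃ C : ℝ, 0 < C ∧ ∀ (A : L2Field Ω) (G : Fin 3 → L2Field Ω),
      IsWeakGradient Ω A G → HasZeroTangentialPart Ω A G →
        ‖A‖ ^ 2 ≤ C * ∑ k : Fin 3, ‖G k‖ ^ 2) := by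
  exact ⟨dense_domain_vecLaplacian hΩ, inner_vecLaplacian_comm hΩ,
    inner_vecLaplacian_self_nonneg hΩ, fun A _ hu hA => inner_vecLaplacian_self hΩ A hu hA,
    exists_selfAdjoint_extension hΩ, exists_poincare_bound hΩ⟩
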